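/- Let $k$ be a field, $R=k[x_0,\dots,x_n]$ with its standard grading, let $2\le c<s$ be integers, and let $F_1,\dots,F_s\in R$ be forms, all of the same degree $\delta$, such that any $c+1$ of them form a regular sequence. Let $$I_c=\bigcap_{1\le j_1<\dots<j_c\le s}(F_{j_1},\dots,F_{j_c})$$ be the ideal of the star configuration of height $c$ on $F_1,\dots,F_s$, and for $m>1$ let $I_c^{(m)}=\bigcap_{P\in \mathrm{Ass}(R/I_c)}\left(I_c^mR_P\cap R\right)$ be its $m$-th symbolic power. Let $\beta_{i,j}=\beta_{i,j}(R/I_c^{(m)})$ denote the graded Betti numbers of $R/I_c^{(m)}$, i.e. the number of copies of $R(-j)$ in homological degree $i$ of a minimal graded free resolution of $R/I_c^{(m)}$ over $R$ (such resolutions exist and all of them give the same numbers considered below). Binomial coefficients $\binom{a}{b}$ with $b<0$ are $0$. Let $1\le i\le c$. 1. For every integer $t$ with $\lceil m/2\rceil<t\le m$ and $j=\delta\,(t(s-c)+m+i-1)$, $$\beta_{i,j}=\binom{c-1}{i-1}\binom{c-2+m-t}{c-2}\binom{s}{c-1}.$$ 2. Let $t=\lceil m/2\rceil$ and $j_i=\delta\,(t(s-c)+m+i-1)$.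 (a) If $m$ is odd, then $$\beta_{i,j_i}=\binom{c-1}{i-1}\binom{c-2+m-t}{c-2}\binom{s}{c-1}-\binom{c-2}{i-2}\binom{s}{c-2}.$$ (b) If $m=2$, then $$\beta_{i,j_i}=\binom{s}{c-1-i}\binom{s-c+i}{i-1}.$$ (c) If $m=4$, then $$\beta_{i,j_i}=\binom{c-2}{i-1}\binom{s}{c-2}+\binom{s}{c-3}\left[\binom{c-3}{i-1}+\binom{c-2}{i-1}(s-c+1)+\binom{c-1}{i-1}\binom{s-c+2}{2}\right].$$ (d) If $m$ is even and $m>4$, then $$\beta_{i,j_i}=\binom{c-2}{i-1}\binom{s}{c-2}+\binom{c-1}{i-1}\binom{s}{c-1}\left[\binom{c-2+t}{t}-(c-1)\right]-\binom{c-2}{i-2}\binom{s}{c-3}(s-c+3).$$ -/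

import Mathlib

/-- The binomial coefficient `a choose b` for integers `a`, `b`, with the convention that it is `0`
whenever `b < 0`. For natural numbers `a`, `b` it is `Nat.choose a b`. -/
def binom (a b : ℤ) : ℤ :=
  if b < 0 then 0 else Ring.choose a b.toNat

/-- The `m`-th symbolic power of an ideal `I`: the intersection of the contractions
`I ^ m R_P ∩ R`, where `P` runs through the associated primes of `R ⧸ I`. -/
noncomputable def symbolicPower {R : Type*} [CommRing R] (I : Ideal R) (m : ℕ) : Ideal R :=
  ⨅ P : {P : Ideal R // P ∈ associatedPrimes R (R ⧸ I)},
    haveI : P.1.IsPrime := P.2.1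
    ((I ^ m).map (algebraMap R (Localization.AtPrime P.1))).comap
      (algebraMap R (Localization.AtPrime P.1))

/-- The ideal of the star configuration of height `c` on the family `F`: the intersection of the
ideals generated by `c` members of the family. -/
noncomputable def starIdeal {R : Type*} [CommRing R] {s : ℕ} (F : Fin s → R) (c : ℕ) : Ideal R :=
  ⨅ A ∈ Finset.powersetCard c (Finset.univ : Finset (Fin s)), Ideal.span (F '' (A : Set (Fin s)))

/-- Any `r` members (with distinct indices) of the family `F` form a regular sequence. -/
def AnyFormRegularSequence {R : Type*} [CommRing R] {s : ℕ} (F : Fin s → R) (r : ℕ) : Prop :=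
  ∀ e : Fin r → Fin s, Function.Injective e →
    RingTheory.Sequence.IsRegular R (List.ofFn fun a => F (e a))

/-- A minimal graded free resolution
`⋯ → F₂ → F₁ → F₀ → R ⧸ J → 0` of `R ⧸ J` over the standard graded polynomial ring
`R = k[xᵢ : i ∈ σ]`, with `Fᵢ = ⨁_q R(-deg i q)` of finite rank `rank i`. -/
structure MinimalGradedFreeResolution {σ k : Type*} [Field k] (J : Ideal (MvPolynomial σ k)) where
  /-- The rank of the `i`-th free module. -/
  rank : ℕ → ℕ
  /-- The degrees of the basis elements of the `i`-th free module. -/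
  deg : (i : ℕ) → Fin (rank i) → ℕ
  /-- The differential from the `(i+1)`-st to the `i`-th free module. -/
  diff : (i : ℕ) → (Fin (rank (i + 1)) → MvPolynomial σ k) →ₗ[MvPolynomial σ k]
    (Fin (rank i) → MvPolynomial σ k)
  /-- The augmentation. -/
  aug : (Fin (rank 0) → MvPolynomial σ k) →ₗ[MvPolynomial σ k] (MvPolynomial σ k ⧸ J)
  /-- The differentials are homogeneous of degree `0`: the `(p, q)` entry of the matrix has degree
  `deg (i + 1) q - deg i p`. -/
  diff_homogeneous : ∀ i p q, diff i (Pi.single q 1) p = 0 ∨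
    ∃ e : ℕ, deg i p + e = deg (i + 1) q ∧ (diff i (Pi.single q 1) p).IsHomogeneous e
  /-- The augmentation is homogeneous of degree `0`. -/
  aug_homogeneous : ∀ q, ∃ f : MvPolynomial σ k,
    f.IsHomogeneous (deg 0 q) ∧ aug (Pi.single q 1) = Ideal.Quotient.mk J f
  /-- Exactness at `R ⧸ J`. -/
  aug_surjective : Function.Surjective aug
  /-- Exactness at `F₀`. -/
  exact_zero : Function.Exact (diff 0) aug
  /-- Exactness at `Fᵢ₊₁`. -/
  exact_succ : ∀ i, Function.Exact (diff (i + 1)) (diff i)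
  /-- Minimality: all matrix entries lie in the homogeneous maximal ideal. -/
  minimal : ∀ i p q, MvPolynomial.constantCoeff (diff i (Pi.single q 1) p) = 0

/-- The graded Betti number `β_{i,j}` read off a minimal graded free resolution: the number of
copies of `R(-j)` in homological degree `i`. -/
def MinimalGradedFreeResolution.betti {σ k : Type*} [Field k] {J : Ideal (MvPolynomial σ k)}
    (G : MinimalGradedFreeResolution J) (i j : ℕ) : ℕ :=
  (Finset.univ.filter fun q => G.deg i q = j).card

/-! Write F^γ for the monomial in the forms with exponent γ. The symbolic power is generated by the
F^γ for which the `c` smallest entries of γ sum to `m` and fewer than `c` entries lie below the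
maximum (`IsStarGen`), exactly as if the forms were variables (`symbolicPower_starIdeal`). Ordered
by degree and then by a weight, these generators have linear quotients: the colon of the preceding
ones by F^γ is generated by the F_a with a in `genDirs γ`. Mapping cones over Koszul complexes
therefore give a resolution, minimal for degree reasons (`exists_star_resolution`). As F^γ has
degree δ(m + (s-c)t) with t the largest entry of γ, the Betti number in question is the sum of
C(|genDirs γ|, i-1) over the generators with largest entry t (`betti_eq_sum_topExp`).

Only `c+1` forms at a time are regular, so the passage from variables to forms is not a flat base
change. It works because every colon that occurs is generated by at most `c` variables. The list of
generators is continued by apices of cones that cover the complement of the monomial ideal, until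
the unit ideal is reached (`isConeSystem_star`). Vanishing of Tor₁ is trivial for the unit ideal and
descends along this list (`TorIndependent.of_insert`); it identifies the colon at each stage with
the expected one (`TorIndependent.mem_of_mul_mem`).

For the count, let t ≤ m ≤ 2t. A generator with largest entry t consists of a set D of `c-1` low
positions with values below t and sum m-t; if m = 2t, also `c-2` low positions with value 0 are
possible. A low position is missing from `genDirs` exactly when its value is t-1 and it precedes
every position outside D. On D with `c-1` elements the value t-1 never occurs if t > ⌈m/2⌉; it
occurs at most once if m is odd, m > 1 and t = ⌈m/2⌉, or if m = 2t with t > 2; and it can occur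
twice if m = 4. This is the source of the case distinction. -/

open MvPolynomial

/-! ### Monomials in regular elements: Tor-independence and colon ideals -/

section MonomialSyzygies

variable {ι R : Type*} [CommRing R]

/-- The ideal of `R[y_i : i ∈ ι]` generated by the monomials with exponents in `U`. -/
noncomputable def monomialSpan (R : Type*) [CommRing R] (U : Set (ι →₀ ℕ)) :
    Ideal (MvPolynomial ι R) :=
  Ideal.span (Set.image (fun u => monomial u (1 : R)) U)

/-- The ideal of `R` generated by the monomials in the family `F` with exponents in `U`. -/
noncomputable def monomialIdeal (F : ι → R) (U : Set (ι →₀ ℕ)) : Ideal R :=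
  Ideal.span ((fun u : ι →₀ ℕ => u.prod fun i e => F i ^ e) '' U)

theorem map_monomialSpan (F : ι → R) (U : Set (ι →₀ ℕ)) :
    (monomialSpan R U).map (aeval F : MvPolynomial ι R →ₐ[R] R) = monomialIdeal F U := by
  rw [monomialSpan, Ideal.map_span, monomialIdeal, Set.image_image]
  congr 1
  ext x
  simp [aeval_monomial]

theorem aeval_mem_monomialIdeal {F : ι → R} {U : Set (ι →₀ ℕ)} {f : MvPolynomial ι R}
    (hf : f ∈ monomialSpan R U) : aeval F f ∈ monomialIdeal F U := by
  rw [← map_monomialSpan]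
  exact Ideal.mem_map_of_mem _ hf

theorem exists_of_mem_monomialIdeal {F : ι → R} {U : Set (ι →₀ ℕ)} {x : R}
    (hx : x ∈ monomialIdeal F U) : ∃ f ∈ monomialSpan R U, aeval F f = x := by
  rw [← map_monomialSpan, Ideal.mem_map_iff_of_surjective] at hx
  · exact hx
  · exact fun r => ⟨C r, by simp⟩

theorem monomialSpan_mono {U V : Set (ι →₀ ℕ)} (h : ∀ u ∈ U, ∃ v ∈ V, v ≤ u) :
    monomialSpan R U ≤ monomialSpan R V := by
  classical
  refine Ideal.span_le.2 ?_
  rintro _ ⟨u, hu, rfl⟩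
  refine mem_ideal_span_monomial_image.2 fun x hx => ?_
  obtain ⟨v, hv, hvu⟩ := h u hu
  have : x = u := by
    by_contra hne
    simp [coeff_monomial, Ne.symm hne] at hx
  exact ⟨v, hv, this ▸ hvu⟩

theorem monomialIdeal_mono {F : ι → R} {U V : Set (ι →₀ ℕ)} (h : ∀ u ∈ U, ∃ v ∈ V, v ≤ u) :
    monomialIdeal F U ≤ monomialIdeal F V := by
  rw [← map_monomialSpan, ← map_monomialSpan]
  exact Ideal.map_mono (monomialSpan_mono h)

/-- The kernel of the evaluation `R[y] → R` at the family `F`. -/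
noncomputable def evalKer (F : ι → R) : Ideal (MvPolynomial ι R) :=
  RingHom.ker (aeval F : MvPolynomial ι R →ₐ[R] R)

theorem mem_evalKer {F : ι → R} {f : MvPolynomial ι R} : f ∈ evalKer F ↔ aeval F f = 0 :=
  Iff.rfl

/-- The relations among the monomials with exponents in `U` evaluated at the family `F`
are generated by the relations among the monomials in independent variables; equivalently
`Tor₁(R[y] ⧸ (U), R) = 0`. -/
def TorIndependent (F : ι → R) (U : Set (ι →₀ ℕ)) : Prop :=
  monomialSpan R U ⊓ evalKer F ≤ monomialSpan R U * evalKer F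

/-- Each `F b` with `b ∉ A` is a nonzerodivisor modulo the `F a` with `a ∈ A`,
for all `A` with at most `c` elements. -/
def RegularUpTo (F : ι → R) (c : ℕ) : Prop :=
  ∀ A : Finset ι, A.card ≤ c → ∀ b ∉ A, ∀ x, x * F b ∈ Ideal.span (F '' (A : Set ι)) →
    x ∈ Ideal.span (Set.image F A)

/-- The exponents of the variables with index in `A`. -/
def varExps (A : Set ι) : Set (ι →₀ ℕ) := (fun a => Finsupp.single a 1) '' A

theorem monomialSpan_varExps (A : Set ι) :
    monomialSpan R (varExps A) = Ideal.span (X '' A) := by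
  rw [monomialSpan, varExps, Set.image_image]
  rfl

theorem monomialIdeal_varExps (F : ι → R) (A : Set ι) :
    monomialIdeal F (varExps A) = Ideal.span (F '' A) := by
  rw [← map_monomialSpan, monomialSpan_varExps, Ideal.map_span, Set.image_image]
  simp

theorem exists_sum_eq_of_mem_span_image {S : Type*} [CommRing S] {f : ι → S} {A : Finset ι} {x : S}
    (hx : x ∈ Ideal.span (f '' (A : Set ι))) : ∃ g : ι → S, ∑ a ∈ A, g a * f a = x := by
  classical
  obtain ⟨g, hg⟩ := (Submodule.mem_span_image_finset_iff_exists_fun S).1 hx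
  refine ⟨fun a => if h : a ∈ A then g ⟨a, h⟩ else 0, ?_⟩
  rw [← hg, ← Finset.sum_coe_sort A]
  exact Finset.sum_congr rfl fun a _ => by simp

/-- Relations on a regular sequence are generated by the Koszul relations, and the Koszul relation
of a and b lifts to X_a (X_b - F_b) - X_b (X_a - F_a), which lies in the product ideal. -/
theorem sum_X_mul_C_mem {F : ι → R} {c : ℕ} (hF : RegularUpTo F c) (A : Finset ι)
    (hA : A.card ≤ c + 1) (h : ι → R) (hh : ∑ a ∈ A, F a * h a = 0) :
    ∑ a ∈ A, X a * C (h a) ∈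
      Ideal.span (X '' (A : Set ι)) * evalKer F := by
  classical
  induction A using Finset.induction_on generalizing h with
  | empty => simp
  | insert b A hb ih =>
    rw [Finset.card_insert_of_notMem hb] at hA
    rw [Finset.sum_insert hb] at hh
    have h1 : h b * F b ∈ Ideal.span (F '' (A : Set ι)) := by
      have : h b * F b = - ∑ a ∈ A, F a * h a := by linear_combination hh
      rw [this]
      exact neg_mem (sum_mem fun a ha =>
        Ideal.mul_mem_right _ _ (Ideal.subset_span ⟨a, ha, rfl⟩))
    have h2 := hF A (by omega) b hb _ h1
    obtain ⟨g, hg⟩ := exists_sum_eq_of_mem_span_image h2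
    -- Writing h b = ∑ g a * F a eliminates b from the relation, at the cost of Koszul terms.
    have h3 : ∑ a ∈ A, F a * (h a + F b * g a) = 0 := by
      simp only [mul_add, Finset.sum_add_distrib]
      have : ∑ a ∈ A, F a * (F b * g a) = F b * h b := by
        rw [← hg, Finset.mul_sum]
        exact Finset.sum_congr rfl fun a _ => by ring
      rw [this]; linear_combination hh
    have h4 := ih (by omega) _ h3
    have hsub : Ideal.span (X '' (A : Set ι)) * evalKer F ≤
        Ideal.span (X '' ((insert b A : Finset ι) : Set ι)) * evalKer F := by
      refine Ideal.mul_mono_left (Ideal.span_mono (Set.image_mono ?_))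
      simp
    have h5 : X b * C (h b) - ∑ a ∈ A, X a * C (F b * g a) ∈
        Ideal.span (X '' ((insert b A : Finset ι) : Set ι)) * evalKer F := by
      rw [← hg, map_sum, Finset.mul_sum, ← Finset.sum_sub_distrib]
      refine sum_mem fun a ha => ?_
      have : X b * C (g a * F a) - X a * C (F b * g a) =
          C (g a) * (X a * (X b - C (F b)) - X b * (X a - C (F a))) := by
        simp only [map_mul]; ring
      rw [this]
      refine Ideal.mul_mem_left _ _ (sub_mem (Ideal.mul_mem_mul ?_ ?_) (Ideal.mul_mem_mul ?_ ?_))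
      · exact Ideal.subset_span ⟨a, by simp [ha], rfl⟩
      · simp [mem_evalKer]
      · exact Ideal.subset_span ⟨b, by simp, rfl⟩
      · simp [mem_evalKer]
    rw [Finset.sum_insert hb]
    convert add_mem h5 (hsub h4) using 1
    simp only [map_add, mul_add, Finset.sum_add_distrib]
    ring

theorem torIndependent_varExps {F : ι → R} {c : ℕ} (hF : RegularUpTo F c) (A : Finset ι)
    (hA : A.card ≤ c + 1) : TorIndependent F (varExps (A : Set ι)) := by
  classical
  rintro f ⟨hf, hfK⟩
  rw [monomialSpan_varExps] at hf ⊢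
  obtain ⟨g, rfl⟩ := exists_sum_eq_of_mem_span_image hf
  have hfK : aeval F _ = 0 := hfK
  simp only [map_sum, map_mul, aeval_X] at hfK
  have h1 := sum_X_mul_C_mem hF A hA (fun a => aeval F (g a))
    (by rw [← hfK]; exact Finset.sum_congr rfl fun a _ => mul_comm _ _)
  have h2 : ∑ a ∈ A, X a * (g a - C (aeval F (g a))) ∈
      Ideal.span (X '' (A : Set ι)) * evalKer F := by
    refine sum_mem fun a ha => Ideal.mul_mem_mul (Ideal.subset_span ⟨a, ha, rfl⟩) ?_
    simp [mem_evalKer]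
  convert add_mem h1 h2 using 1
  rw [← Finset.sum_add_distrib]
  exact Finset.sum_congr rfl fun a _ => by ring

/-- The monomial ideal generated by `U` satisfies `(U) : y^N = (y_a : a ∈ A)`. -/
structure VarColon (U : Set (ι →₀ ℕ)) (N : ι →₀ ℕ) (A : Finset ι) : Prop where
  le : ∀ a ∈ A, ∃ u ∈ U, u ≤ N + Finsupp.single a 1
  not_le : ∀ x, (∀ a ∈ A, x a = 0) → ∀ u ∈ U, ¬ u ≤ N + x

theorem VarColon.mem_span_X {U : Set (ι →₀ ℕ)} {N : ι →₀ ℕ} {A : Finset ι}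
    (h : VarColon U N A) {g : MvPolynomial ι R} (hg : monomial N 1 * g ∈ monomialSpan R U) :
    g ∈ Ideal.span (X '' (A : Set ι)) := by
  classical
  rw [mem_ideal_span_X_image]
  intro x hx
  by_contra! hcon
  obtain ⟨u, hu, hux⟩ := mem_ideal_span_monomial_image.1 hg (N + x) (by
    rw [mem_support_iff] at hx ⊢
    rwa [coeff_monomial_mul, one_mul])
  exact h.not_le x hcon u hu hux

theorem VarColon.monomial_mul_mem {U : Set (ι →₀ ℕ)} {N : ι →₀ ℕ} {A : Finset ι}
    (h : VarColon U N A) : Ideal.span {monomial N (1 : R)} * Ideal.span (X '' (A : Set ι)) ≤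
      monomialSpan R U := by
  rw [Ideal.span_mul_span, Ideal.span_le]
  rintro _ ⟨_, rfl, _, ⟨a, ha, rfl⟩, rfl⟩
  obtain ⟨u, hu, hle⟩ := h.le a ha
  have : monomial N (1 : R) * X a = monomial (N + Finsupp.single a 1) 1 := by
    rw [X, monomial_mul, one_mul]
  simp only [this]
  refine monomialSpan_mono (U := {N + Finsupp.single a 1}) ?_
    (Ideal.subset_span ⟨_, rfl, rfl⟩)
  rintro _ rfl
  exact ⟨u, hu, hle⟩

theorem monomialSpan_insert (U : Set (ι →₀ ℕ)) (N : ι →₀ ℕ) :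
    monomialSpan R (insert N U) = Ideal.span {monomial N 1} ⊔ monomialSpan R U := by
  rw [monomialSpan, Set.image_insert_eq, Ideal.span_insert, monomialSpan]

theorem monomialIdeal_insert (F : ι → R) (U : Set (ι →₀ ℕ)) (N : ι →₀ ℕ) :
    monomialIdeal F (insert N U) =
      Ideal.span {N.prod fun i e => F i ^ e} ⊔ monomialIdeal F U := by
  rw [monomialIdeal, Set.image_insert_eq, Ideal.span_insert, monomialIdeal]

/-- In the exact sequence 0 → R[y]/(y_A) → R[y]/(U) → R[y]/(U, y^N) → 0, Tor₁ against R vanishes at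
both ends, hence in the middle. The proof is this diagram chase on elements. -/
theorem TorIndependent.of_insert {F : ι → R} {c : ℕ} (hF : RegularUpTo F c)
    {U : Set (ι →₀ ℕ)} {N : ι →₀ ℕ} {A : Finset ι} (hA : A.card ≤ c + 1) (h : VarColon U N A)
    (hT : TorIndependent F (insert N U)) : TorIndependent F U := by
  rintro f ⟨hf, hfK⟩
  have hf' : f ∈ monomialSpan R (insert N U) := by
    rw [monomialSpan_insert]
    exact Submodule.mem_sup_right hf
  have h1 := hT ⟨hf', hfK⟩
  rw [monomialSpan_insert, Ideal.sup_mul, Submodule.mem_sup] at h1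
  obtain ⟨x, hx, y, hy, rfl⟩ := h1
  obtain ⟨g, hg, rfl⟩ := Ideal.mem_span_singleton_mul.1 hx
  refine add_mem ?_ hy
  have h2 : monomial N 1 * g ∈ monomialSpan R U :=
    (Ideal.add_mem_iff_left _ (Ideal.mul_le_left hy)).1 hf
  have h3 := h.mem_span_X h2
  have h4 := torIndependent_varExps hF A hA ⟨by rwa [monomialSpan_varExps], hg⟩
  rw [monomialSpan_varExps] at h4
  refine Ideal.mul_mono_left h.monomial_mul_mem ?_
  rw [mul_assoc]
  exact Ideal.mul_mem_mul (Ideal.mem_span_singleton_self _) h4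

/-- In the same sequence, vanishing of Tor₁ at the right end keeps multiplication by y^N injective
after specializing y to `F`. -/
theorem TorIndependent.mem_of_mul_mem {F : ι → R}
    {U : Set (ι →₀ ℕ)} {N : ι →₀ ℕ} {A : Finset ι} (h : VarColon U N A)
    (hT : TorIndependent F (insert N U)) {x : R}
    (hx : x * (N.prod fun i e => F i ^ e) ∈ monomialIdeal F U) :
    x ∈ Ideal.span (F '' (A : Set ι)) := by
  obtain ⟨f, hf, hfx⟩ := exists_of_mem_monomialIdeal hx
  have h1 : monomial N 1 * C x - f ∈ monomialSpan R (insert N U) := by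
    rw [monomialSpan_insert]
    exact sub_mem (Submodule.mem_sup_left
      (Ideal.mul_mem_right _ _ (Ideal.mem_span_singleton_self _))) (Submodule.mem_sup_right hf)
  have h2 : monomial N 1 * C x - f ∈ evalKer F := by
    rw [mem_evalKer, map_sub, hfx, map_mul, aeval_monomial, aeval_C]
    simp [mul_comm]
  have h3 := hT ⟨h1, h2⟩
  rw [monomialSpan_insert, Ideal.sup_mul, Submodule.mem_sup] at h3
  obtain ⟨y, hy, z, hz, hyz⟩ := h3
  obtain ⟨g, hg, rfl⟩ := Ideal.mem_span_singleton_mul.1 hy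
  have h4 : monomial N 1 * (C x - g) ∈ monomialSpan R U := by
    have : monomial N 1 * (C x - g) = f + z := by linear_combination -hyz
    rw [this]
    exact add_mem hf (Ideal.mul_le_left hz)
  have h5 := aeval_mem_monomialIdeal (F := F)
    (by rw [monomialSpan_varExps]; exact h.mem_span_X h4)
  rw [monomialIdeal_varExps, map_sub, mem_evalKer.1 hg, aeval_C] at h5
  simpa using h5

theorem VarColon.mul_mem {F : ι → R} {U : Set (ι →₀ ℕ)} {N : ι →₀ ℕ} {A : Finset ι}
    (h : VarColon U N A) {x : R} (hx : x ∈ Ideal.span (F '' (A : Set ι))) :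
    x * (N.prod fun i e => F i ^ e) ∈ monomialIdeal F U := by
  rw [← monomialIdeal_varExps] at hx
  obtain ⟨f, hf, rfl⟩ := exists_of_mem_monomialIdeal hx
  rw [monomialSpan_varExps] at hf
  have h1 := aeval_mem_monomialIdeal (F := F) (h.monomial_mul_mem
    (Ideal.mul_mem_mul (Ideal.mem_span_singleton_self _) hf))
  rw [map_mul, aeval_monomial] at h1
  simpa [mul_comm] using h1

theorem torIndependent_of_zero_mem (F : ι → R) {U : Set (ι →₀ ℕ)} (h : 0 ∈ U) :
    TorIndependent F U := by
  have : monomialSpan R U = ⊤ :=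
    (Ideal.eq_top_iff_one _).2 (Ideal.subset_span ⟨0, h, rfl⟩)
  rw [TorIndependent, this]
  simp [Ideal.top_mul]

end MonomialSyzygies

/-! ### Cone decompositions and descent from the unit ideal -/

section ConeSystems

variable {ι κ α : Type*} [LinearOrder α]

/-- A family of exponents `N g` with sets of directions `A g`, ranked by `α`, such that the cones
`N g + ℕ^(ι ∖ A g)` are pairwise disjoint, and each step `N g + e_a` with `a ∈ A g` dominates an
exponent of the family of smaller rank. -/
structure IsConeSystem (Γ : Set κ) (N : κ → ι →₀ ℕ) (A : κ → Finset ι) (rank : κ → α) :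
    Prop where
  step : ∀ g ∈ Γ, ∀ a ∈ A g, ∃ h ∈ Γ, N h ≤ N g + Finsupp.single a 1 ∧ rank h < rank g
  unique : ∀ g ∈ Γ, ∀ h ∈ Γ, ∀ x, N g ≤ x → (∀ a ∈ A g, x a = N g a) →
    N h ≤ x → (∀ a ∈ A h, x a = N h a) → g = h

/-- A finite subfamily containing with each member all members of smaller rank. -/
structure IsInitial (Γ : Set κ) (rank : κ → α) (D : Finset κ) : Prop where
  subset : ∀ g ∈ D, g ∈ Γ
  mem : ∀ g ∈ D, ∀ h ∈ Γ, rank h < rank g → h ∈ D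

variable {Γ : Set κ} {N : κ → ι →₀ ℕ} {A : κ → Finset ι} {rank : κ → α}

/-- If x has left the cone of g in a direction of `A g`, then `step` supplies an exponent of smaller
rank that is still below x; well-foundedness ends the walk. -/
theorem IsConeSystem.exists_cone [WellFoundedLT α] (hΓ : IsConeSystem Γ N A rank) (g : κ)
    (hg : g ∈ Γ) (x : ι →₀ ℕ) (hx : N g ≤ x) :
    ∃ h ∈ Γ, N h ≤ x ∧ (∀ a ∈ A h, x a = N h a) ∧ (h = g ∨ rank h < rank g) := by
  induction hr : rank g using WellFoundedLT.induction generalizing g with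
  | ind r ih =>
    subst hr
    by_cases hc : ∀ a ∈ A g, x a = N g a
    · exact ⟨g, hg, hx, hc, Or.inl rfl⟩
    · push Not at hc
      obtain ⟨a, ha, hxa⟩ := hc
      obtain ⟨h, hh, hle, hlt⟩ := hΓ.step g hg a ha
      have : N g + Finsupp.single a 1 ≤ x := by
        classical
        intro i
        have hi := hx i
        rw [Finsupp.add_apply, Finsupp.single_apply]
        split_ifs with h
        · subst h
          have := lt_of_le_of_ne hi (Ne.symm hxa)
          omega
        · simpa using hi
      obtain ⟨h', h1, h2, h3, h4⟩ := ih _ hlt h hh (hle.trans this) rfl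
      exact ⟨h', h1, h2, h3, Or.inr (h4.elim (fun e => e ▸ hlt) fun e => e.trans hlt)⟩

/-- If N h divided N g + x with h in D, the walk from h would end at a cone containing N g + x,
which by disjointness is that of g. But g is not in D, nor is its rank below that of h. Ties of rank
do no harm. -/
theorem IsConeSystem.varColon [WellFoundedLT α] (hΓ : IsConeSystem Γ N A rank) {D : Finset κ}
    (hD : ∀ h ∈ D, h ∈ Γ) {g : κ} (hg : g ∈ Γ) (hgD : g ∉ D)
    (h1 : ∀ h ∈ Γ, rank h < rank g → h ∈ D) (h2 : ∀ h ∈ D, rank h ≤ rank g) :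
    VarColon (N '' D) (N g) (A g) where
  le a ha := by
    obtain ⟨h, hh, hle, hlt⟩ := hΓ.step g hg a ha
    exact ⟨N h, ⟨h, h1 h hh hlt, rfl⟩, hle⟩
  not_le := by
    rintro x hx _ ⟨h, hh, rfl⟩ hle
    obtain ⟨h', h3, h4, h5, h6⟩ := hΓ.exists_cone h (hD h hh) _ hle
    have := hΓ.unique g hg h' h3 (N g + x) le_self_add (fun a ha => by simp [hx a ha]) h4 h5
    subst this
    rcases h6 with rfl | h6
    · exact hgD hh
    · exact absurd h6 (not_lt.2 (h2 h hh))

theorem exists_mem_sdiff_min (hfin : Γ.Finite) {D : Finset κ} (hD : IsInitial Γ rank D)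
    (hne : ∃ g ∈ Γ, g ∉ D) :
    ∃ g ∈ Γ, g ∉ D ∧ (∀ h ∈ Γ, rank h < rank g → h ∈ D) ∧ (∀ h ∈ D, rank h ≤ rank g) := by
  classical
  have hne' : (hfin.toFinset \ D).Nonempty := by
    obtain ⟨g, hg, hgD⟩ := hne
    exact ⟨g, by simp [hg, hgD]⟩
  obtain ⟨g, hg, hmin⟩ := Finset.exists_min_image _ rank hne'
  simp only [Finset.mem_sdiff, Set.Finite.mem_toFinset] at hg hmin
  refine ⟨g, hg.1, hg.2, fun h hh hlt => ?_, fun h hh => ?_⟩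
  · by_contra hcon
    exact absurd hlt (not_lt.2 (hmin h ⟨hh, hcon⟩))
  · by_contra! hlt
    exact hg.2 (hD.mem h hh g hg.1 hlt)

theorem IsInitial.insert [DecidableEq κ] {D : Finset κ} (hD : IsInitial Γ rank D) {g : κ}
    (hg : g ∈ Γ) (h1 : ∀ h ∈ Γ, rank h < rank g → h ∈ D) : IsInitial Γ rank (insert g D) where
  subset h hh := by
    rcases Finset.mem_insert.1 hh with rfl | hh
    exacts [hg, hD.subset h hh]
  mem h hh g₁ hg₁ hlt := by
    rcases Finset.mem_insert.1 hh with rfl | hh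
    exacts [Finset.mem_insert_of_mem (h1 g₁ hg₁ hlt),
      Finset.mem_insert_of_mem (hD.mem h hh g₁ hg₁ hlt)]

/-- Induction over the initial subfamilies of a finite ranked family, from the whole family
downwards. -/
theorem IsInitial.induction_down [DecidableEq κ] (hfin : Γ.Finite) {p : Finset κ → Prop}
    (htop : p hfin.toFinset)
    (hstep : ∀ D, IsInitial Γ rank D → ∀ g ∈ Γ, g ∉ D → (∀ h ∈ Γ, rank h < rank g → h ∈ D) →
      (∀ h ∈ D, rank h ≤ rank g) → IsInitial Γ rank (Insert.insert g D) →
      p (Insert.insert g D) → p D)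
    (D : Finset κ) (hD : IsInitial Γ rank D) : p D := by
  induction hn : (hfin.toFinset \ D).card generalizing D with
  | zero =>
    have h1 : hfin.toFinset ⊆ D := by simpa using hn
    have h2 : D ⊆ hfin.toFinset := fun g hg => by simpa using hD.subset g hg
    rwa [h2.antisymm h1]
  | succ n ih =>
    have hne : ∃ g ∈ Γ, g ∉ D := by
      obtain ⟨g, hg⟩ := Finset.card_pos.1 (by omega : 0 < (hfin.toFinset \ D).card)
      exact ⟨g, by simpa using hg⟩
    obtain ⟨g, hg, hgD, h1, h2⟩ := exists_mem_sdiff_min hfin hD hne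
    refine hstep D hD g hg hgD h1 h2 (hD.insert hg h1) (ih _ (hD.insert hg h1) ?_)
    have : hfin.toFinset \ D = Insert.insert g (hfin.toFinset \ (Insert.insert g D)) := by
      ext h
      by_cases hh : h = g
      · subst hh; simp [hg, hgD]
      · simp [hh]
    rw [this, Finset.card_insert_of_notMem (by simp)] at hn
    omega

/-- Induction over the initial subfamilies of a ranked family, from the empty family upwards. -/
theorem IsInitial.induction_up [DecidableEq κ] {p : Finset κ → Prop} (h0 : p ∅)
    (hstep : ∀ D, IsInitial Γ rank D → ∀ g ∈ Γ, g ∉ D → (∀ h ∈ Γ, rank h < rank g → h ∈ D) →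
      (∀ h ∈ D, rank h ≤ rank g) → p D → p (Insert.insert g D))
    (D : Finset κ) (hD : IsInitial Γ rank D) : p D := by
  induction hn : D.card generalizing D with
  | zero => rwa [Finset.card_eq_zero.1 hn]
  | succ n ih =>
    obtain ⟨g, hg, hmax⟩ := Finset.exists_max_image D rank (Finset.card_pos.1 (by omega))
    have hE : IsInitial Γ rank (D.erase g) := by
      refine ⟨fun h hh => hD.subset h (Finset.mem_of_mem_erase hh), fun h hh h' hh' hlt => ?_⟩
      have hhD := Finset.mem_of_mem_erase hh
      refine Finset.mem_erase.2 ⟨?_, hD.mem h hhD h' hh' hlt⟩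
      rintro rfl
      exact absurd hlt (not_lt.2 (hmax h hhD))
    rw [← Finset.insert_erase hg]
    refine hstep _ hE g (hD.subset g hg) (by simp) (fun h hh hlt => ?_)
      (fun h hh => hmax h (Finset.mem_of_mem_erase hh))
      (ih _ hE (by rw [Finset.card_erase_of_mem hg, hn]; rfl))
    exact Finset.mem_erase.2 ⟨fun e => by simp [e] at hlt, hD.mem g hg h hh hlt⟩

variable {R : Type*} [CommRing R]

/-- The exponent 0 belongs to the family, so the full family generates the unit ideal; from there
members are removed one at a time by `TorIndependent.of_insert`. -/
theorem IsConeSystem.torIndependent [WellFoundedLT α] (hΓ : IsConeSystem Γ N A rank)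
    (hfin : Γ.Finite) (h0 : ∃ g ∈ Γ, N g = 0) {F : ι → R} {c : ℕ} (hF : RegularUpTo F c)
    (hA : ∀ g ∈ Γ, (A g).card ≤ c + 1) (D : Finset κ) (hD : IsInitial Γ rank D) :
    TorIndependent F (N '' D) := by
  classical
  refine IsInitial.induction_down hfin (p := fun D => TorIndependent F (N '' D)) ?_ ?_ D hD
  · obtain ⟨g, hg, hg0⟩ := h0
    exact torIndependent_of_zero_mem F ⟨g, by simpa using hg, hg0⟩
  · intro D hD g hg hgD h1 h2 _ hT
    rw [Finset.coe_insert, Set.image_insert_eq] at hT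
    exact hT.of_insert hF (hA g hg) (hΓ.varColon hD.subset hg hgD h1 h2)

theorem IsConeSystem.mem_iff_mul_mem [WellFoundedLT α] (hΓ : IsConeSystem Γ N A rank)
    (hfin : Γ.Finite) (h0 : ∃ g ∈ Γ, N g = 0) {F : ι → R} {c : ℕ} (hF : RegularUpTo F c)
    (hA : ∀ g ∈ Γ, (A g).card ≤ c + 1) {D : Finset κ} (hD : IsInitial Γ rank D)
    {g : κ} (hg : g ∈ Γ) (hgD : g ∉ D)
    (h1 : ∀ h ∈ Γ, rank h < rank g → h ∈ D) (h2 : ∀ h ∈ D, rank h ≤ rank g) (x : R) :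
    x * ((N g).prod fun i e => F i ^ e) ∈ monomialIdeal F (N '' D) ↔
      x ∈ Ideal.span (F '' (A g : Set ι)) := by
  classical
  have hV := hΓ.varColon hD.subset hg hgD h1 h2
  refine ⟨fun hx => ?_, fun hx => hV.mul_mem hx⟩
  have hT := hΓ.torIndependent hfin h0 hF hA _ (hD.insert hg h1)
  rw [Finset.coe_insert, Set.image_insert_eq] at hT
  exact hT.mem_of_mul_mem hV hx

end ConeSystems

/-! ### Generators of the monomial symbolic power and their linear quotients -/

section StarExponents

variable {s : ℕ}

theorem sum_exchange {f g : Fin s → ℕ} {a b : Fin s} (hab : a ≠ b)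
    (h : ∀ i, i ≠ a → i ≠ b → f i = g i) :
    ∑ i, f i + g a + g b = ∑ i, g i + f a + f b := by
  have hb : b ∈ (Finset.univ : Finset (Fin s)).erase a := by simp [hab.symm]
  rw [← Finset.add_sum_erase _ f (Finset.mem_univ a), ← Finset.add_sum_erase _ f hb,
    ← Finset.add_sum_erase _ g (Finset.mem_univ a), ← Finset.add_sum_erase _ g hb]
  have : ∑ i ∈ (Finset.univ.erase a).erase b, f i = ∑ i ∈ (Finset.univ.erase a).erase b, g i :=
    Finset.sum_congr rfl fun i hi => by
      simp only [Finset.mem_erase, Finset.mem_univ, and_true] at hi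
      exact h i hi.2 hi.1
  omega

/-- The largest exponent. -/
def topExp (γ : Fin s →₀ ℕ) : ℕ := Finset.univ.sup γ

theorem le_topExp (γ : Fin s →₀ ℕ) (i : Fin s) : γ i ≤ topExp γ :=
  Finset.le_sup (f := γ) (Finset.mem_univ i)

theorem topExp_eq {γ : Fin s →₀ ℕ} {t : ℕ} (h : ∀ i, γ i ≤ t) (i : Fin s) (hi : γ i = t) :
    topExp γ = t :=
  le_antisymm (Finset.sup_le fun i _ => h i) (hi ▸ le_topExp γ i)

/-- The positions where the exponent is not the largest one. -/
def lowPos (γ : Fin s →₀ ℕ) : Finset (Fin s) := Finset.univ.filter fun i => γ i < topExp γ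

/-- The exponents of the minimal generators of the `m`-th symbolic power of the monomial star
configuration of height `c` in `s` variables. -/
structure IsStarGen (c m : ℕ) (γ : Fin s →₀ ℕ) : Prop where
  card_lowPos : (lowPos γ).card < c
  sum_eq : ∑ i, γ i = m + (s - c) * topExp γ

/-- The directions in which multiplication leads into the ideal of the preceding generators. -/
def genDirs (γ : Fin s →₀ ℕ) : Finset (Fin s) :=
  Finset.univ.filter fun i => γ i < topExp γ ∧
    (γ i + 1 = topExp γ → ∃ j, j < i ∧ γ j = topExp γ)

theorem genDirs_subset (γ : Fin s →₀ ℕ) : genDirs γ ⊆ lowPos γ := fun i hi => by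
  simp only [genDirs, lowPos, Finset.mem_filter, Finset.mem_univ, true_and] at hi ⊢
  exact hi.1

theorem exists_eq_topExp {c : ℕ} (hcs : c < s) (γ : Fin s →₀ ℕ) : ∃ i, γ i = topExp γ := by
  obtain ⟨i, -, hi⟩ := Finset.exists_mem_eq_sup (Finset.univ : Finset (Fin s))
    ⟨⟨0, by omega⟩, Finset.mem_univ _⟩ γ
  exact ⟨i, hi.symm⟩

theorem sum_compl_le {c : ℕ} {γ : Fin s →₀ ℕ} {C : Finset (Fin s)} (hC : C.card = c) :
    ∑ i ∈ Cᶜ, γ i ≤ (s - c) * topExp γ := by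
  refine (Finset.sum_le_card_nsmul _ _ _ fun i _ => le_topExp γ i).trans ?_
  simp [Finset.card_compl, hC]

theorem IsStarGen.le_sum {c m : ℕ} {γ : Fin s →₀ ℕ} (h : IsStarGen c m γ)
    {C : Finset (Fin s)} (hC : C.card = c) : m ≤ ∑ i ∈ C, γ i := by
  have h1 := h.sum_eq
  have h2 := sum_compl_le (γ := γ) hC
  rw [← Finset.sum_add_sum_compl C] at h1
  omega

/-- Any `c`-set containing the low positions works, since all s-c entries outside it are equal to
the maximum. With `IsStarGen.le_sum`, the condition `sum_eq` thus means that the `c` smallest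
entries sum to `m`. -/
theorem IsStarGen.exists_sum_eq {c m : ℕ} (hcs : c < s) {γ : Fin s →₀ ℕ} (h : IsStarGen c m γ) :
    ∃ C : Finset (Fin s), C.card = c ∧ lowPos γ ⊆ C ∧ ∑ i ∈ C, γ i = m := by
  obtain ⟨C, hC1, -, hC⟩ := Finset.exists_subsuperset_card_eq (Finset.subset_univ (lowPos γ))
    h.card_lowPos.le (by simpa using hcs.le)
  refine ⟨C, hC, hC1, ?_⟩
  have h1 : ∑ i ∈ Cᶜ, γ i = (s - c) * topExp γ := by
    rw [Finset.sum_congr rfl (g := fun _ => topExp γ)]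
    · simp [Finset.card_compl, hC]
    · intro i hi
      have hi : i ∉ lowPos γ := fun h => (Finset.mem_compl.1 hi) (hC1 h)
      simp only [lowPos, Finset.mem_filter, Finset.mem_univ, true_and, not_lt] at hi
      exact le_antisymm (le_topExp γ i) hi
  have h2 := h.sum_eq
  rw [← Finset.sum_add_sum_compl C] at h2
  omega

theorem IsStarGen.topExp_le {c m : ℕ} (hcs : c < s) {γ : Fin s →₀ ℕ}
    (h : IsStarGen c m γ) : topExp γ ≤ m := by
  obtain ⟨C, hC, hlow, hsum⟩ := h.exists_sum_eq hcs
  obtain ⟨i, hi, hi'⟩ := Finset.exists_mem_notMem_of_card_lt_card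
    (s := lowPos γ) (t := C) (by rw [hC]; exact h.card_lowPos)
  simp only [lowPos, Finset.mem_filter, Finset.mem_univ, true_and, not_lt] at hi'
  exact hi'.trans (hsum ▸ Finset.single_le_sum (f := γ) (fun _ _ => Nat.zero_le _) hi)

/-- A monomial in the symbolic power is divisible by one of the generators. -/
theorem exists_isStarGen_le {c m : ℕ} (hc : 0 < c) (hcs : c < s) (hm : 0 < m) (x : Fin s →₀ ℕ)
    (hx : ∀ C : Finset (Fin s), C.card = c → m ≤ ∑ i ∈ C, x i) :
    ∃ γ, IsStarGen c m γ ∧ γ ≤ x := by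
  induction hn : ∑ i, x i using Nat.strong_induction_on generalizing x with
  | _ n ih =>
    subst hn
    obtain ⟨i₀, hi₀⟩ := exists_eq_topExp hcs x
    have hpos : 0 < topExp x := by
      obtain ⟨C, -, hC⟩ := Finset.exists_subset_card_eq (s := (Finset.univ : Finset (Fin s)))
        (n := c) (by simpa using hcs.le)
      have h1 := hx C hC
      by_contra! h0
      have h2 : ∑ i ∈ C, x i = 0 := Finset.sum_eq_zero fun i _ => by
        have := le_topExp x i
        omega
      omega
    obtain ⟨y, hy⟩ : ∃ y : Fin s →₀ ℕ, y = x - Finsupp.single i₀ 1 := ⟨_, rfl⟩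
    have hy₀ : y i₀ = x i₀ - 1 := by simp [hy]
    have hyne : ∀ i, i ≠ i₀ → y i = x i := fun i hi => by simp [hy, hi]
    by_cases hmin : ∀ C : Finset (Fin s), C.card = c → m ≤ ∑ i ∈ C, y i
    · have hle : y ≤ x := hy ▸ tsub_le_self
      obtain ⟨γ, h1, h2⟩ := ih (∑ i, y i) (by
        refine Finset.sum_lt_sum (fun i _ => hle i) ⟨i₀, Finset.mem_univ _, ?_⟩
        omega) _ hmin rfl
      exact ⟨γ, h1, h2.trans hle⟩
    · push Not at hmin
      obtain ⟨C, hC, hlt⟩ := hmin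
      have hmem : i₀ ∈ C := by
        by_contra hcon
        refine absurd (hx C hC) (not_le.2 (lt_of_eq_of_lt (Finset.sum_congr rfl ?_) hlt))
        exact fun i hi => (hyne i fun h => hcon (h ▸ hi)).symm
      have hsum : ∑ i ∈ C, x i = ∑ i ∈ C, y i + 1 := by
        rw [← Finset.add_sum_erase _ _ hmem, ← Finset.add_sum_erase _ (fun i => y i) hmem]
        have : ∑ i ∈ C.erase i₀, y i = ∑ i ∈ C.erase i₀, x i :=
          Finset.sum_congr rfl fun i hi => hyne i (Finset.ne_of_mem_erase hi)
        omega
      have hxC := hx C hC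
      have hout : ∀ j ∉ C, x j = topExp x := by
        intro j hj
        have h1 := hx (insert j (C.erase i₀)) (by
          rw [Finset.card_insert_of_notMem (fun h => hj (Finset.mem_of_mem_erase h)),
            Finset.card_erase_of_mem hmem]
          omega)
        rw [Finset.sum_insert (fun h => hj (Finset.mem_of_mem_erase h))] at h1
        rw [← Finset.add_sum_erase _ _ hmem] at hsum
        have := le_topExp x j
        omega
      refine ⟨x, ⟨?_, ?_⟩, le_rfl⟩
      · refine lt_of_le_of_lt (Finset.card_le_card (t := C.erase i₀) ?_) (by
          rw [Finset.card_erase_of_mem hmem]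
          omega)
        intro i hi
        simp only [lowPos, Finset.mem_filter, Finset.mem_univ, true_and] at hi
        refine Finset.mem_erase.2 ⟨fun h => by rw [h] at hi; omega, ?_⟩
        by_contra hcon
        rw [hout i hcon] at hi
        omega
      · rw [← Finset.sum_add_sum_compl C, Finset.sum_congr rfl (s₁ := Cᶜ) (g := fun _ => topExp x)
          fun i hi => hout i (Finset.mem_compl.1 hi)]
        simp only [Finset.sum_const, Finset.card_compl, hC, Fintype.card_fin, smul_eq_mul]
        omega

/-- Among generators of the same degree those of smaller weight come first. -/
def genWeight (γ : Fin s →₀ ℕ) : ℕ := ∑ i, (s * γ i ^ 2 + (s - i) * γ i)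

/-- After raising the entry at a, either all largest entries can be lowered by one, which decreases
the degree, or a single one can, which keeps the degree and decreases the weight. -/
theorem IsStarGen.exists_smaller {c m : ℕ} (hcs : c < s) {γ : Fin s →₀ ℕ}
    (h : IsStarGen c m γ) {a : Fin s} (ha : a ∈ genDirs γ) :
    ∃ γ', IsStarGen c m γ' ∧ γ' ≤ γ + Finsupp.single a 1 ∧
      (∑ i, γ' i < ∑ i, γ i ∨ ∑ i, γ' i = ∑ i, γ i ∧ genWeight γ' < genWeight γ) := by
  classical
  simp only [genDirs, Finset.mem_filter, Finset.mem_univ, true_and] at ha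
  obtain ⟨hlt, hsnd⟩ := ha
  set t := topExp γ with ht
  have hne : (Finset.univ.filter fun i => γ i = t).Nonempty := by
    obtain ⟨i, hi⟩ := exists_eq_topExp hcs γ
    exact ⟨i, by simpa using hi⟩
  -- In this case lowering a single largest entry would leave `c` low positions, so all of them must
  -- be lowered.
  by_cases hcase : γ a + 1 < t ∧ (lowPos γ).card + 1 = c
  · obtain ⟨ha1, hcard⟩ := hcase
    let γ' : Fin s →₀ ℕ := Finsupp.equivFunOnFinite.symm fun i =>
      if γ i = t then t - 1 else if i = a then γ a + 1 else γ i
    have hγ' : ∀ i, γ' i = if γ i = t then t - 1 else if i = a then γ a + 1 else γ i :=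
      fun i => rfl
    obtain ⟨i₀, hi₀⟩ := hne
    simp only [Finset.mem_filter, Finset.mem_univ, true_and] at hi₀
    have htop : topExp γ' = t - 1 := by
      refine topExp_eq (fun i => ?_) i₀ (by rw [hγ', if_pos hi₀])
      rw [hγ']
      have := le_topExp γ i
      split_ifs <;> omega
    have hT : (Finset.univ.filter fun i => γ i = t).card = s - c + 1 := by
      have h1 := Finset.card_filter_add_card_filter_not (s := (Finset.univ : Finset (Fin s)))
        (fun i => γ i < t)
      have h2 : (Finset.univ.filter fun i => ¬ γ i < t) = Finset.univ.filter fun i => γ i = t := by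
        refine Finset.filter_congr fun i _ => ?_
        have := le_topExp γ i
        omega
      rw [h2, Finset.card_univ, Fintype.card_fin] at h1
      have h3 : (Finset.univ.filter fun i => γ i < t).card = (lowPos γ).card := rfl
      omega
    -- There are s-c+1 largest entries, so the degree drops by s-c > 0.
    have hsum : ∑ i, γ' i + (s - c + 1) = ∑ i, γ i + 1 := by
      rw [← hT, Finset.card_filter, ← Finset.sum_add_distrib]
      have : (1 : ℕ) = ∑ i, if i = a then 1 else 0 := by simp
      rw [this, ← Finset.sum_add_distrib]
      refine Finset.sum_congr rfl fun i _ => ?_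
      rw [hγ']
      rcases eq_or_ne i a with rfl | hia
      · rw [if_neg (by omega), if_pos rfl, if_neg (by omega), if_pos rfl]
      · rw [if_neg hia, if_neg hia]
        split_ifs <;> omega
    have hs := h.sum_eq
    obtain ⟨t', ht'⟩ : ∃ t', t = t' + 1 := ⟨t - 1, by omega⟩
    rw [← ht, ht', mul_add] at hs
    refine ⟨γ', ⟨?_, ?_⟩, ?_, ?_⟩
    · refine lt_of_le_of_lt (Finset.card_le_card ?_) h.card_lowPos
      intro i hi
      simp only [lowPos, Finset.mem_filter, Finset.mem_univ, true_and, htop, hγ'] at hi ⊢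
      have := le_topExp γ i
      by_contra hcon
      rw [if_pos (by omega)] at hi
      omega
    · rw [htop, ht', Nat.add_sub_cancel]
      omega
    · intro i
      rw [hγ', Finsupp.add_apply, Finsupp.single_apply]
      split_ifs <;> first | omega | (subst_vars; omega)
    · left
      omega
  -- One unit moves from the first largest position τ to a.
  · obtain ⟨τ, hτ, hmin⟩ := Finset.exists_min_image _ id hne
    simp only [Finset.mem_filter, Finset.mem_univ, true_and, id] at hτ hmin
    have haτ : a ≠ τ := fun e => by rw [e] at hlt; omega
    let γ' : Fin s →₀ ℕ := Finsupp.equivFunOnFinite.symm fun i =>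
      if i = a then γ a + 1 else if i = τ then t - 1 else γ i
    have hγ' : ∀ i, γ' i = if i = a then γ a + 1 else if i = τ then t - 1 else γ i :=
      fun i => rfl
    have hγa : γ' a = γ a + 1 := by rw [hγ', if_pos rfl]
    have hγτ : γ' τ = t - 1 := by rw [hγ', if_neg haτ.symm, if_pos rfl]
    have hγo : ∀ i, i ≠ a → i ≠ τ → γ' i = γ i := fun i h1 h2 => by
      rw [hγ', if_neg h1, if_neg h2]
    have hsum := sum_exchange (f := γ') (g := γ) haτ hγo
    have hle : ∀ i, γ' i ≤ t := fun i => by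
      have := le_topExp γ i
      rw [hγ']
      split_ifs <;> omega
    have hw := sum_exchange (f := fun i => s * γ' i ^ 2 + (s - i) * γ' i)
      (g := fun i => s * γ i ^ 2 + (s - i) * γ i) haτ
      fun i h1 h2 => by simp only [hγo i h1 h2]
    simp only [hγa, hγτ, hτ] at hw hsum
    change genWeight γ' + _ + _ = genWeight γ + _ + _ at hw
    have hττ := τ.2
    have haa := a.2
    have hgoal : ∃ j, γ' j = t ∧ (lowPos γ ∪ {τ} : Finset _).card < c ∨ γ' j = t ∧ γ a + 1 = t := by
      by_cases ha1 : γ a + 1 = t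
      · exact ⟨a, Or.inr ⟨by omega, ha1⟩⟩
      · have hcard : (lowPos γ).card + 1 < c := by
          have := h.card_lowPos
          omega
        have h3 := Finset.card_union_le (lowPos γ) {τ}
        rw [Finset.card_singleton] at h3
        obtain ⟨j, -, hj⟩ := Finset.exists_mem_notMem_of_card_lt_card
          (s := lowPos γ ∪ {τ}) (t := Finset.univ) (by
            rw [Finset.card_univ, Fintype.card_fin]
            omega)
        simp only [lowPos, Finset.mem_union, Finset.mem_filter, Finset.mem_univ, true_and,
          Finset.mem_singleton, not_or, not_lt] at hj
        have hja : j ≠ a := fun e => by rw [e] at hj; omega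
        refine ⟨j, Or.inl ⟨?_, by omega⟩⟩
        rw [hγo j hja hj.2]
        exact le_antisymm (le_topExp γ j) hj.1
    obtain ⟨j, hj⟩ := hgoal
    have htop : topExp γ' = t := topExp_eq hle j (by tauto)
    refine ⟨γ', ⟨?_, ?_⟩, ?_, Or.inr ⟨by omega, ?_⟩⟩
    · rcases hj with ⟨-, hj⟩ | ⟨-, hj⟩
      · refine lt_of_le_of_lt (Finset.card_le_card fun i hi => ?_) hj
        simp only [lowPos, Finset.mem_union, Finset.mem_filter, Finset.mem_univ, true_and,
          Finset.mem_singleton, htop] at hi ⊢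
        by_cases h1 : i = τ
        · exact Or.inr h1
        · left
          rw [hγ', if_neg h1] at hi
          split_ifs at hi with h2
          · rw [h2]; omega
          · exact hi
      · have hsub : lowPos γ' ⊆ insert τ ((lowPos γ).erase a) := by
          intro i hi
          simp only [lowPos, Finset.mem_insert, Finset.mem_filter, Finset.mem_univ, true_and,
            Finset.mem_erase, htop] at hi ⊢
          by_cases h1 : i = τ
          · exact Or.inl h1
          · have h2 : i ≠ a := fun e => by rw [e, hγa] at hi; omega
            rw [hγo i h2 h1] at hi
            exact Or.inr ⟨h2, hi⟩
        have h1 := Finset.card_le_card hsub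
        have h2 := Finset.card_insert_le τ ((lowPos γ).erase a)
        have h3 : a ∈ lowPos γ := by simpa [lowPos] using hlt
        rw [Finset.card_erase_of_mem h3] at h2
        have h4 := Finset.card_pos.2 ⟨a, h3⟩
        have := h.card_lowPos
        omega
    · rw [htop, ← h.sum_eq]
      omega
    · intro i
      rw [hγ', Finsupp.add_apply, Finsupp.single_apply]
      split_ifs <;> first | omega | (subst_vars; omega)
    -- The quadratic part of the weight changes by 2s(γ a + 1 - t) and the linear part by τ - a,
    -- which is less than s in absolute value. If γ a + 1 = t only the linear part changes, and the
    -- definition of `genDirs` ensures τ < a.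
    · by_cases ha1 : γ a + 1 = t
      · obtain ⟨j, hja, hjt⟩ := hsnd ha1
        have hτa : τ < a := lt_of_le_of_lt (hmin j hjt) hja
        have hτa' : (τ : ℕ) < a := hτa
        have h5 : γ a = t - 1 := by omega
        rw [h5] at hw
        obtain ⟨t', ht'⟩ : ∃ t', t = t' + 1 := ⟨t - 1, by omega⟩
        simp only [ht', Nat.add_sub_cancel] at hw
        obtain ⟨u, hu⟩ : ∃ u, s = a + u := ⟨s - a, by omega⟩
        obtain ⟨v, hv⟩ : ∃ v, (a : ℕ) = τ + v := ⟨a - τ, by omega⟩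
        have h6 : s - (a : ℕ) = u := by omega
        have h7 : s - (τ : ℕ) = u + v := by omega
        rw [h6, h7] at hw
        nlinarith
      · obtain ⟨d, hd⟩ : ∃ d, t = γ a + 2 + d := ⟨t - (γ a + 2), by omega⟩
        have h5 : t - 1 = γ a + 1 + d := by omega
        rw [h5, hd] at hw
        have h6 : s - (a : ℕ) ≤ s := Nat.sub_le _ _
        have h7 : 0 < s - (τ : ℕ) := by omega
        have h8 : 0 ≤ s * d := Nat.zero_le _
        generalize s - (a : ℕ) = u at *
        generalize s - (τ : ℕ) = v at *
        nlinarith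

/-- Suppose the maximum of γ' is smaller. Take C with ∑ γ = m on C. There γ' ≤ γ: on `genDirs γ`
because γ' ≤ x = γ, elsewhere because γ is at least its maximum minus 1. At a largest position of γ
in C the inequality is strict, so γ' has sum below `m` on C. -/
theorem IsStarGen.topExp_le_of_cone {c m : ℕ} (hcs : c < s) {γ γ' : Fin s →₀ ℕ}
    (h : IsStarGen c m γ) (h' : IsStarGen c m γ') {x : Fin s →₀ ℕ}
    (hx : ∀ a ∈ genDirs γ, x a = γ a) (hle' : γ' ≤ x) : topExp γ ≤ topExp γ' := by
  by_contra! hlt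
  obtain ⟨C, hC, hlow, hsum⟩ := h.exists_sum_eq hcs
  have h1 := h'.le_sum hC
  obtain ⟨i, hi, hi'⟩ := Finset.exists_mem_notMem_of_card_lt_card
    (s := lowPos γ) (t := C) (by rw [hC]; exact h.card_lowPos)
  have h2 : ∑ i ∈ C, γ' i < ∑ i ∈ C, γ i := by
    refine Finset.sum_lt_sum (fun j _ => ?_) ⟨i, hi, ?_⟩
    · by_cases hj : j ∈ genDirs γ
      · exact (hle' j).trans (hx j hj).le
      · simp only [genDirs, Finset.mem_filter, Finset.mem_univ, true_and, not_and] at hj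
        have := le_topExp γ' j
        by_cases hj1 : γ j < topExp γ
        · have := hj hj1
          push Not at this
          omega
        · omega
    · simp only [lowPos, Finset.mem_filter, Finset.mem_univ, true_and, not_lt] at hi'
      have := le_topExp γ' i
      omega
  omega

/-- Both generators have the same maximum, hence the same degree, so it is enough that they are
comparable. -/
theorem IsStarGen.unique {c m : ℕ} (hcs : c < s) {γ γ' : Fin s →₀ ℕ}
    (h : IsStarGen c m γ) (h' : IsStarGen c m γ') {x : Fin s →₀ ℕ} (hle : γ ≤ x)
    (hx : ∀ a ∈ genDirs γ, x a = γ a) (hle' : γ' ≤ x) (hx' : ∀ a ∈ genDirs γ', x a = γ' a) :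
    γ = γ' := by
  classical
  have ht : topExp γ' = topExp γ :=
    le_antisymm (h'.topExp_le_of_cone hcs h hx' hle) (h.topExp_le_of_cone hcs h' hx hle')
  have hs : ∑ i, γ i = ∑ i, γ' i := by rw [h.sum_eq, h'.sum_eq, ht]
  suffices hcmp : γ ≤ γ' ∨ γ' ≤ γ by
    rcases hcmp with hcmp | hcmp
    · ext i
      exact (Finset.sum_eq_sum_iff_of_le fun i _ => hcmp i).1 hs i (Finset.mem_univ i)
    · ext i
      exact ((Finset.sum_eq_sum_iff_of_le fun i _ => hcmp i).1 hs.symm i (Finset.mem_univ i)).symm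
  -- A generator is x truncated at its maximum t, apart from some entries t-1 that precede all
  -- entries t. If two were incomparable, at i and j, each of i and j would have to precede the
  -- other.
  have key : ∀ {γ : Fin s →₀ ℕ}, γ ≤ x → (∀ a ∈ genDirs γ, x a = γ a) → ∀ i,
      γ i = min (x i) (topExp γ) ∨
      (γ i + 1 = topExp γ ∧ topExp γ ≤ x i ∧ ∀ j, γ j = topExp γ → i < j) := by
    intro γ hle hx i
    have h1 := le_topExp γ i
    have h2 := hle i
    by_cases hi : i ∈ genDirs γ
    · left; rw [hx i hi]; omega
    · simp only [genDirs, Finset.mem_filter, Finset.mem_univ, true_and, not_and] at hi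
      by_cases h3 : γ i < topExp γ
      · have h4 := hi h3
        push Not at h4
        by_cases h5 : topExp γ ≤ x i
        · refine Or.inr ⟨h4.1, h5, fun j hj => ?_⟩
          by_contra! hji
          rcases hji.lt_or_eq with hji | rfl
          · exact h4.2 j hji hj
          · omega
        · left; omega
      · left; omega
  have k1 := key hle hx
  have k2 := key hle' hx'
  rw [ht] at k2
  by_contra! hcon
  obtain ⟨hc1, hc2⟩ := hcon
  rw [Finsupp.le_def] at hc1 hc2
  push Not at hc1 hc2
  obtain ⟨i, hi⟩ := hc1
  obtain ⟨j, hj⟩ := hc2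
  have hl1 := le_topExp γ i
  have hl2 := le_topExp γ' j
  have hx1 := hle i
  have hx2 := hle' j
  have a1 : i < j := by
    rcases k2 i with k | k
    · omega
    · refine k.2.2 j ?_
      have := k1 j
      omega
  have a2 : j < i := by
    rcases k1 j with k | k
    · omega
    · refine k.2.2 i ?_
      have := k2 i
      omega
  exact absurd a1 (not_lt.2 a2.le)

end StarExponents

/-! ### Cones covering the monomials outside the symbolic power -/

section StarCones

variable {s : ℕ}

/-- The positions up to `p`, when the positions are sorted by exponent, then by index. -/
def lexPos (x : Fin s →₀ ℕ) (p : Fin s) : Finset (Fin s) :=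
  Finset.univ.filter fun i => x i < x p ∨ x i = x p ∧ i ≤ p

theorem mem_lexPos {x : Fin s →₀ ℕ} {p i : Fin s} :
    i ∈ lexPos x p ↔ x i < x p ∨ x i = x p ∧ i ≤ p := by
  simp [lexPos]

theorem self_mem_lexPos (x : Fin s →₀ ℕ) (p : Fin s) : p ∈ lexPos x p :=
  mem_lexPos.2 (Or.inr ⟨rfl, le_rfl⟩)

theorem exists_card_lexPos (x : Fin s →₀ ℕ) {c : ℕ} (hc : 0 < c) (hcs : c ≤ s) :
    ∃ p, (lexPos x p).card = c := by
  -- Ties are broken by index, so the key is injective and its initial segments have every size.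
  let key : Fin s → ℕ ×ₗ Fin s := fun i => toLex (x i, i)
  have hkey : ∀ p, lexPos x p = Finset.univ.filter fun i => key i ≤ key p := fun p => by
    ext i
    simp [lexPos, key, Prod.Lex.toLex_le_toLex]
  have hinj : Function.Injective key := fun i j h => (Prod.mk.inj (toLex.injective h)).2
  induction c, hc using Nat.le_induction with
  | base =>
    obtain ⟨p, -, hp⟩ := Finset.exists_min_image (Finset.univ : Finset (Fin s)) key
      ⟨⟨0, by omega⟩, Finset.mem_univ _⟩
    refine ⟨p, Finset.card_eq_one.2 ⟨p, ?_⟩⟩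
    rw [hkey]
    ext i
    simp only [Finset.mem_filter, Finset.mem_univ, true_and, Finset.mem_singleton]
    exact ⟨fun h => hinj (le_antisymm h (hp i (Finset.mem_univ i))), fun h => h ▸ le_rfl⟩
  | succ c hc ih =>
    obtain ⟨p, hp⟩ := ih (by omega)
    have hne : (lexPos x p)ᶜ.Nonempty := by
      rw [← Finset.card_pos, Finset.card_compl, hp, Fintype.card_fin]
      omega
    obtain ⟨q, hq, hmin⟩ := Finset.exists_min_image _ key hne
    refine ⟨q, ?_⟩
    have : lexPos x q = insert q (lexPos x p) := by
      rw [hkey] at hq ⊢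
      ext i
      simp only [Finset.mem_insert, Finset.mem_filter, Finset.mem_univ, true_and, hkey,
        Finset.mem_compl, not_le] at hq hmin ⊢
      constructor
      · intro h
        by_contra! hcon
        exact hcon.1 (hinj (le_antisymm h (hmin i hcon.2)))
      · rintro (rfl | h)
        · exact le_rfl
        · exact h.trans hq.le
    rw [this, Finset.card_insert_of_notMem (Finset.mem_compl.1 hq), hp]

/-- The two differences of the sets have equal size and x p separates their values; equality of sums
forces every newcomer to have the value x p. -/
theorem sum_lexPos_le {x : Fin s →₀ ℕ} {p : Fin s} {C : Finset (Fin s)}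
    (hC : C.card = (lexPos x p).card) :
    ∑ i ∈ lexPos x p, x i ≤ ∑ i ∈ C, x i ∧
      (∑ i ∈ C, x i ≤ ∑ i ∈ lexPos x p, x i → ∀ i ∈ C, i ∉ lexPos x p → x i = x p) := by
  classical
  set A := lexPos x p with hA
  have hcard : (C \ A).card = (A \ C).card := Finset.card_sdiff_comm hC
  have h1 : ∑ i ∈ A \ C, x i ≤ (A \ C).card * x p := by
    refine Finset.sum_le_card_nsmul _ _ _ fun i hi => ?_
    have := mem_lexPos.1 (Finset.mem_sdiff.1 hi).1
    omega
  have hge : ∀ i ∈ C \ A, x p ≤ x i := fun i hi => by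
    by_contra! h
    exact (Finset.mem_sdiff.1 hi).2 (mem_lexPos.2 (Or.inl h))
  have h2 : (C \ A).card * x p ≤ ∑ i ∈ C \ A, x i := Finset.card_nsmul_le_sum _ _ _ hge
  have h3 := Finset.sum_inter_add_sum_sdiff A C x
  have h4 := Finset.sum_inter_add_sum_sdiff C A x
  rw [Finset.inter_comm] at h4
  rw [hcard] at h2
  refine ⟨by omega, fun hle i hi hiA => ?_⟩
  have h5 : ∑ i ∈ C \ A, x p = ∑ i ∈ C \ A, x i := by
    rw [Finset.sum_const, smul_eq_mul, hcard]
    omega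
  exact ((Finset.sum_eq_sum_iff_of_le hge).1 h5 i (Finset.mem_sdiff.2 ⟨hi, hiA⟩)).symm

/-- The apex `γ` of a cone of monomials outside the symbolic power; its last fixed
position is `p`. -/
structure IsStarCone (c m : ℕ) (γ : Fin s →₀ ℕ) (p : Fin s) : Prop where
  card_lexPos : (lexPos γ p).card = c
  sum_lt : ∑ i ∈ lexPos γ p, γ i < m
  eq_of_notMem : ∀ i ∉ lexPos γ p, γ i = if p < i then γ p else γ p + 1

theorem lexPos_eq_of_cone {γ x : Fin s →₀ ℕ} {p : Fin s} (hle : γ ≤ x)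
    (hx : ∀ a ∈ lexPos γ p, x a = γ a) : lexPos x p = lexPos γ p := by
  have hp := hx p (self_mem_lexPos γ p)
  ext i
  have h1 := hle i
  by_cases hi : i ∈ lexPos γ p
  · simp only [hi, iff_true]
    rw [mem_lexPos, hp, hx i hi, ← mem_lexPos]
    exact hi
  · simp only [hi, iff_false]
    rw [mem_lexPos, hp] at *
    omega

/-- The first `c` positions of x in sorted order, and with them p, are recovered from any x in the
cone; they determine γ, whose other entries are prescribed by `eq_of_notMem`. -/
theorem IsStarCone.unique {c m : ℕ} {γ γ' : Fin s →₀ ℕ} {p p' : Fin s}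
    (h : IsStarCone c m γ p) (h' : IsStarCone c m γ' p') {x : Fin s →₀ ℕ} (hle : γ ≤ x)
    (hx : ∀ a ∈ lexPos γ p, x a = γ a) (hle' : γ' ≤ x) (hx' : ∀ a ∈ lexPos γ' p', x a = γ' a) :
    γ = γ' ∧ p = p' := by
  have e := lexPos_eq_of_cone hle hx
  have e' := lexPos_eq_of_cone hle' hx'
  have hsub : ∀ {p p'}, (x p < x p' ∨ x p = x p' ∧ p ≤ p') → lexPos x p ⊆ lexPos x p' := by
    intro p p' h i hi
    rw [mem_lexPos] at hi ⊢
    have : i ≤ p → p ≤ p' → i ≤ p' := le_trans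
    omega
  have hcard : (lexPos x p).card = (lexPos x p').card := by
    rw [e, e', h.card_lexPos, h'.card_lexPos]
  have hpp : lexPos x p = lexPos x p' := by
    have hor : (x p < x p' ∨ x p = x p' ∧ p ≤ p') ∨ (x p' < x p ∨ x p' = x p ∧ p' ≤ p) := by
      have := le_total p p'
      omega
    rcases hor with hor | hor
    · exact Finset.eq_of_subset_of_card_le (hsub hor) hcard.ge
    · exact (Finset.eq_of_subset_of_card_le (hsub hor) hcard.le).symm
  have h1 : p ∈ lexPos x p' := hpp ▸ self_mem_lexPos x p
  have h2 : p' ∈ lexPos x p := hpp ▸ self_mem_lexPos x p'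
  rw [mem_lexPos] at h1 h2
  have hp : p = p' := le_antisymm (by omega) (by omega)
  subst hp
  refine ⟨?_, rfl⟩
  have e2 : lexPos γ p = lexPos γ' p := e.symm.trans e'
  ext i
  by_cases hi : i ∈ lexPos γ p
  · rw [← hx i hi, hx' i (e2 ▸ hi)]
  · rw [h.eq_of_notMem i hi, h'.eq_of_notMem i (e2 ▸ hi), ← hx p (self_mem_lexPos γ p),
      hx' p (self_mem_lexPos γ' p)]

theorem exists_isStarCone_le {c m : ℕ} (hc : 0 < c) (hcs : c < s) (hm : 0 < m)
    (x : Fin s →₀ ℕ) : (∃ γ, IsStarGen c m γ ∧ γ ≤ x) ∨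
      ∃ γ p, IsStarCone c m γ p ∧ γ ≤ x ∧ ∀ a ∈ lexPos γ p, x a = γ a := by
  obtain ⟨p, hp⟩ := exists_card_lexPos x hc hcs.le
  by_cases hsum : m ≤ ∑ i ∈ lexPos x p, x i
  · left
    refine exists_isStarGen_le hc hcs hm x fun C hC => ?_
    exact hsum.trans (sum_lexPos_le (hC.trans hp.symm)).1
  · right
    -- The least exponent with the same first `c` positions and values there: a later position may
    -- tie with p only if its index is larger.
    let γ : Fin s →₀ ℕ := Finsupp.equivFunOnFinite.symm fun i =>
      if i ∈ lexPos x p then x i else if p < i then x p else x p + 1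
    have hγ : ∀ i, γ i = if i ∈ lexPos x p then x i else if p < i then x p else x p + 1 :=
      fun i => rfl
    have hγp : γ p = x p := by rw [hγ, if_pos (self_mem_lexPos x p)]
    have hmem : ∀ i ∈ lexPos x p, γ i = x i := fun i hi => by rw [hγ, if_pos hi]
    have hle : γ ≤ x := fun i => by
      rw [hγ]
      split_ifs with h1 h2
      · exact le_rfl
      · rw [mem_lexPos] at h1
        omega
      · rw [mem_lexPos] at h1
        have := not_lt.1 h2
        omega
    have hpos : lexPos γ p = lexPos x p := by
      ext i
      by_cases hi : i ∈ lexPos x p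
      · rw [mem_lexPos, hγp, hmem i hi, ← mem_lexPos]
      · simp only [hi, iff_false]
        rw [mem_lexPos, hγp, hγ, if_neg hi]
        split_ifs with h2
        · have := not_le.2 h2
          omega
        · omega
    refine ⟨γ, p, ⟨by rw [hpos, hp], ?_, ?_⟩, hle, fun a ha => (hmem a (hpos ▸ ha)).symm⟩
    · rw [hpos, Finset.sum_congr rfl hmem]
      exact not_le.1 hsum
    · intro i hi
      rw [hpos] at hi
      rw [hγp, hγ, if_neg hi]

/-- Raising an entry cannot decrease the sum of the `c` smallest entries. If this sum stays the
same, a has been replaced by positions tied with γ p, whose index exceeds p; so the last of the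
first `c` positions moves to the right. -/
theorem IsStarCone.exists_smaller {c m : ℕ} (hc : 0 < c) (hcs : c < s) {γ : Fin s →₀ ℕ}
    {p : Fin s} (h : IsStarCone c m γ p) {a : Fin s} (ha : a ∈ lexPos γ p) :
    (∃ γ', IsStarGen c m γ' ∧ γ' ≤ γ + Finsupp.single a 1) ∨
      ∃ γ' p', IsStarCone c m γ' p' ∧ γ' ≤ γ + Finsupp.single a 1 ∧
        (∑ i ∈ lexPos γ p, γ i < ∑ i ∈ lexPos γ' p', γ' i ∨
          ∑ i ∈ lexPos γ p, γ i = ∑ i ∈ lexPos γ' p', γ' i ∧ p < p') := by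
  classical
  set x := γ + Finsupp.single a 1 with hxdef
  have hm : 0 < m := by have := h.sum_lt; omega
  rcases exists_isStarCone_le hc hcs hm x with h1 | ⟨γ', p', h1, hle, hx⟩
  · exact Or.inl h1
  refine Or.inr ⟨γ', p', h1, hle, ?_⟩
  have hxa : x a = γ a + 1 := by simp [hxdef]
  have hxo : ∀ i, i ≠ a → x i = γ i := fun i hi => by simp [hxdef, hi]
  have hγx : ∀ i, γ i ≤ x i := fun i => by simp [hxdef]
  set B := lexPos γ' p' with hB
  have hs : ∑ i ∈ B, γ' i = ∑ i ∈ B, x i := Finset.sum_congr rfl fun i hi => (hx i hi).symm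
  have hmono : ∑ i ∈ B, γ i ≤ ∑ i ∈ B, x i := Finset.sum_le_sum fun i _ => hγx i
  have hcard : B.card = (lexPos γ p).card := by rw [h1.card_lexPos, h.card_lexPos]
  obtain ⟨hmin, heq⟩ := sum_lexPos_le hcard
  by_cases hlt : ∑ i ∈ lexPos γ p, γ i < ∑ i ∈ B, γ' i
  · exact Or.inl hlt
  refine Or.inr ⟨by omega, ?_⟩
  have haB : a ∉ B := fun haB => by
    have : ∑ i ∈ B, γ i < ∑ i ∈ B, x i :=
      Finset.sum_lt_sum (fun i _ => hγx i) ⟨a, haB, by omega⟩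
    omega
  obtain ⟨b, hbB, hb⟩ : ∃ b ∈ B, b ∉ lexPos γ p := by
    by_contra! hcon
    exact haB ((Finset.eq_of_subset_of_card_le hcon hcard.ge) ▸ ha)
  have hγb := heq (by omega) b hbB hb
  have hpb : p < b := by
    have := fun h => hb (mem_lexPos.2 (Or.inr ⟨hγb, h⟩))
    exact not_le.1 this
  have hBγ : ∀ i ∈ B, γ' i = γ i := fun i hi => by
    rw [← hx i hi, hxo i fun e => haB (e ▸ hi)]
  have hp' := self_mem_lexPos γ' p'
  have hγp' : γ p' ≤ γ p := by
    by_cases hh : p' ∈ lexPos γ p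
    · have := mem_lexPos.1 hh
      omega
    · exact (heq (by omega) p' hp' hh).le
  have hb2 := mem_lexPos.1 hbB
  rw [hBγ b hbB, hBγ p' hp'] at hb2
  exact lt_of_lt_of_le hpb (by omega)

/-- The indices of the cones: generators of the symbolic power, and apices of the cones
covering its complement. -/
abbrev StarIndex (s : ℕ) := (Fin s →₀ ℕ) ⊕ ((Fin s →₀ ℕ) × Fin s)

/-- The exponent belonging to an index. -/
def starExp : StarIndex s → Fin s →₀ ℕ := Sum.elim id Prod.fst

/-- The fixed directions belonging to an index. -/
def starDirs : StarIndex s → Finset (Fin s) := Sum.elim genDirs fun g => lexPos g.1 g.2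

/-- The rank of an index. -/
def starRank (m : ℕ) : StarIndex s → ℕ ×ₗ ℕ ×ₗ ℕ :=
  Sum.elim (fun γ => toLex (0, toLex (∑ i, γ i, genWeight γ)))
    fun g => toLex (1, toLex (m - ∑ i ∈ lexPos g.1 g.2, g.1 i, s - g.2))

/-- The set of all generators and apices. -/
def starIndices (c m : ℕ) : Set (StarIndex s) :=
  {g | Sum.elim (IsStarGen c m) (fun g => IsStarCone c m g.1 g.2) g}

/-- Generators come first. Among the apices, those with larger sum of fixed entries and then with
larger last position come earlier, since raising a fixed entry moves in this direction. A cone of an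
apex meets no cone of a generator, as a generator has sum at least `m` on every `c`-set. -/
theorem isConeSystem_star {c m : ℕ} (hc : 0 < c) (hcs : c < s) :
    IsConeSystem (starIndices (s := s) c m) starExp starDirs (starRank m) where
  step := by
    rintro (γ | ⟨γ, p⟩) hg a ha
    · obtain ⟨γ', h1, h2, h3⟩ := IsStarGen.exists_smaller hcs hg ha
      refine ⟨Sum.inl γ', h1, h2, ?_⟩
      simp only [starRank, Sum.elim_inl, Prod.Lex.toLex_lt_toLex]
      tauto
    · have hg : IsStarCone c m γ p := hg
      rcases hg.exists_smaller hc hcs ha with ⟨γ', h1, h2⟩ | ⟨γ', p', h1, h2, h3⟩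
      · refine ⟨Sum.inl γ', h1, h2, ?_⟩
        simp only [starRank, Sum.elim_inl, Sum.elim_inr, Prod.Lex.toLex_lt_toLex]
        exact Or.inl Nat.zero_lt_one
      · refine ⟨Sum.inr (γ', p'), h1, h2, ?_⟩
        have h4 := h1.sum_lt
        have h5 := p'.2
        have h6 : p < p' → (p : ℕ) < p' := id
        simp only [starRank, Sum.elim_inr, Prod.Lex.toLex_lt_toLex]
        refine Or.inr ⟨trivial, ?_⟩
        rcases h3 with h3 | ⟨h3, h7⟩
        · left; omega
        · right; have := h6 h7; omega
  unique := by
    have hmix : ∀ (γ γ' : Fin s →₀ ℕ) (p : Fin s) (x : Fin s →₀ ℕ), IsStarGen c m γ →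
        IsStarCone c m γ' p → γ ≤ x → (∀ a ∈ lexPos γ' p, x a = γ' a) → False := by
      intro γ γ' p x h h' hle hx
      have h1 := h.le_sum h'.card_lexPos
      have h2 := h'.sum_lt
      have h3 : ∑ i ∈ lexPos γ' p, γ i ≤ ∑ i ∈ lexPos γ' p, γ' i :=
        Finset.sum_le_sum fun i hi => (hle i).trans (hx i hi).le
      omega
    rintro (γ | ⟨γ, p⟩) hg (γ' | ⟨γ', p'⟩) hh x h1 h2 h3 h4
    · exact congrArg _ (IsStarGen.unique hcs hg hh h1 h2 h3 h4)
    · exact (hmix _ _ _ _ hg hh h1 h4).elim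
    · exact (hmix _ _ _ _ hh hg h3 h2).elim
    · obtain ⟨rfl, rfl⟩ := IsStarCone.unique hg hh h1 h2 h3 h4
      rfl

theorem finite_starGens {c m : ℕ} (hcs : c < s) : {γ : Fin s →₀ ℕ | IsStarGen c m γ}.Finite := by
  refine (Set.finite_Iic (Finsupp.equivFunOnFinite.symm fun _ : Fin s => m)).subset ?_
  exact fun γ hγ i => (le_topExp γ i).trans (IsStarGen.topExp_le hcs hγ)

theorem finite_starIndices {c m : ℕ} (hcs : c < s) : (starIndices (s := s) c m).Finite := by
  have h2 : {g : (Fin s →₀ ℕ) × Fin s | IsStarCone c m g.1 g.2}.Finite := by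
    refine ((Set.finite_Iic (Finsupp.equivFunOnFinite.symm fun _ : Fin s => m + 1)).prod
      (Set.finite_univ (α := Fin s))).subset ?_
    rintro ⟨γ, p⟩ hg
    refine ⟨fun i => ?_, Set.mem_univ _⟩
    have hg : IsStarCone c m γ p := hg
    have h1 : ∀ i ∈ lexPos γ p, γ i < m := fun i hi =>
      lt_of_le_of_lt (Finset.single_le_sum (f := γ) (fun _ _ => Nat.zero_le _) hi) hg.sum_lt
    change γ i ≤ m + 1
    by_cases hi : i ∈ lexPos γ p
    · have := h1 i hi
      omega
    · have := h1 p (self_mem_lexPos γ p)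
      rw [hg.eq_of_notMem i hi]
      split_ifs <;> omega
  refine (((finite_starGens (m := m) hcs).image Sum.inl).union (h2.image Sum.inr)).subset ?_
  rintro (γ | g) hg
  · exact Or.inl ⟨γ, hg, rfl⟩
  · exact Or.inr ⟨g, hg, rfl⟩

theorem exists_starExp_eq_zero {c m : ℕ} (hc : 0 < c) (hcs : c < s) (hm : 0 < m) :
    ∃ g ∈ starIndices (s := s) c m, starExp g = 0 := by
  rcases exists_isStarCone_le hc hcs hm (0 : Fin s →₀ ℕ) with ⟨γ, h, hle⟩ | ⟨γ, p, h, hle, -⟩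
  · exact ⟨Sum.inl γ, h, le_antisymm hle zero_le⟩
  · exact ⟨Sum.inr (γ, p), h, le_antisymm hle zero_le⟩

theorem card_starDirs_le {c m : ℕ} {g : StarIndex s} (hg : g ∈ starIndices c m) :
    (starDirs g).card ≤ c := by
  rcases g with γ | ⟨γ, p⟩
  · exact (Finset.card_le_card (genDirs_subset γ)).trans (IsStarGen.card_lowPos hg).le
  · exact (IsStarCone.card_lexPos hg).le

end StarCones

/-! ### The symbolic power is generated by monomials in the forms -/

section SymbolicPower

variable {R : Type*} [CommRing R] {s : ℕ}

/-- Enumerate A, then b, then enough further indices to reach length `c+1`. -/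
theorem AnyFormRegularSequence.regularUpTo {F : Fin s → R} {c : ℕ}
    (h : AnyFormRegularSequence F (c + 1)) (hcs : c < s) : RegularUpTo F c := by
  classical
  intro A hA b hb x hx
  have hcard : (insert b A).card ≤ c + 1 := by
    rw [Finset.card_insert_of_notMem hb]; omega
  obtain ⟨B, hB1, -, hB⟩ := Finset.exists_subsuperset_card_eq (Finset.subset_univ (insert b A))
    hcard (by simpa using hcs)
  let l : List (Fin s) := A.toList ++ b :: (B \ insert b A).toList
  have hl : l.length = c + 1 := by
    simp only [l, List.length_append, Finset.length_toList, List.length_cons,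
      Finset.card_sdiff_of_subset hB1, hB, Finset.card_insert_of_notMem hb]
    omega
  have hnd : l.Nodup := by
    simp only [l, List.nodup_append, Finset.nodup_toList, List.nodup_cons, Finset.mem_toList,
      Finset.mem_sdiff, true_and, List.mem_cons]
    refine ⟨by simp, ?_⟩
    rintro a ha _ (rfl | hb') rfl
    · exact hb ha
    · exact hb'.2 (Finset.mem_insert_of_mem ha)
  have h1 := h (fun i => l.get (i.cast hl.symm)) (fun i j hij => by
    simpa using List.nodup_iff_injective_get.1 hnd hij)
  have h2 : List.ofFn (fun i : Fin (c + 1) => F (l.get (i.cast hl.symm))) = l.map F := by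
    refine List.ext_getElem (by simp [hl]) fun i h3 h4 => ?_
    rw [List.getElem_ofFn]
    simp
  rw [h2] at h1
  have hi : A.card < (l.map F).length := by
    rw [List.length_map, hl]; omega
  have h3 := h1.toIsWeaklyRegular.regular_mod_prev A.card hi
  have htake : (l.map F).take A.card = A.toList.map F := by
    simp only [l, List.map_append]
    rw [List.take_left' (by simp)]
  have hget : (l.map F)[A.card] = F b := by
    simp [l, List.getElem_append_right]
  have hspan : (Ideal.ofList (A.toList.map F) • ⊤ : Submodule R R) =
      Ideal.span (F '' (A : Set (Fin s))) := by
    rw [smul_eq_mul, Ideal.mul_top, Ideal.ofList]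
    congr 1
    ext y
    simp
  rw [isSMulRegular_quotient_iff_mem_of_smul_mem, hget, htake, hspan] at h3
  exact h3 x (by rwa [smul_eq_mul, mul_comm])

theorem mem_associatedPrimes_quotient_iff [IsNoetherianRing R] {I P : Ideal R} :
    P ∈ associatedPrimes R (R ⧸ I) ↔ P.IsPrime ∧ ∃ y, ∀ z, z ∈ P ↔ z * y ∈ I := by
  rw [AssociatedPrimes.mem_iff, isAssociatedPrime_iff]
  refine and_congr_right fun _ => ⟨?_, ?_⟩
  · rintro ⟨x, rfl⟩
    obtain ⟨y, rfl⟩ := Ideal.Quotient.mk_surjective x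
    refine ⟨y, fun z => ?_⟩
    rw [Submodule.mem_colon_singleton, Submodule.mem_bot, ← Ideal.Quotient.eq_zero_iff_mem,
      map_mul]
    rfl
  · rintro ⟨y, hy⟩
    refine ⟨Ideal.Quotient.mk I y, ?_⟩
    ext z
    rw [hy, Submodule.mem_colon_singleton, Submodule.mem_bot, ← Ideal.Quotient.eq_zero_iff_mem,
      map_mul]
    rfl

theorem mem_starIdeal {F : Fin s → R} {c : ℕ} {x : R} :
    x ∈ starIdeal F c ↔ ∀ A : Finset (Fin s), A.card = c →
      x ∈ Ideal.span (F '' (A : Set (Fin s))) := by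
  simp [starIdeal, Submodule.mem_iInf]

theorem mem_symbolicPower {I : Ideal R} {m : ℕ} {x : R} :
    x ∈ symbolicPower I m ↔ ∀ P ∈ associatedPrimes R (R ⧸ I), ∃ w ∉ P, w * x ∈ I ^ m := by
  simp only [symbolicPower, Submodule.mem_iInf, Subtype.forall, Ideal.mem_comap]
  refine forall₂_congr fun P hP => ?_
  have : P.IsPrime := hP.1
  rw [IsLocalization.algebraMap_mem_map_algebraMap_iff P.primeCompl]
  rfl

/-- P is the finite intersection of the colons of y into the (F_A), so, being prime, it contains one
of them. -/
theorem exists_associatedPrime_of_starIdeal [IsNoetherianRing R] {F : Fin s → R} {c : ℕ}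
    {P : Ideal R} (hP : P ∈ associatedPrimes R (R ⧸ starIdeal F c)) :
    ∃ A : Finset (Fin s), A.card = c ∧
      P ∈ associatedPrimes R (R ⧸ Ideal.span (F '' (A : Set (Fin s)))) := by
  rw [mem_associatedPrimes_quotient_iff] at hP
  obtain ⟨hprime, y, hy⟩ := hP
  let J : Finset (Fin s) → Ideal R := fun A =>
    Submodule.comap (LinearMap.toSpanSingleton R R y) (Ideal.span (F '' (A : Set (Fin s))))
  have hJ : ∀ A z, z ∈ J A ↔ z * y ∈ Ideal.span (F '' (A : Set (Fin s))) := fun A z => Iff.rfl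
  have hle : (Finset.powersetCard c Finset.univ).inf J ≤ P := fun z hz => by
    rw [hy, mem_starIdeal]
    intro A hA
    rw [← hJ]
    exact Finset.inf_le (f := J) (by simp [hA]) hz
  obtain ⟨A, hA, hAP⟩ := hprime.inf_le'.1 hle
  have hA : A.card = c := by simpa using hA
  refine ⟨A, hA, mem_associatedPrimes_quotient_iff.2 ⟨hprime, y, fun z => ⟨fun hz => ?_, fun hz =>
    hAP hz⟩⟩⟩
  exact mem_starIdeal.1 ((hy z).1 hz) A hA

theorem prod_compl_mul_mem_starIdeal {F : Fin s → R} {c : ℕ} {A : Finset (Fin s)}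
    (hA : A.card = c) {x : R} (hx : x ∈ Ideal.span (F '' (A : Set (Fin s)))) :
    (∏ b ∈ Aᶜ, F b) * x ∈ starIdeal F c := by
  rw [mem_starIdeal]
  intro B hB
  by_cases hAB : A = B
  · subst hAB
    exact Ideal.mul_mem_left _ _ hx
  · obtain ⟨b, hbB, hbA⟩ : ∃ b ∈ B, b ∉ A := by
      by_contra! hcon
      exact hAB (Finset.eq_of_subset_of_card_le hcon (by omega)).symm
    refine Ideal.mul_mem_right _ _ ?_
    rw [← Finset.mul_prod_erase _ _ (Finset.mem_compl.2 hbA)]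
    exact Ideal.mul_mem_right _ _ (Ideal.subset_span ⟨b, hbB, rfl⟩)

theorem RegularUpTo.notMem_associatedPrime [IsNoetherianRing R] {F : Fin s → R} {c : ℕ}
    (hF : RegularUpTo F c) {A : Finset (Fin s)} (hA : A.card = c) {P : Ideal R}
    (hP : P ∈ associatedPrimes R (R ⧸ Ideal.span (F '' (A : Set (Fin s))))) {b : Fin s}
    (hb : b ∉ A) : F b ∉ P := by
  rw [mem_associatedPrimes_quotient_iff] at hP
  obtain ⟨hprime, y, hy⟩ := hP
  intro hbP
  refine hprime.ne_top ((Ideal.eq_top_iff_one P).2 ?_)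
  rw [hy, one_mul]
  refine hF A hA.le b hb y ?_
  rw [mul_comm]
  exact (hy _).1 hbP

/-- Multiplying the witness by the forms outside A puts it into the other components, and none of
these forms lies in P. -/
theorem mem_associatedPrimes_starIdeal [IsNoetherianRing R] {F : Fin s → R} {c : ℕ}
    (hF : RegularUpTo F c) {A : Finset (Fin s)} (hA : A.card = c) {P : Ideal R}
    (hP : P ∈ associatedPrimes R (R ⧸ Ideal.span (F '' (A : Set (Fin s))))) :
    P ∈ associatedPrimes R (R ⧸ starIdeal F c) := by
  have hP' := mem_associatedPrimes_quotient_iff.1 hP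
  obtain ⟨hprime, y, hy⟩ := hP'
  refine mem_associatedPrimes_quotient_iff.2 ⟨hprime, (∏ b ∈ Aᶜ, F b) * y, fun z => ⟨fun hz => ?_,
    fun hz => ?_⟩⟩
  · rw [mul_left_comm]
    exact prod_compl_mul_mem_starIdeal hA ((hy z).1 hz)
  · have h1 := mem_starIdeal.1 hz A hA
    rw [← mul_assoc, ← hy] at h1
    have h2 : (∏ b ∈ Aᶜ, F b) ∉ P := fun h => by
      obtain ⟨b, hb, hbP⟩ := (hprime.prod_mem_iff).1 h
      exact hF.notMem_associatedPrime hA hP (Finset.mem_compl.1 hb) hbP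
    exact ((hprime.mem_or_mem h1).resolve_right h2)

/-- The exponents of degree at least `d` in the variables with index in `A`. -/
def degGE (A : Finset (Fin s)) (d : ℕ) : Set (Fin s →₀ ℕ) := {u | d ≤ ∑ i ∈ A, u i}

theorem monomialIdeal_mul_le (F : Fin s → R) (U V W : Set (Fin s →₀ ℕ))
    (h : ∀ u ∈ U, ∀ v ∈ V, u + v ∈ W) :
    monomialIdeal F U * monomialIdeal F V ≤ monomialIdeal F W := by
  rw [monomialIdeal, monomialIdeal, Ideal.span_mul_span, Ideal.span_le]
  rintro _ ⟨_, ⟨u, hu, rfl⟩, _, ⟨v, hv, rfl⟩, rfl⟩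
  refine Ideal.subset_span ⟨u + v, h u hu v hv, ?_⟩
  exact Finsupp.prod_add_index' (by simp) (by simp [pow_add])

theorem span_pow_le_monomialIdeal (F : Fin s → R) (A : Finset (Fin s)) (m : ℕ) :
    Ideal.span (F '' (A : Set (Fin s))) ^ m ≤ monomialIdeal F (degGE A m) := by
  induction m with
  | zero =>
    have : monomialIdeal F (degGE A 0) = ⊤ :=
      (Ideal.eq_top_iff_one _).2 (Ideal.subset_span ⟨0, by simp [degGE], by simp⟩)
    rw [this]
    exact le_top
  | succ m ih =>
    rw [pow_succ]
    refine (Ideal.mul_mono_left ih).trans ?_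
    rw [← monomialIdeal_varExps]
    refine monomialIdeal_mul_le F _ _ _ ?_
    rintro u hu _ ⟨a, ha, rfl⟩
    simp only [degGE, Set.mem_ofPred_eq, Finsupp.add_apply, Finset.sum_add_distrib] at hu ⊢
    have : ∑ i ∈ A, (Finsupp.single a 1 : Fin s →₀ ℕ) i = 1 := by
      rw [Finset.sum_eq_single a]
      · simp
      · intro i _ hi
        simp [hi]
      · exact fun h => absurd ha h
    omega

theorem prod_pow_mem_span_pow (F : Fin s → R) (A : Finset (Fin s)) {m : ℕ} {γ : Fin s →₀ ℕ}
    (h : m ≤ ∑ i ∈ A, γ i) :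
    (γ.prod fun i e => F i ^ e) ∈ Ideal.span (F '' (A : Set (Fin s))) ^ m := by
  rw [Finsupp.prod_fintype _ _ (by simp), ← Finset.prod_mul_prod_compl A]
  refine Ideal.mul_mem_right _ _ (Ideal.pow_le_pow_right h ?_)
  rw [← Finset.prod_pow_eq_pow_sum]
  exact Ideal.prod_mem_prod fun i hi =>
    Ideal.pow_mem_pow (Ideal.subset_span (Set.mem_image_of_mem F hi)) _

theorem TorIndependent.congr {ι : Type*} {F : ι → R} {U V : Set (ι →₀ ℕ)}
    (h1 : ∀ u ∈ U, ∃ v ∈ V, v ≤ u) (h2 : ∀ v ∈ V, ∃ u ∈ U, u ≤ v) (h : TorIndependent F U) :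
    TorIndependent F V := by
  have : monomialSpan R U = monomialSpan R V :=
    le_antisymm (monomialSpan_mono h1) (monomialSpan_mono h2)
  rwa [TorIndependent, ← this]

theorem filter_mem_finsuppAntidiag (A : Finset (Fin s)) (u : Fin s →₀ ℕ) :
    u.filter (· ∈ A) ∈ Finset.finsuppAntidiag A (∑ i ∈ A, u i) := by
  rw [Finset.mem_finsuppAntidiag]
  refine ⟨Finset.sum_congr rfl fun i hi => by simp [hi], fun i hi => ?_⟩
  by_contra hcon
  simp [hcon] at hi

theorem filter_le_self (u : Fin s →₀ ℕ) (p : Fin s → Prop) [DecidablePred p] :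
    u.filter p ≤ u := fun i => by
  rw [Finsupp.filter_apply]
  split_ifs <;> omega

theorem varColon_degGE_union {A : Finset (Fin s)} {d : ℕ} {V : Finset (Fin s →₀ ℕ)}
    (hV : V ⊆ Finset.finsuppAntidiag A d) {N : Fin s →₀ ℕ}
    (hN : N ∈ Finset.finsuppAntidiag A d) (hNV : N ∉ V) :
    VarColon (degGE A (d + 1) ∪ V) N A where
  le a ha := by
    refine ⟨_, Or.inl ?_, le_rfl⟩
    have h1 := (Finset.mem_finsuppAntidiag.1 hN).1
    simp only [degGE, Set.mem_ofPred_eq, Finsupp.add_apply, Finset.sum_add_distrib]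
    rw [h1]
    have := Finset.single_le_sum (f := fun i => (Finsupp.single a 1 : Fin s →₀ ℕ) i)
      (fun _ _ => Nat.zero_le _) ha
    simp only [Finsupp.single_eq_same] at this
    omega
  not_le := by
    intro x hx u hu hle
    have hN1 := (Finset.mem_finsuppAntidiag.1 hN).1
    have h1 : ∑ i ∈ A, u i ≤ d := by
      rw [← hN1]
      exact Finset.sum_le_sum fun i hi => by simpa [hx i hi] using hle i
    rcases hu with hu | hu
    · simp only [degGE, Set.mem_ofPred_eq] at hu
      omega
    · obtain ⟨h3, h4⟩ := Finset.mem_finsuppAntidiag.1 (hV hu)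
      refine hNV ?_
      convert Finset.mem_coe.1 hu
      ext i
      by_cases hi : i ∈ A
      · exact ((Finset.sum_eq_sum_iff_of_le fun i hi => by
          simpa [hx i hi] using hle i).1 (h3.trans hN1.symm) i hi).symm
      · rw [Finsupp.notMem_support_iff.1 fun h => hi (h4 h),
          Finsupp.notMem_support_iff.1 fun h => hi ((Finset.mem_finsuppAntidiag.1 hN).2 h)]

/-- The same descent for powers of (y_A): adding the missing monomials of degree d one by one, each
with colon (y_A), leads to the ideal of all monomials of A-degree at least d, which is treated by
induction on d. -/
theorem torIndependent_degGE_union {F : Fin s → R} {c : ℕ} (hF : RegularUpTo F c)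
    {A : Finset (Fin s)} (hA : A.card ≤ c + 1) (d : ℕ) (V : Finset (Fin s →₀ ℕ))
    (hV : V ⊆ Finset.finsuppAntidiag A d) : TorIndependent F (degGE A (d + 1) ∪ V) := by
  classical
  induction d generalizing V with
  | zero =>
    have hfull : TorIndependent F (degGE A (0 + 1) ∪ Finset.finsuppAntidiag A 0) := by
      refine torIndependent_of_zero_mem F (Or.inr ?_)
      simp
    by_cases h : V = Finset.finsuppAntidiag A 0
    · rwa [h]
    · have h0 : V = ∅ := by
        rw [Finset.finsuppAntidiag_zero] at hV h
        exact (Finset.subset_singleton_iff.1 hV).resolve_right h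
      subst h0
      have hmem : (0 : Fin s →₀ ℕ) ∈ Finset.finsuppAntidiag A 0 := by simp
      refine TorIndependent.of_insert hF hA (varColon_degGE_union hV hmem (by simp)) ?_
      refine hfull.congr (fun u hu => ⟨0, Or.inl rfl, zero_le⟩) ?_
      exact fun v _ => ⟨0, Or.inr (by simp), zero_le⟩
  | succ d ih =>
    induction hn : (Finset.finsuppAntidiag A (d + 1) \ V).card generalizing V with
    | zero =>
      have hVeq : V = Finset.finsuppAntidiag A (d + 1) :=
        hV.antisymm (by simpa using hn)
      refine (ih ∅ (by simp)).congr (fun u hu => ?_) (fun v hv => ?_)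
      · have hu : d + 1 ≤ ∑ i ∈ A, u i := by simpa [degGE] using hu
        rcases hu.eq_or_lt with hu | hu
        · refine ⟨u.filter (· ∈ A), Or.inr ?_, filter_le_self _ _⟩
          rw [hVeq, hu]
          exact filter_mem_finsuppAntidiag A u
        · exact ⟨u, Or.inl hu, le_rfl⟩
      · refine ⟨v, Or.inl ?_, le_rfl⟩
        rcases hv with hv | hv
        · simp only [degGE, Set.mem_ofPred_eq] at hv ⊢
          omega
        · exact (Finset.mem_finsuppAntidiag.1 (hV hv)).1.ge
    | succ n ih2 =>
      obtain ⟨N, hN⟩ := Finset.card_pos.1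
        (by omega : 0 < (Finset.finsuppAntidiag A (d + 1) \ V).card)
      obtain ⟨hN1, hN2⟩ := Finset.mem_sdiff.1 hN
      refine TorIndependent.of_insert hF hA (varColon_degGE_union hV hN1 hN2) ?_
      have := ih2 (insert N V) (Finset.insert_subset hN1 hV) (by
        rw [Finset.sdiff_insert, Finset.card_erase_of_mem hN, hn]
        rfl)
      rwa [Finset.coe_insert, Set.union_insert] at this

/-- An element of the symbolic power lies in the unit ideal at the end of the list. It stays in the
ideal as apices are removed one at a time, until only the generators remain. -/
theorem symbolicPower_starIdeal [IsNoetherianRing R] {F : Fin s → R} {c m : ℕ} (hc : 0 < c)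
    (hcs : c < s) (hm : 0 < m) (hF : RegularUpTo F c) :
    symbolicPower (starIdeal F c) m = monomialIdeal F {γ | IsStarGen c m γ} := by
  classical
  apply le_antisymm
  · intro x hx
    have hfin := finite_starIndices (s := s) (m := m) hcs
    have h0 := exists_starExp_eq_zero (s := s) hc hcs hm
    have hsys := isConeSystem_star (s := s) (m := m) hc hcs
    let D₀ : Finset (StarIndex s) := (finite_starGens (m := m) hcs).toFinset.map
      ⟨Sum.inl, Sum.inl_injective⟩
    have hD₀ : IsInitial (starIndices c m) (starRank m) D₀ := by
      constructor
      · intro g hg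
        simp only [D₀, Finset.mem_map, Set.Finite.mem_toFinset] at hg
        obtain ⟨γ, hγ, rfl⟩ := hg
        exact hγ
      · intro g hg h hh hlt
        simp only [D₀, Finset.mem_map, Set.Finite.mem_toFinset] at hg ⊢
        obtain ⟨γ, hγ, rfl⟩ := hg
        rcases h with γ' | g'
        · exact ⟨γ', hh, rfl⟩
        · simp [starRank, Prod.Lex.toLex_lt_toLex] at hlt
    suffices key : ∀ D, IsInitial (starIndices c m) (starRank m) D →
        D₀ ⊆ D → x ∈ monomialIdeal F (starExp '' D) by
      refine monomialIdeal_mono ?_ (key D₀ hD₀ (Finset.Subset.refl _))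
      rintro _ ⟨g, hg, rfl⟩
      simp only [D₀, Finset.coe_map, Set.Finite.coe_toFinset] at hg
      obtain ⟨γ, hγ, rfl⟩ := hg
      exact ⟨γ, hγ, le_rfl⟩
    refine IsInitial.induction_down hfin ?_ ?_
    · intro _
      obtain ⟨g, hg, hg0⟩ := h0
      have : monomialIdeal F (starExp '' (hfin.toFinset : Set (StarIndex s))) = ⊤ :=
        (Ideal.eq_top_iff_one _).2
          (Ideal.subset_span ⟨0, ⟨g, by simpa using hg, hg0⟩, by simp⟩)
      rw [this]
      trivial
    · intro D hD g hg hgD h1 h2 _ ih hsub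
      have hx' := ih (hsub.trans (Finset.subset_insert _ _))
      rw [Finset.coe_insert, Set.image_insert_eq, monomialIdeal_insert, Submodule.mem_sup] at hx'
      obtain ⟨_, hy, x', hx', rfl⟩ := hx'
      obtain ⟨r, rfl⟩ := Ideal.mem_span_singleton'.1 hy
      refine add_mem ?_ hx'
      rw [hsys.mem_iff_mul_mem hfin h0 hF (fun g hg => (card_starDirs_le hg).trans (by omega)) hD
        hg hgD h1 h2]
      have hV := hsys.varColon hD.subset hg hgD h1 h2
      rcases g with γ | ⟨γ, p⟩
      · exact absurd (hsub (Finset.mem_map.2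
          ⟨γ, (Set.Finite.mem_toFinset _).2 hg, rfl⟩)) hgD
      have hg : IsStarCone c m γ p := hg
      change VarColon (starExp '' D) γ (lexPos γ p) at hV
      change r ∈ Ideal.span (F '' (lexPos γ p : Set (Fin s)))
      change r * (γ.prod fun i e => F i ^ e) + x' ∈ _ at hx
      set A := lexPos γ p with hAdef
      set d := ∑ i ∈ A, γ i with hd
      have hA : A.card = c := hg.card_lexPos
      have hdm : d < m := hg.sum_lt
      -- It has to be shown that the coefficient r of F^γ lies in (F_A). Otherwise some associated
      -- prime P of (F_A) contains every z with z r in (F_A), and the symbolic power condition is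
      -- applied at P.
      by_contra hr
      obtain ⟨P, hP, hle⟩ := exists_le_isAssociatedPrime_of_isNoetherianRing R
        (Ideal.Quotient.mk (Ideal.span (F '' (A : Set (Fin s)))) r)
        (fun h => hr (Ideal.Quotient.eq_zero_iff_mem.1 h))
      have hprime := hP.isPrime
      have hrP : ∀ z, z * r ∈ Ideal.span (F '' (A : Set (Fin s))) → z ∈ P := fun z hz => by
        refine hle (Submodule.mem_colon_singleton.2 ?_)
        rw [Submodule.mem_bot]
        exact (Ideal.Quotient.eq_zero_iff_mem.2 hz)
      obtain ⟨w, hwP, hw⟩ := mem_symbolicPower.1 hx P (mem_associatedPrimes_starIdeal hF hA hP)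
      have hw' : w * (r * (γ.prod fun i e => F i ^ e) + x') ∈
          Ideal.span (F '' (A : Set (Fin s))) ^ m :=
        Ideal.pow_right_mono (fun z hz => mem_starIdeal.1 hz A hA) m hw
      let N := γ.filter (· ∈ A)
      have hN : N ∈ Finset.finsuppAntidiag A d := filter_mem_finsuppAntidiag A γ
      let V := (Finset.finsuppAntidiag A d).erase N
      have hV1 : V ⊆ Finset.finsuppAntidiag A d := Finset.erase_subset _ _
      -- By the order of ranks, every exponent in D has A-degree at least d. If it is exactly d, its
      -- A-part differs from N, as otherwise the exponent would divide γ times variables outside A.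
      have hDU : monomialIdeal F (starExp '' D) ≤ monomialIdeal F (degGE A (d + 1) ∪ V) := by
        refine monomialIdeal_mono ?_
        rintro _ ⟨g', hg', rfl⟩
        have hge : d ≤ ∑ i ∈ A, starExp g' i := by
          rcases g' with γ' | ⟨γ', p'⟩
          · exact hdm.le.trans (IsStarGen.le_sum (hD.subset _ hg') hA)
          · have hg2 : IsStarCone c m γ' p' := hD.subset _ hg'
            have h3 := (sum_lexPos_le (x := γ') (p := p') (C := A)
              (by rw [hA, hg2.card_lexPos])).1
            have h4 := h2 _ hg'
            simp only [starRank, Sum.elim_inr, Prod.Lex.toLex_le_toLex] at h4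
            change d ≤ ∑ i ∈ A, γ' i
            have h5 : m - ∑ i ∈ lexPos γ' p', γ' i ≤ m - d := by
              rcases h4 with h4 | ⟨-, h4 | h4⟩
              · omega
              · exact h4.le
              · exact h4.1.le
            omega
        rcases hge.eq_or_lt with heq | hlt
        · refine ⟨(starExp g').filter (· ∈ A), Or.inr ?_, filter_le_self _ _⟩
          refine Finset.mem_coe.2 (Finset.mem_erase.2 ⟨fun e => ?_, ?_⟩)
          · refine hV.not_le ((starExp g').filter (· ∉ A)) (fun a ha => by simp [ha]) _
              ⟨g', hg', rfl⟩ fun i => ?_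
            have e' := DFunLike.congr_fun e i
            simp only [N, Finsupp.filter_apply] at e'
            simp only [Finsupp.add_apply, Finsupp.filter_apply]
            split_ifs at e' ⊢ <;> omega
          · rw [heq]
            exact filter_mem_finsuppAntidiag A _
        · exact ⟨_, Or.inl hlt, le_rfl⟩
      have hQU : Ideal.span (F '' (A : Set (Fin s))) ^ m ≤
          monomialIdeal F (degGE A (d + 1) ∪ V) := by
        refine (span_pow_le_monomialIdeal F A m).trans (monomialIdeal_mono fun u hu => ?_)
        refine ⟨u, Or.inl ?_, le_rfl⟩
        simp only [degGE, Set.mem_ofPred_eq] at hu ⊢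
        omega
      have hmem : w * (r * (γ.prod fun i e => F i ^ e)) ∈
          monomialIdeal F (degGE A (d + 1) ∪ V) := by
        have h3 := sub_mem (hQU hw') (Ideal.mul_mem_left _ w (hDU hx'))
        rwa [mul_add, add_sub_cancel_right] at h3
      let B := γ.filter (· ∉ A)
      have hsplit : (γ.prod fun i e => F i ^ e) =
          (N.prod fun i e => F i ^ e) * (B.prod fun i e => F i ^ e) := by
        rw [← Finsupp.prod_add_index' (by simp) (by simp [pow_add]), Finsupp.filter_add_filter_not]
      have hT : TorIndependent F (insert N (degGE A (d + 1) ∪ V)) := by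
        rw [← Set.union_insert, ← Finset.coe_insert, Finset.insert_erase hN]
        exact torIndependent_degGE_union hF (by omega) d _ (Finset.Subset.refl _)
      have hfinal := hT.mem_of_mul_mem (x := w * (B.prod fun i e => F i ^ e) * r)
        (varColon_degGE_union hV1 hN (by simp [V])) (by
          rw [hsplit] at hmem
          convert hmem using 1
          ring)
      -- So w times a product of forms outside A lies in P, while none of the factors does.
      rcases hprime.mem_or_mem (hrP _ hfinal) with h | h
      · exact hwP h
      · rw [Finsupp.prod, hprime.prod_mem_iff] at h
        obtain ⟨b, hb, hbP⟩ := h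
        have hbA : b ∉ A := fun hbA => by simp [B, hbA] at hb
        exact hF.notMem_associatedPrime hA hP hbA (hprime.mem_of_pow_mem _ hbP)
  · rw [monomialIdeal, Ideal.span_le]
    rintro _ ⟨γ, hγ, rfl⟩
    refine mem_symbolicPower.2 fun P hP => ?_
    obtain ⟨A, hA, hPA⟩ := exists_associatedPrime_of_starIdeal hP
    have hprime : P.IsPrime := hP.1
    -- One factor ∏ F_b over b outside A moves (F_A) into the star ideal; the m-th power does so for
    -- (F_A)^m, which contains F^γ.
    refine ⟨(∏ b ∈ Aᶜ, F b) ^ m, fun h => ?_, ?_⟩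
    · obtain ⟨b, hb, hbP⟩ := (hprime.prod_mem_iff).1 (hprime.mem_of_pow_mem _ h)
      exact hF.notMem_associatedPrime hA hPA (Finset.mem_compl.1 hb) hbP
    · have h1 := prod_pow_mem_span_pow F A (IsStarGen.le_sum hγ hA)
      have h2 : Ideal.span {∏ b ∈ Aᶜ, F b} * Ideal.span (F '' (A : Set (Fin s))) ≤
          starIdeal F c := by
        intro z hz
        obtain ⟨y, hy, rfl⟩ := Ideal.mem_span_singleton_mul.1 hz
        exact prod_compl_mul_mem_starIdeal hA hy
      have h3 := Ideal.pow_right_mono h2 m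
      rw [mul_pow] at h3
      exact h3 (Ideal.mul_mem_mul (Ideal.pow_mem_pow (Ideal.mem_span_singleton_self _) _) h1)

end SymbolicPower

/-! ### Homogeneous vectors and graded maps -/

section GradedVectors

variable {σ k : Type*} [Field k]

theorem homogeneousComponent_mul_of_isHomogeneous {a : MvPolynomial σ k} {e : ℕ}
    (ha : a.IsHomogeneous e) (v : MvPolynomial σ k) (n : ℕ) :
    homogeneousComponent n (v * a) =
      if e ≤ n then homogeneousComponent (n - e) v * a else 0 := by
  classical
  conv_lhs => rw [← sum_homogeneousComponent v, Finset.sum_mul, map_sum]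
  have h1 : ∀ i, homogeneousComponent n (homogeneousComponent i v * a) =
      if n = i + e then homogeneousComponent i v * a else 0 := fun i => by
    rw [homogeneousComponent_of_mem
      ((homogeneousComponent_isHomogeneous i v).mul ha : (_ * a).IsHomogeneous (i + e))]
  rw [Finset.sum_congr rfl fun i _ => h1 i]
  split_ifs with hen
  · by_cases hv : n - e < v.totalDegree + 1
    · rw [Finset.sum_eq_single (n - e)]
      · rw [if_pos (by omega)]
      · intro i _ hi
        rw [if_neg (by omega)]
      · intro h
        simp only [Finset.mem_range] at h
        exact absurd hv h
    · rw [homogeneousComponent_eq_zero (n - e) v (by omega), zero_mul]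
      refine Finset.sum_eq_zero fun i hi => ?_
      rw [Finset.mem_range] at hi
      rw [if_neg (by omega)]
  · refine Finset.sum_eq_zero fun i _ => ?_
    rw [if_neg (by omega)]

/-- `v` is homogeneous of degree `j` in the free module with basis elements in degrees `deg`. -/
def IsGradedVec {ι : Type*} (deg : ι → ℕ) (j : ℕ) (v : ι → MvPolynomial σ k) : Prop :=
  ∀ p, v p = 0 ∨ ∃ e : ℕ, deg p + e = j ∧ (v p).IsHomogeneous e

/-- The component of degree `j` of a vector. -/
noncomputable def gradedProj {ι : Type*} (deg : ι → ℕ) (j : ℕ) (v : ι → MvPolynomial σ k) :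
    ι → MvPolynomial σ k :=
  fun p => if deg p ≤ j then homogeneousComponent (j - deg p) (v p) else 0

theorem isGradedVec_gradedProj {ι : Type*} (deg : ι → ℕ) (j : ℕ) (v : ι → MvPolynomial σ k) :
    IsGradedVec deg j (gradedProj deg j v) := fun p => by
  unfold gradedProj
  split_ifs with h
  · exact Or.inr ⟨j - deg p, by omega, homogeneousComponent_isHomogeneous _ _⟩
  · exact Or.inl rfl

theorem IsGradedVec.gradedProj_eq {ι : Type*} {deg : ι → ℕ} {j : ℕ} {v : ι → MvPolynomial σ k}
    (h : IsGradedVec deg j v) : gradedProj deg j v = v := by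
  funext p
  unfold gradedProj
  rcases h p with h | ⟨e, he, hv⟩
  · simp [h]
  · rw [if_pos (by omega), homogeneousComponent_of_mem hv, if_pos (by omega)]

theorem LinearMap.map_eq_sum_smul_single {A ι M : Type*} [CommRing A] [Fintype ι] [DecidableEq ι]
    [AddCommGroup M] [Module A M] (f : (ι → A) →ₗ[A] M) (v : ι → A) :
    f v = ∑ q, v q • f (Pi.single q 1) := by
  conv_lhs => rw [← Finset.univ_sum_single v, map_sum]
  refine Finset.sum_congr rfl fun q _ => ?_
  rw [← map_smul, ← Pi.single_smul', smul_eq_mul, mul_one]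

theorem LinearMap.apply_eq_sum_single {A ι κ : Type*} [CommRing A] [Fintype ι] [DecidableEq ι]
    (f : (ι → A) →ₗ[A] (κ → A)) (v : ι → A) (p : κ) :
    f v p = ∑ q, v q * f (Pi.single q 1) p := by
  rw [LinearMap.map_eq_sum_smul_single f v, Finset.sum_apply]
  rfl

/-- An ideal closed under taking homogeneous components. -/
def IsHomogeneousIdeal (J : Ideal (MvPolynomial σ k)) : Prop :=
  ∀ r ∈ J, ∀ j, homogeneousComponent j r ∈ J

theorem isHomogeneousIdeal_span {S : Set (MvPolynomial σ k)}
    (hS : ∀ f ∈ S, ∃ d, f.IsHomogeneous d) : IsHomogeneousIdeal (Ideal.span S) := by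
  intro r hr j
  induction hr using Submodule.span_induction with
  | mem f hf =>
    obtain ⟨d, hd⟩ := hS f hf
    rw [homogeneousComponent_of_mem hd]
    split_ifs
    · exact Ideal.subset_span hf
    · exact zero_mem _
  | zero => simp
  | add x y _ _ hx hy => rw [map_add]; exact add_mem hx hy
  | smul a x hx ih =>
    obtain ⟨c, hc, hcx⟩ := (Submodule.mem_span_set (R := MvPolynomial σ k)).1 hx
    rw [← hcx, Finsupp.sum, Finset.smul_sum, map_sum]
    refine sum_mem fun f hf => ?_
    obtain ⟨d, hd⟩ := hS f (hc hf)
    rw [smul_eq_mul, smul_eq_mul, ← mul_assoc, homogeneousComponent_mul_of_isHomogeneous hd]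
    split_ifs
    · exact Ideal.mul_mem_left _ _ (Ideal.subset_span (hc hf))
    · exact zero_mem _

/-- A homogeneous map of degree `0` between graded free modules. -/
def IsGradedMap {ι κ : Type*} [DecidableEq ι] (degι : ι → ℕ) (degκ : κ → ℕ)
    (f : (ι → MvPolynomial σ k) →ₗ[MvPolynomial σ k] (κ → MvPolynomial σ k)) : Prop :=
  ∀ q, IsGradedVec degκ (degι q) (f (Pi.single q 1))

theorem IsGradedMap.map_gradedProj {ι κ : Type*} [Fintype ι] [DecidableEq ι] {degι : ι → ℕ}
    {degκ : κ → ℕ} {f : (ι → MvPolynomial σ k) →ₗ[MvPolynomial σ k] (κ → MvPolynomial σ k)}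
    (hf : IsGradedMap degι degκ f) (j : ℕ) (v : ι → MvPolynomial σ k) :
    f (gradedProj degι j v) = gradedProj degκ j (f v) := by
  funext p
  rw [LinearMap.apply_eq_sum_single]
  unfold gradedProj
  have key : ∀ q, (if degι q ≤ j then homogeneousComponent (j - degι q) (v q) else 0) *
      f (Pi.single q 1) p =
      if degκ p ≤ j then homogeneousComponent (j - degκ p) (v q * f (Pi.single q 1) p) else 0 := by
    intro q
    rcases hf q p with h | ⟨e, he, h⟩
    · simp [h]
    · rw [homogeneousComponent_mul_of_isHomogeneous h]
      by_cases h1 : degι q ≤ j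
      · rw [if_pos h1, if_pos (by omega), if_pos (by omega)]
        congr 3
        omega
      · rw [if_neg h1, zero_mul]
        split_ifs <;> first | rfl | omega
  rw [Finset.sum_congr rfl fun q _ => key q]
  split_ifs with h
  · rw [LinearMap.apply_eq_sum_single f v, map_sum]
  · simp

theorem IsGradedMap.isGradedVec {ι κ : Type*} [Fintype ι] [DecidableEq ι] {degι : ι → ℕ}
    {degκ : κ → ℕ} {f : (ι → MvPolynomial σ k) →ₗ[MvPolynomial σ k] (κ → MvPolynomial σ k)}
    (hf : IsGradedMap degι degκ f) {j : ℕ} {v : ι → MvPolynomial σ k}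
    (hv : IsGradedVec degι j v) : IsGradedVec degκ j (f v) := by
  rw [← hv.gradedProj_eq, hf.map_gradedProj]
  exact isGradedVec_gradedProj _ _ _

end GradedVectors

/-- Dependent choice, used to build chain maps and homotopies degree by degree. -/
theorem exists_dependent_seq {α : ℕ → Type*} {P : ∀ i, α i → Prop}
    {Q : ∀ i, α i → α (i + 1) → Prop} (a₀ : α 0) (h₀ : P 0 a₀)
    (hs : ∀ i a, P i a → ∃ b, P (i + 1) b ∧ Q i a b) :
    ∃ f : ∀ i, α i, f 0 = a₀ ∧ (∀ i, P i (f i)) ∧ ∀ i, Q i (f i) (f (i + 1)) := by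
  choose g hg using hs
  let f : ∀ i, {a : α i // P i a} :=
    fun i => Nat.rec ⟨a₀, h₀⟩ (fun i a => ⟨g i a.1 a.2, (hg i a.1 a.2).1⟩) i
  exact ⟨fun i => (f i).1, rfl, fun i => (f i).2, fun i => (hg i (f i).1 (f i).2).2⟩

/-! ### Graded resolutions and uniqueness of Betti numbers -/

section Resolutions

variable {σ k : Type*} [Field k]

/-- A graded free resolution of `R ⧸ J` by free modules of finite rank, with arbitrary finite
types indexing the bases. -/
structure GradedRes (J : Ideal (MvPolynomial σ k)) where
  /-- The basis of the `i`-th module. -/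
  ι : ℕ → Type
  [fin : ∀ i, Fintype (ι i)]
  [dec : ∀ i, DecidableEq (ι i)]
  /-- The degrees of the basis elements. -/
  deg : ∀ i, ι i → ℕ
  /-- The differential. -/
  diff : ∀ i, (ι (i + 1) → MvPolynomial σ k) →ₗ[MvPolynomial σ k] (ι i → MvPolynomial σ k)
  /-- The augmentation. -/
  aug : (ι 0 → MvPolynomial σ k) →ₗ[MvPolynomial σ k] (MvPolynomial σ k ⧸ J)
  graded : ∀ i, IsGradedMap (deg (i + 1)) (deg i) (diff i)
  aug_graded : ∀ q, ∃ f : MvPolynomial σ k,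
    f.IsHomogeneous (deg 0 q) ∧ aug (Pi.single q 1) = Ideal.Quotient.mk J f
  aug_surjective : Function.Surjective aug
  exact_zero : Function.Exact (diff 0) aug
  exact_succ : ∀ i, Function.Exact (diff (i + 1)) (diff i)

attribute [instance] GradedRes.fin GradedRes.dec

namespace GradedRes

variable {I J : Ideal (MvPolynomial σ k)}

/-- All entries of the differentials lie in the homogeneous maximal ideal. -/
def Minimal (X : GradedRes J) : Prop :=
  ∀ i p q, constantCoeff (X.diff i (Pi.single q 1) p) = 0

/-- The number of basis elements of degree `j` in homological degree `i`. -/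
def betti (X : GradedRes J) (i j : ℕ) : ℕ := (Finset.univ.filter fun q => X.deg i q = j).card

/-- The kernels of the augmentation and of the differentials. -/
noncomputable def cycles (X : GradedRes J) :
    ∀ i, Submodule (MvPolynomial σ k) (X.ι i → MvPolynomial σ k)
  | 0 => LinearMap.ker X.aug
  | i + 1 => LinearMap.ker (X.diff i)

theorem mem_cycles_iff (X : GradedRes J) (i : ℕ) (v : X.ι i → MvPolynomial σ k) :
    v ∈ X.cycles i ↔ ∃ w, X.diff i w = v := by
  cases i with
  | zero => exact X.exact_zero v
  | succ i => exact X.exact_succ i v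

theorem diff_mem_cycles (X : GradedRes J) (i : ℕ) (w : X.ι (i + 1) → MvPolynomial σ k) :
    X.diff i w ∈ X.cycles i := (X.mem_cycles_iff i _).2 ⟨w, rfl⟩

theorem diff_diff (X : GradedRes J) (i : ℕ) (w : X.ι (i + 2) → MvPolynomial σ k) :
    X.diff i (X.diff (i + 1) w) = 0 := X.diff_mem_cycles (i + 1) w

theorem aug_diff (X : GradedRes J) (w : X.ι 1 → MvPolynomial σ k) :
    X.aug (X.diff 0 w) = 0 := X.diff_mem_cycles 0 w

/-- Homogeneous preimages under the augmentation. -/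
theorem exists_aug_eq (X : GradedRes J) (hJ : IsHomogeneousIdeal J)
    {j : ℕ} {r : MvPolynomial σ k} (hr : r.IsHomogeneous j) :
    ∃ x, IsGradedVec (X.deg 0) j x ∧ X.aug x = Ideal.Quotient.mk J r := by
  obtain ⟨x, hx⟩ := X.aug_surjective (Ideal.Quotient.mk J r)
  refine ⟨gradedProj (X.deg 0) j x, isGradedVec_gradedProj _ _ _, ?_⟩
  choose f hf hfa using X.aug_graded
  have haug : ∀ v, X.aug v = Ideal.Quotient.mk J (∑ q, v q * f q) := fun v => by
    rw [LinearMap.map_eq_sum_smul_single X.aug v, map_sum]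
    refine Finset.sum_congr rfl fun q _ => ?_
    rw [map_mul, hfa]
    rfl
  rw [haug, Ideal.Quotient.eq] at hx
  rw [haug, Ideal.Quotient.eq]
  have h1 := hJ _ hx j
  rw [map_sub, homogeneousComponent_of_mem hr, if_pos rfl, map_sum] at h1
  convert h1 using 3 with q
  rw [homogeneousComponent_mul_of_isHomogeneous (hf q)]
  unfold gradedProj
  split_ifs <;> simp

/-- Homogeneous preimages of cycles. -/
theorem exists_diff_eq (X : GradedRes J) {i j : ℕ} {z : X.ι i → MvPolynomial σ k}
    (hz : z ∈ X.cycles i) (hj : IsGradedVec (X.deg i) j z) :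
    ∃ x, IsGradedVec (X.deg (i + 1)) j x ∧ X.diff i x = z := by
  obtain ⟨x, rfl⟩ := (X.mem_cycles_iff i z).1 hz
  refine ⟨gradedProj (X.deg (i + 1)) j x, isGradedVec_gradedProj _ _ _, ?_⟩
  rw [(X.graded i).map_gradedProj, hj.gradedProj_eq]

theorem linearMap_ext {ι M : Type*} [Fintype ι] [DecidableEq ι] [AddCommGroup M]
    [Module (MvPolynomial σ k) M] {f g : (ι → MvPolynomial σ k) →ₗ[MvPolynomial σ k] M}
    (h : ∀ q, f (Pi.single q 1) = g (Pi.single q 1)) (v : ι → MvPolynomial σ k) : f v = g v := by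
  have : f = g := LinearMap.pi_ext' fun q => LinearMap.ext_ring (h q)
  rw [this]

/-- Lifting of multiplication by a homogeneous element `f` to a chain map. -/
theorem exists_lift (Y : GradedRes I) (X : GradedRes J)
    (hJ : IsHomogeneousIdeal J) {f : MvPolynomial σ k} {d : ℕ}
    (hf : f.IsHomogeneous d)
    (μ : (MvPolynomial σ k ⧸ I) →ₗ[MvPolynomial σ k] (MvPolynomial σ k ⧸ J))
    (hμ : ∀ r, μ (Ideal.Quotient.mk I r) = Ideal.Quotient.mk J (f * r)) :
    ∃ φ : ∀ i, (Y.ι i → MvPolynomial σ k) →ₗ[MvPolynomial σ k] (X.ι i → MvPolynomial σ k),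
      (∀ i, IsGradedMap (fun q => d + Y.deg i q) (X.deg i) (φ i)) ∧
      (∀ v, X.aug (φ 0 v) = μ (Y.aug v)) ∧
      ∀ i v, X.diff i (φ (i + 1) v) = φ i (Y.diff i v) := by
  have h0 : ∀ q, ∃ x, IsGradedVec (X.deg 0) (d + Y.deg 0 q) x ∧
      X.aug x = μ (Y.aug (Pi.single q 1)) := fun q => by
    obtain ⟨g, hg, hq⟩ := Y.aug_graded q
    rw [hq, hμ]
    exact X.exists_aug_eq hJ (hf.mul hg)
  choose g hg hga using h0
  have hφ0 : ∀ v, X.aug (Fintype.linearCombination _ g v) = μ (Y.aug v) := fun v => by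
    refine linearMap_ext (f := X.aug ∘ₗ Fintype.linearCombination _ g) (g := μ ∘ₗ Y.aug)
      (fun q => ?_) v
    simp [hga]
  obtain ⟨φ, hφ1, hφ2, hφ3⟩ := exists_dependent_seq
    (α := fun i => (Y.ι i → MvPolynomial σ k) →ₗ[MvPolynomial σ k] (X.ι i → MvPolynomial σ k))
    (P := fun i φ => IsGradedMap (fun q => d + Y.deg i q) (X.deg i) φ ∧
      ∀ v ∈ Y.cycles i, φ v ∈ X.cycles i)
    (Q := fun i φ φ' => ∀ v, X.diff i (φ' v) = φ (Y.diff i v))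
    (Fintype.linearCombination _ g) ⟨fun q => by simpa using hg q, fun v hv => by
      change X.aug _ = 0
      rw [hφ0, (show Y.aug v = 0 from hv), map_zero]⟩ (by
      rintro i φ ⟨h1, h2⟩
      have h3 : ∀ q, ∃ x, IsGradedVec (X.deg (i + 1)) (d + Y.deg (i + 1) q) x ∧
          X.diff i x = φ (Y.diff i (Pi.single q 1)) := fun q => by
        refine X.exists_diff_eq (h2 _ (Y.diff_mem_cycles i _)) (h1.isGradedVec fun p => ?_)
        rcases Y.graded i q p with h | ⟨e, he, h⟩
        · exact Or.inl h
        · exact Or.inr ⟨e, by simp only; omega, h⟩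
      choose g hg hgd using h3
      have h4 : ∀ v, X.diff i (Fintype.linearCombination _ g v) = φ (Y.diff i v) := fun v => by
        refine linearMap_ext (f := X.diff i ∘ₗ Fintype.linearCombination _ g)
          (g := φ ∘ₗ Y.diff i) (fun q => ?_) v
        simp [hgd]
      refine ⟨Fintype.linearCombination _ g, ⟨fun q => by simpa using hg q, fun v hv => ?_⟩, h4⟩
      change X.diff i _ = 0
      rw [h4, (show Y.diff i v = 0 from hv), map_zero])
  exact ⟨φ, fun i => (hφ2 i).1, fun v => by rw [hφ1, hφ0], hφ3⟩

theorem constantCoeff_apply_eq_zero {ι κ : Type*} [Fintype ι] [DecidableEq ι]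
    (f : (ι → MvPolynomial σ k) →ₗ[MvPolynomial σ k] (κ → MvPolynomial σ k))
    (v : ι → MvPolynomial σ k) (p : κ)
    (h : ∀ q, constantCoeff (v q) = 0 ∨ constantCoeff (f (Pi.single q 1) p) = 0) :
    constantCoeff (f v p) = 0 := by
  rw [LinearMap.apply_eq_sum_single, map_sum]
  refine Finset.sum_eq_zero fun q _ => ?_
  rw [map_mul]
  rcases h q with h | h <;> simp [h]

/-- A chain endomorphism of a minimal resolution lifting zero is zero modulo the homogeneous
maximal ideal. -/
theorem Minimal.constantCoeff_eq_zero {X : GradedRes J} (hX : X.Minimal)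
    (e : ∀ i, (X.ι i → MvPolynomial σ k) →ₗ[MvPolynomial σ k] (X.ι i → MvPolynomial σ k))
    (he0 : ∀ v, X.aug (e 0 v) = 0) (he : ∀ i v, X.diff i (e (i + 1) v) = e i (X.diff i v))
    (i : ℕ) (v : X.ι i → MvPolynomial σ k) (p : X.ι i) : constantCoeff (e i v p) = 0 := by
  have hmin : ∀ i w p, constantCoeff (X.diff i w p) = 0 := fun i w p =>
    constantCoeff_apply_eq_zero _ _ _ fun q => Or.inr (hX i p q)
  have lift : ∀ i (g : (X.ι i → MvPolynomial σ k) →ₗ[MvPolynomial σ k]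
      (X.ι i → MvPolynomial σ k)), (∀ v, g v ∈ X.cycles i) →
      ∃ h : (X.ι i → MvPolynomial σ k) →ₗ[MvPolynomial σ k] (X.ι (i + 1) → MvPolynomial σ k),
        ∀ v, X.diff i (h v) = g v := fun i g hg => by
    choose h hh using fun q : X.ι i => (X.mem_cycles_iff i _).1 (hg (Pi.single q 1))
    refine ⟨Fintype.linearCombination _ h, fun v => ?_⟩
    refine linearMap_ext (f := X.diff i ∘ₗ Fintype.linearCombination _ h) (g := g)
      (fun q => ?_) v
    simp [hh]
  obtain ⟨h₀, hh₀⟩ := lift 0 (e 0) he0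
  -- A homotopy from e to 0: then e = dh + hd, and the entries of d lie in the maximal ideal.
  obtain ⟨h, h1, -, h3⟩ := exists_dependent_seq
    (α := fun i => (X.ι i → MvPolynomial σ k) →ₗ[MvPolynomial σ k]
      (X.ι (i + 1) → MvPolynomial σ k))
    (P := fun i h => ∀ v, e (i + 1) v - h (X.diff i v) ∈ X.cycles (i + 1))
    (Q := fun i h h' => ∀ v, e (i + 1) v = X.diff (i + 1) (h' v) + h (X.diff i v))
    h₀ (fun v => by
      change X.diff 0 _ = 0
      rw [map_sub, he, hh₀, sub_self]) (by
      intro i h hP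
      obtain ⟨h', hh'⟩ := lift (i + 1) (e (i + 1) - h ∘ₗ X.diff i) hP
      have h4 : ∀ v, e (i + 1) v = X.diff (i + 1) (h' v) + h (X.diff i v) := fun v => by
        rw [hh']
        simp
      refine ⟨h', fun v => ?_, h4⟩
      change X.diff (i + 1) _ = 0
      rw [map_sub, he, h4, X.diff_diff, map_zero, add_zero, sub_self])
  cases i with
  | zero => rw [← hh₀]; exact hmin 0 _ p
  | succ i =>
    rw [h3, Pi.add_apply, map_add, hmin, zero_add]
    exact constantCoeff_apply_eq_zero _ _ _ fun q => Or.inl (hmin i v q)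

/-- Comparison maps Y → X → Y compose to the identity modulo the maximal ideal, by minimality of Y.
In degree j the identity matrix thus factors through a space of dimension `X.betti i j`, which
bounds its rank. -/
theorem Minimal.betti_le {X Y : GradedRes J} (hJ : IsHomogeneousIdeal J)
    (hY : Y.Minimal) (i j : ℕ) : Y.betti i j ≤ X.betti i j := by
  obtain ⟨φ, hφ, hφ0, hφd⟩ := exists_lift Y X hJ (isHomogeneous_one σ k) LinearMap.id (by simp)
  obtain ⟨ψ, hψ, hψ0, hψd⟩ := exists_lift X Y hJ (isHomogeneous_one σ k) LinearMap.id (by simp)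
  have h1 := hY.constantCoeff_eq_zero (fun i => ψ i ∘ₗ φ i - LinearMap.id)
    (fun v => by simp [hψ0, hφ0]) (fun i v => by simp [hψd, hφd]) i
  let B : Matrix {q // Y.deg i q = j} {q // X.deg i q = j} k :=
    fun p r => constantCoeff (ψ i (Pi.single r.1 1) p.1)
  let A : Matrix {q // X.deg i q = j} {q // Y.deg i q = j} k :=
    fun r q => constantCoeff (φ i (Pi.single q.1 1) r.1)
  have hBA : B * A = 1 := by
    ext p q
    have h2 := h1 (Pi.single q.1 1) p.1
    rw [LinearMap.sub_apply, Pi.sub_apply, map_sub, sub_eq_zero, LinearMap.comp_apply,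
      LinearMap.apply_eq_sum_single, map_sum] at h2
    rw [Matrix.mul_apply, Matrix.one_apply]
    have h3 : constantCoeff ((LinearMap.id (R := MvPolynomial σ k) (Pi.single q.1 1 :
        Y.ι i → MvPolynomial σ k)) p.1) = if p = q then (1 : k) else 0 := by
      rw [LinearMap.id_apply, Pi.single_apply]
      by_cases hpq : p = q
      · simp [hpq]
      · have : p.1 ≠ q.1 := fun h => hpq (Subtype.ext h)
        simp [hpq, this]
    rw [← h3, ← h2]
    rw [← Finset.sum_subset (Finset.subset_univ (Finset.univ.filter fun r => X.deg i r = j)),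
      Finset.sum_subtype _ (p := fun r => X.deg i r = j) (by simp)]
    · exact Finset.sum_congr rfl fun r _ => by rw [map_mul, mul_comm]
    -- Entries between basis elements of different degrees are homogeneous of nonzero degree or
    -- zero, so only degree j contributes.
    · intro r _ hr
      simp only [Finset.mem_filter, Finset.mem_univ, true_and] at hr
      rw [map_mul]
      rcases hφ i q.1 r with h | ⟨e, he, h⟩
      · simp [h]
      · have hq := q.2
        simp only [zero_add] at he
        rw [constantCoeff_eq, h.coeff_eq_zero (by simp; omega), zero_mul]
  have h4 : (1 : Matrix {q // Y.deg i q = j} {q // Y.deg i q = j} k).rank ≤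
      Fintype.card {q // X.deg i q = j} := by
    rw [← hBA]
    exact (Matrix.rank_mul_le_left B A).trans (Matrix.rank_le_card_width B)
  rw [Matrix.rank_one, Fintype.card_subtype, Fintype.card_subtype] at h4
  exact h4

theorem Minimal.betti_eq {X Y : GradedRes J} (hJ : IsHomogeneousIdeal J)
    (hX : X.Minimal) (hY : Y.Minimal) (i j : ℕ) : Y.betti i j = X.betti i j :=
  le_antisymm (hY.betti_le hJ i j) (hX.betti_le hJ i j)

end GradedRes

end Resolutions

/-! ### Mapping cones -/

namespace GradedRes

variable {σ k : Type*} [Field k] {I I' J : Ideal (MvPolynomial σ k)}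

/-- The basis of the mapping cone. -/
abbrev coneIdx (X : GradedRes I) (Y : GradedRes I') : ℕ → Type
  | 0 => X.ι 0
  | i + 1 => X.ι (i + 1) ⊕ Y.ι i

instance (X : GradedRes I) (Y : GradedRes I') : ∀ i, Fintype (coneIdx X Y i)
  | 0 => inferInstanceAs (Fintype (X.ι 0))
  | i + 1 => inferInstanceAs (Fintype (X.ι (i + 1) ⊕ Y.ι i))

instance (X : GradedRes I) (Y : GradedRes I') : ∀ i, DecidableEq (coneIdx X Y i)
  | 0 => inferInstanceAs (DecidableEq (X.ι 0))
  | i + 1 => inferInstanceAs (DecidableEq (X.ι (i + 1) ⊕ Y.ι i))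

/-- The degrees of the basis elements of the mapping cone of a map of degree `d`. -/
def coneDeg (X : GradedRes I) (Y : GradedRes I') (d : ℕ) : ∀ i, coneIdx X Y i → ℕ
  | 0 => X.deg 0
  | i + 1 => Sum.elim (X.deg (i + 1)) fun q => d + Y.deg i q

/-- The differential of the mapping cone. -/
noncomputable def coneDiff (X : GradedRes I) (Y : GradedRes I')
    (φ : ∀ i, (Y.ι i → MvPolynomial σ k) →ₗ[MvPolynomial σ k] (X.ι i → MvPolynomial σ k)) :
    ∀ i, (coneIdx X Y (i + 1) → MvPolynomial σ k) →ₗ[MvPolynomial σ k]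
      (coneIdx X Y i → MvPolynomial σ k)
  | 0 => X.diff 0 ∘ₗ LinearMap.funLeft _ _ Sum.inl + φ 0 ∘ₗ LinearMap.funLeft _ _ Sum.inr
  | i + 1 =>
    { toFun := fun v : (X.ι (i + 2) ⊕ Y.ι (i + 1) → MvPolynomial σ k) =>
        Sum.elim (X.diff (i + 1) (v ∘ Sum.inl) + φ (i + 1) (v ∘ Sum.inr))
          (-(Y.diff i (v ∘ Sum.inr)))
      map_add' := fun v w => by
        have h1 : ∀ {α β : Type} (g : α → β) (v w : β → MvPolynomial σ k),
          (v + w) ∘ g = v ∘ g + w ∘ g := fun _ _ _ => rfl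
        simp only [h1, map_add]
        funext x
        rcases x with x | x <;> simp only [Sum.elim_inl, Sum.elim_inr, Pi.add_apply, Pi.neg_apply]
          <;> ring
      map_smul' := fun r v => by
        have h1 : ∀ {α β : Type} (g : α → β) (v : β → MvPolynomial σ k),
          (r • v) ∘ g = r • (v ∘ g) := fun _ _ => rfl
        simp only [h1, map_smul, RingHom.id_apply]
        funext x
        rcases x with x | x <;> simp only [Sum.elim_inl, Sum.elim_inr, Pi.add_apply, Pi.neg_apply,
          Pi.smul_apply, smul_eq_mul] <;> ring }

section Cone

variable (X : GradedRes I) (Y : GradedRes I')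
  (φ : ∀ i, (Y.ι i → MvPolynomial σ k) →ₗ[MvPolynomial σ k] (X.ι i → MvPolynomial σ k))

theorem coneDiff_zero_elim (x : X.ι 1 → MvPolynomial σ k) (y : Y.ι 0 → MvPolynomial σ k) :
    coneDiff X Y φ 0 (Sum.elim x y) = X.diff 0 x + φ 0 y := rfl

theorem coneDiff_succ_elim (i : ℕ) (x : X.ι (i + 2) → MvPolynomial σ k)
    (y : Y.ι (i + 1) → MvPolynomial σ k) :
    coneDiff X Y φ (i + 1) (Sum.elim x y) =
      Sum.elim (X.diff (i + 1) x + φ (i + 1) y) (-(Y.diff i y)) := rfl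

theorem exists_eq_elim {α β γ : Type*} (v : α ⊕ β → γ) : ∃ x y, v = Sum.elim x y :=
  ⟨v ∘ Sum.inl, v ∘ Sum.inr, (Sum.elim_comp_inl_inr v).symm⟩

theorem single_inl (i : ℕ) (q : X.ι (i + 1)) :
    (Pi.single (Sum.inl q : X.ι (i + 1) ⊕ Y.ι i) 1 : coneIdx X Y (i + 1) → MvPolynomial σ k) =
      Sum.elim (Pi.single q 1) 0 := (Sum.elim_single_zero q 1).symm

theorem single_inr (i : ℕ) (q : Y.ι i) :
    (Pi.single (Sum.inr q : X.ι (i + 1) ⊕ Y.ι i) 1 : coneIdx X Y (i + 1) → MvPolynomial σ k) =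
      Sum.elim (0 : X.ι (i + 1) → MvPolynomial σ k) (Pi.single q 1) := (Sum.elim_zero_single q 1).symm

end Cone

theorem card_filter_sumElim {α β : Type*} [Fintype α] [Fintype β] (f : α → ℕ) (g : β → ℕ) (j : ℕ) :
    (Finset.univ.filter fun q => Sum.elim f g q = j).card =
      (Finset.univ.filter fun q => f q = j).card + (Finset.univ.filter fun q => g q = j).card := by
  rw [Finset.card_filter, Fintype.sum_sum_type, Finset.card_filter, Finset.card_filter]
  rfl

/-- The mapping cone of a lift of multiplication by `f` on `R ⧸ (I : f) → R ⧸ I` resolves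
`R ⧸ (I + (f))`. -/
theorem exists_cone (X : GradedRes I) (Y : GradedRes I') (hI : IsHomogeneousIdeal I)
    {f : MvPolynomial σ k} {d : ℕ} (hf : f.IsHomogeneous d) (hI' : ∀ x, x * f ∈ I ↔ x ∈ I')
    (hJ : J = Ideal.span {f} ⊔ I) (hX : X.Minimal) (hY : Y.Minimal)
    (hdeg : ∀ i p q, X.deg i p ≠ d + Y.deg i q) :
    ∃ Z : GradedRes J, Z.Minimal ∧ (∀ j, Z.betti 0 j = X.betti 0 j) ∧
      ∀ i j, Z.betti (i + 1) j =
        X.betti (i + 1) j + if d ≤ j then Y.betti i (j - d) else 0 := by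
  have hIJ : I ≤ J := hJ ▸ le_sup_right
  have hfJ : f ∈ J := hJ ▸ Submodule.mem_sup_left (Ideal.mem_span_singleton_self f)
  obtain ⟨μ, hμ⟩ : ∃ μ : (MvPolynomial σ k ⧸ I') →ₗ[MvPolynomial σ k] (MvPolynomial σ k ⧸ I),
      ∀ r, μ (Ideal.Quotient.mk I' r) = Ideal.Quotient.mk I (f * r) := by
    refine ⟨Submodule.mapQ I' I (LinearMap.mulLeft (MvPolynomial σ k) f) fun x hx => ?_,
      fun r => rfl⟩
    rw [Submodule.mem_comap, LinearMap.mulLeft_apply, mul_comm]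
    exact (hI' x).2 hx
  -- As I' is the colon of I by f, multiplication by f is injective on the quotients, so the cone
  -- has no homology in positive degrees.
  have hμinj : ∀ z, μ z = 0 → z = 0 := fun z hz => by
    obtain ⟨r, rfl⟩ := Ideal.Quotient.mk_surjective z
    rw [hμ, Ideal.Quotient.eq_zero_iff_mem, mul_comm] at hz
    exact Ideal.Quotient.eq_zero_iff_mem.2 ((hI' r).1 hz)
  obtain ⟨φ, hφ, hφ0, hφd⟩ := exists_lift Y X hI hf μ hμ
  let π : (MvPolynomial σ k ⧸ I) →ₗ[MvPolynomial σ k] (MvPolynomial σ k ⧸ J) :=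
    Submodule.factor hIJ
  have hπ : ∀ r, π (Ideal.Quotient.mk I r) = Ideal.Quotient.mk J r := fun r => rfl
  have hπker : ∀ z, π z = 0 ↔ ∃ y, z = μ y := fun z => by
    obtain ⟨r, rfl⟩ := Ideal.Quotient.mk_surjective z
    rw [hπ, Ideal.Quotient.eq_zero_iff_mem, hJ, Submodule.mem_sup]
    constructor
    · rintro ⟨_, ha, b, hb, rfl⟩
      obtain ⟨a, rfl⟩ := Ideal.mem_span_singleton'.1 ha
      refine ⟨Ideal.Quotient.mk I' a, ?_⟩
      rw [hμ, map_add, Ideal.Quotient.eq_zero_iff_mem.2 hb, add_zero, mul_comm]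
    · rintro ⟨y, hy⟩
      obtain ⟨a, rfl⟩ := Ideal.Quotient.mk_surjective y
      rw [hμ, Ideal.Quotient.eq] at hy
      exact ⟨f * a, Ideal.mul_mem_right _ _ (Ideal.mem_span_singleton_self f), _, hy, by ring⟩
  let Z : GradedRes J :=
    { ι := coneIdx X Y
      deg := coneDeg X Y d
      diff := coneDiff X Y φ
      aug := π ∘ₗ X.aug
      graded := by
        rintro (_ | i) (q | q)
        · rw [single_inl, coneDiff_zero_elim, map_zero, add_zero]
          exact X.graded 0 q
        · rw [single_inr, coneDiff_zero_elim, map_zero, zero_add (φ 0 _)]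
          exact hφ 0 q
        · rw [single_inl, coneDiff_succ_elim, map_zero, map_zero, add_zero]
          rintro (p | p)
          · exact X.graded (i + 1) q p
          · exact Or.inl (by simp)
        · rw [single_inr, coneDiff_succ_elim, map_zero, zero_add]
          rintro (p | p)
          · exact hφ (i + 1) q p
          · rcases Y.graded i q p with h | ⟨e, he, h⟩
            · exact Or.inl (by simp [h])
            · exact Or.inr ⟨e, by simp only [coneDeg, Sum.elim_inr]; omega, h.neg⟩
      aug_graded := fun q => by
        obtain ⟨g, hg, hq⟩ := X.aug_graded q
        exact ⟨g, hg, by rw [← hπ, ← hq]; rfl⟩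
      aug_surjective := (Submodule.factor_surjective hIJ).comp X.aug_surjective
      exact_zero := fun x => by
        constructor
        · intro hx
          obtain ⟨z, hz⟩ := (hπker _).1 hx
          obtain ⟨y, rfl⟩ := Y.aug_surjective z
          rw [← hφ0, ← sub_eq_zero, ← map_sub] at hz
          obtain ⟨w, hw⟩ := (X.exact_zero _).1 hz
          exact ⟨Sum.elim w y, by rw [coneDiff_zero_elim, hw, sub_add_cancel]⟩
        · rintro ⟨v, rfl⟩
          obtain ⟨w, y, rfl⟩ := exists_eq_elim v
          refine (hπker _).2 ⟨Y.aug y, ?_⟩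
          rw [coneDiff_zero_elim, map_add, X.aug_diff, zero_add, hφ0]
      exact_succ := by
        rintro (_ | i) v
        · obtain ⟨x, y, rfl⟩ := exists_eq_elim v
          rw [coneDiff_zero_elim]
          constructor
          · intro h
            have h1 : Y.aug y = 0 := by
              refine hμinj _ ?_
              rw [← hφ0]
              have := congrArg X.aug h
              rwa [map_add, X.aug_diff, zero_add, map_zero] at this
            obtain ⟨y', rfl⟩ := (Y.exact_zero y).1 h1
            rw [← hφd, ← map_add] at h
            obtain ⟨x', hx'⟩ := (X.exact_succ 0 _).1 h
            refine ⟨Sum.elim x' (-y'), ?_⟩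
            rw [coneDiff_succ_elim, hx', map_neg, map_neg, neg_neg, add_neg_cancel_right]
          · rintro ⟨w, hw⟩
            obtain ⟨x', y', rfl⟩ := exists_eq_elim w
            rw [coneDiff_succ_elim, Sum.elim_eq_iff] at hw
            rw [← hw.1, ← hw.2, map_add, X.diff_diff, zero_add, hφd, map_neg, add_neg_cancel]
        · obtain ⟨x, y, rfl⟩ := exists_eq_elim v
          have hz : (0 : coneIdx X Y (i + 1) → MvPolynomial σ k) =
              Sum.elim (0 : X.ι (i + 1) → _) (0 : Y.ι i → _) := by
            funext z; rcases z with z | z <;> rfl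
          rw [coneDiff_succ_elim, hz, Sum.elim_eq_iff, neg_eq_zero]
          constructor
          · rintro ⟨h, h1⟩
            obtain ⟨y', rfl⟩ := (Y.exact_succ i y).1 h1
            rw [← hφd, ← map_add] at h
            obtain ⟨x', hx'⟩ := (X.exact_succ (i + 1) _).1 h
            refine ⟨Sum.elim x' (-y'), ?_⟩
            rw [coneDiff_succ_elim, hx', map_neg, map_neg, neg_neg, add_neg_cancel_right]
          · rintro ⟨w, hw⟩
            obtain ⟨x', y', rfl⟩ := exists_eq_elim w
            rw [coneDiff_succ_elim, Sum.elim_eq_iff] at hw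
            rw [← hw.1, ← hw.2, map_add, X.diff_diff, zero_add, hφd, map_neg, map_neg,
              Y.diff_diff]
            simp }
  -- A nonzero constant in φ would join basis elements of equal degree, which `hdeg` excludes.
  have hφmin : ∀ i p q, constantCoeff (φ i (Pi.single q 1) p) = 0 := fun i p q => by
    rcases hφ i q p with h | ⟨e, he, h⟩
    · simp [h]
    · have := hdeg i p q
      simp only at he
      rw [constantCoeff_eq, h.coeff_eq_zero (by simp; omega)]
  refine ⟨Z, ?_, fun j => rfl, fun i j => ?_⟩
  · rintro (_ | i) p (q | q)
    · change constantCoeff (coneDiff X Y φ 0 _ p) = 0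
      erw [single_inl]
      rw [coneDiff_zero_elim, map_zero, add_zero]
      exact hX 0 p q
    · change constantCoeff (coneDiff X Y φ 0 _ p) = 0
      erw [single_inr]
      rw [coneDiff_zero_elim, map_zero, zero_add]
      exact hφmin 0 p q
    · change constantCoeff (coneDiff X Y φ (i + 1) _ p) = 0
      erw [single_inl]
      rw [coneDiff_succ_elim, map_zero, map_zero, add_zero]
      rcases p with p | p
      · exact hX (i + 1) p q
      · simp
    · change constantCoeff (coneDiff X Y φ (i + 1) _ p) = 0
      erw [single_inr]
      rw [coneDiff_succ_elim, map_zero, zero_add]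
      rcases p with p | p
      · exact hφmin (i + 1) p q
      · simp [hY i p q]
  · change (Finset.univ.filter fun q : X.ι (i + 1) ⊕ Y.ι i =>
      Sum.elim (X.deg (i + 1)) (fun q => d + Y.deg i q) q = j).card = _
    rw [card_filter_sumElim]
    refine congrArg (X.betti (i + 1) j + ·) ?_
    split_ifs with h
    · refine congrArg _ (Finset.filter_congr fun q _ => ?_)
      omega
    · rw [Finset.card_eq_zero, Finset.filter_eq_empty_iff]
      intro q _
      omega

/-- The resolution of `R` itself. -/
theorem exists_bot : ∃ Z : GradedRes (⊥ : Ideal (MvPolynomial σ k)), Z.Minimal ∧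
    (∀ j, Z.betti 0 j = if j = 0 then 1 else 0) ∧ ∀ i j, Z.betti (i + 1) j = 0 := by
  let idx : ℕ → Type := fun i => Fin (if i = 0 then 1 else 0)
  have hempty : ∀ i, IsEmpty (idx (i + 1)) := fun i => inferInstanceAs (IsEmpty (Fin 0))
  have hsub : ∀ i (v w : idx (i + 1) → MvPolynomial σ k), v = w := fun i v w =>
    funext fun x => ((hempty i).false x).elim
  have hinj : Function.Injective (Ideal.Quotient.mk (⊥ : Ideal (MvPolynomial σ k))) := by
    rw [injective_iff_map_eq_zero]
    exact fun a ha => by simpa using Ideal.Quotient.eq_zero_iff_mem.1 ha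
  let Z : GradedRes (⊥ : Ideal (MvPolynomial σ k)) :=
    { ι := idx
      fin := fun i => inferInstanceAs (Fintype (Fin _))
      dec := fun i => inferInstanceAs (DecidableEq (Fin _))
      deg := fun _ _ => 0
      diff := fun _ => 0
      aug := (Submodule.mkQ ⊥) ∘ₗ LinearMap.proj (0 : Fin 1)
      graded := fun i q => ((hempty i).false q).elim
      aug_graded := fun q => by
        refine ⟨1, isHomogeneous_one σ k, ?_⟩
        obtain rfl : q = (0 : Fin 1) := Subsingleton.elim (α := Fin 1) _ _
        simp
      aug_surjective := fun z => by
        obtain ⟨r, rfl⟩ := Ideal.Quotient.mk_surjective z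
        exact ⟨fun _ => r, rfl⟩
      exact_zero := fun x => by
        constructor
        · intro hx
          refine ⟨0, ?_⟩
          have : x (0 : Fin 1) = 0 := hinj (by rw [map_zero]; exact hx)
          funext q
          obtain rfl : q = (0 : Fin 1) := Subsingleton.elim (α := Fin 1) _ _
          exact this.symm
        · rintro ⟨y, rfl⟩
          simp
      exact_succ := fun i v => ⟨fun _ => ⟨0, hsub _ _ _⟩, fun _ => rfl⟩ }
  refine ⟨Z, fun i p q => by simp [Z], fun j => ?_, fun i j => ?_⟩
  · change (Finset.univ.filter fun _ : Fin 1 => 0 = j).card = _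
    split_ifs with h
    · simp [h]
    · simp [Ne.symm h]
  · refine Finset.card_eq_zero.2 (Finset.filter_eq_empty_iff.2 fun q => ?_)
    exact ((hempty i).false q).elim

theorem pos_betti (X : GradedRes J) (i : ℕ) (q : X.ι i) : 0 < X.betti i (X.deg i q) :=
  Finset.card_pos.2 ⟨q, by simp⟩

end GradedRes

/-! ### The minimal resolution of the symbolic power -/

section StarResolution

variable {σ k : Type*} [Field k]

/-- Each new form adds the cone of multiplication by it, and the ranks follow Pascal's rule.
Minimality holds as the degrees δi and δ(i+1) differ. -/
theorem exists_koszul {ι : Type*} {F : ι → MvPolynomial σ k} {c δ : ℕ} (hδ : 0 < δ)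
    (hdeg : ∀ a, (F a).IsHomogeneous δ) (hF : RegularUpTo F c) (A : Finset ι)
    (hA : A.card ≤ c + 1) :
    ∃ Z : GradedRes (Ideal.span (F '' (A : Set ι))), Z.Minimal ∧
      ∀ i j, Z.betti i j = if j = δ * i then A.card.choose i else 0 := by
  classical
  induction A using Finset.induction_on with
  | empty =>
    obtain ⟨Z, h1, h2, h3⟩ := GradedRes.exists_bot (σ := σ) (k := k)
    have : Ideal.span (F '' ((∅ : Finset ι) : Set ι)) = ⊥ := by simp
    rw [this]
    refine ⟨Z, h1, fun i j => ?_⟩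
    rcases i with _ | i
    · simp [h2]
    · simp [h3]
  | insert b A hb ih =>
    rw [Finset.card_insert_of_notMem hb] at hA ⊢
    obtain ⟨X, hX, hXb⟩ := ih (by omega)
    have hXdeg : ∀ i q, X.deg i q = δ * i := fun i q => by
      have := X.pos_betti i q
      rw [hXb] at this
      by_contra h
      rw [if_neg h] at this
      omega
    obtain ⟨Z, h1, h2, h3⟩ := GradedRes.exists_cone
      (J := Ideal.span (F '' ((insert b A : Finset ι) : Set ι))) X X
      (isHomogeneousIdeal_span (by rintro _ ⟨a, -, rfl⟩; exact ⟨δ, hdeg a⟩)) (hdeg b)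
      (fun x => ⟨hF A (by omega) b hb x, fun hx => Ideal.mul_mem_right _ _ hx⟩)
      (by rw [Finset.coe_insert, Set.image_insert_eq, Ideal.span_insert]) hX hX
      (fun i p q => by rw [hXdeg, hXdeg]; omega)
    refine ⟨Z, h1, fun i j => ?_⟩
    rcases i with _ | i
    · rw [h2, hXb]
      simp
    · rw [h3, hXb, hXb, Nat.choose_succ_succ', mul_add, mul_one]
      split_ifs <;> omega

theorem isHomogeneous_finsuppProd {ι : Type*} {F : ι → MvPolynomial σ k} {δ : ℕ}
    (hdeg : ∀ a, (F a).IsHomogeneous δ) (γ : ι →₀ ℕ) :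
    (γ.prod fun i e => F i ^ e).IsHomogeneous (δ * γ.sum fun _ e => e) := by
  rw [Finsupp.sum, Finset.mul_sum]
  exact IsHomogeneous.prod _ _ _ fun i _ => (hdeg i).pow _

theorem isHomogeneousIdeal_monomialIdeal {ι : Type*} {F : ι → MvPolynomial σ k} {δ : ℕ}
    (hdeg : ∀ a, (F a).IsHomogeneous δ) (U : Set (ι →₀ ℕ)) :
    IsHomogeneousIdeal (monomialIdeal F U) := by
  refine isHomogeneousIdeal_span ?_
  rintro _ ⟨γ, -, rfl⟩
  exact ⟨_, isHomogeneous_finsuppProd hdeg γ⟩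

/-- Each generator F^γ contributes the Koszul complex on its colon, shifted by one homological step
and by the degree of F^γ. -/
theorem exists_star_resolution {s : ℕ} {F : Fin s → MvPolynomial σ k} {c m δ : ℕ} (hc : 0 < c)
    (hcs : c < s) (hm : 0 < m) (hδ : 0 < δ) (hdeg : ∀ a, (F a).IsHomogeneous δ)
    (hF : RegularUpTo F c) :
    ∃ Z : GradedRes (monomialIdeal F {γ | IsStarGen c m γ}), Z.Minimal ∧
      ∀ i j, Z.betti (i + 1) j = ∑ γ ∈ (finite_starGens (s := s) (m := m) hcs).toFinset,
        if j = δ * (∑ a, γ a + i) then (genDirs γ).card.choose i else 0 := by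
  classical
  have hfin := finite_starIndices (s := s) (m := m) hcs
  have h0 := exists_starExp_eq_zero (s := s) hc hcs hm
  have hsys := isConeSystem_star (s := s) (m := m) hc hcs
  let D₀ : Finset (StarIndex s) := (finite_starGens (m := m) hcs).toFinset.map
    ⟨Sum.inl, Sum.inl_injective⟩
  have hD₀mem : ∀ g, g ∈ D₀ ↔ ∃ γ, IsStarGen c m γ ∧ Sum.inl γ = g := fun g => by
    simp [D₀]
  have hD₀ : IsInitial (starIndices c m) (starRank m) D₀ := by
    constructor
    · intro g hg
      obtain ⟨γ, hγ, rfl⟩ := (hD₀mem g).1 hg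
      exact hγ
    · intro g hg h hh hlt
      obtain ⟨γ, hγ, rfl⟩ := (hD₀mem g).1 hg
      rcases h with γ' | g'
      · exact (hD₀mem _).2 ⟨γ', hh, rfl⟩
      · simp [starRank, Prod.Lex.toLex_lt_toLex] at hlt
  have key : ∀ D, IsInitial (starIndices c m) (starRank m) D → D ⊆ D₀ →
      ∃ Z : GradedRes (monomialIdeal F (starExp '' D)), Z.Minimal ∧
        (∀ j, Z.betti 0 j = if j = 0 then 1 else 0) ∧
        ∀ i j, Z.betti (i + 1) j = ∑ g ∈ D,
          if j = δ * (∑ a, starExp g a + i) then (starDirs g).card.choose i else 0 := by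
    refine IsInitial.induction_up ?_ ?_
    · intro _
      obtain ⟨Z, h1, h2, h3⟩ := GradedRes.exists_bot (σ := σ) (k := k)
      have : monomialIdeal F (starExp '' ((∅ : Finset (StarIndex s)) : Set (StarIndex s))) = ⊥ := by
        simp [monomialIdeal]
      rw [this]
      exact ⟨Z, h1, h2, fun i j => by simp [h3]⟩
    · intro D hD g hg hgD h1 h2 ih hsub
      have hsub' : D ⊆ D₀ := (Finset.subset_insert g D).trans hsub
      obtain ⟨X, hX, hX0, hXb⟩ := ih hsub'
      obtain ⟨γ, hγ, rfl⟩ := (hD₀mem g).1 (hsub (Finset.mem_insert_self _ _))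
      obtain ⟨Y, hY, hYb⟩ := exists_koszul hδ hdeg hF (starDirs (Sum.inl γ))
        ((card_starDirs_le hg).trans (by omega))
      have hYdeg : ∀ i q, Y.deg i q = δ * i := fun i q => by
        have := Y.pos_betti i q
        rw [hYb] at this
        by_contra h
        rw [if_neg h] at this
        omega
      have hsum : (γ.sum fun _ e => e) = ∑ a, γ a := Finsupp.sum_fintype _ _ (by simp)
      have hhom := isHomogeneous_finsuppProd hdeg γ
      rw [hsum] at hhom
      have hpos : 0 < ∑ a, γ a := by
        rw [hγ.sum_eq]
        omega
      -- Earlier generators γ' satisfy |γ'| ≤ |γ|, so in homological degree i+1 the degrees δ(|γ'| +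
      -- i) of X stay below δ(|γ| + i + 1).
      have hdisj : ∀ i p q, X.deg i p ≠ δ * ∑ a, γ a + Y.deg i q := by
        intro i p q
        rw [hYdeg]
        have hp := X.pos_betti i p
        rcases i with _ | i
        · rw [hX0] at hp
          have h3 : X.deg 0 p = 0 := by
            by_contra h
            rw [if_neg h] at hp
            omega
          rw [h3]
          have := Nat.mul_pos hδ hpos
          omega
        · rw [hXb] at hp
          obtain ⟨g', hg', hne⟩ := Finset.exists_ne_zero_of_sum_ne_zero hp.ne'
          have h3 : X.deg (i + 1) p = δ * (∑ a, starExp g' a + i) := by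
            by_contra h
            exact hne (if_neg h)
          obtain ⟨γ', hγ', rfl⟩ := (hD₀mem g').1 (hsub' hg')
          have h4 := h2 _ hg'
          simp only [starRank, Sum.elim_inl, Prod.Lex.toLex_le_toLex] at h4
          have h5 : ∑ a, γ' a ≤ ∑ a, γ a := by
            rcases h4 with h4 | ⟨-, h4 | h4⟩
            · omega
            · exact h4.le
            · exact h4.1.le
          rw [h3, ← mul_add]
          refine (Nat.mul_lt_mul_of_pos_left ?_ hδ).ne
          change ∑ a, γ' a + i < _
          omega
      obtain ⟨Z, hZ, hZ0, hZb⟩ := GradedRes.exists_cone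
        (J := monomialIdeal F (starExp '' ((insert (Sum.inl γ) D : Finset _) :
          Set (StarIndex s)))) X Y (isHomogeneousIdeal_monomialIdeal hdeg _) hhom
        (fun x => hsys.mem_iff_mul_mem hfin h0 hF (fun g hg => (card_starDirs_le hg).trans
          (by omega)) hD hg hgD h1 h2 x)
        (by rw [Finset.coe_insert, Set.image_insert_eq, monomialIdeal_insert]; rfl) hX hY hdisj
      refine ⟨Z, hZ, fun j => by rw [hZ0, hX0], fun i j => ?_⟩
      rw [hZb, hXb, Finset.sum_insert hgD, add_comm, hYb]
      congr 1
      change _ = if j = δ * (∑ a, γ a + i) then _ else _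
      rw [mul_add]
      split_ifs <;> first | rfl | omega
  have hres := key D₀ hD₀ (Finset.Subset.refl _)
  have himg : starExp '' (D₀ : Set (StarIndex s)) = {γ | IsStarGen c m γ} := by
    ext γ
    simp [D₀, starExp]
  rw [himg] at hres
  obtain ⟨Z, h1, -, h2⟩ := hres
  refine ⟨Z, h1, fun i j => ?_⟩
  rw [h2, Finset.sum_map]
  rfl

end StarResolution

/-! ### Passage between the two notions of resolution -/

section Comparison

variable {σ k : Type*} [Field k] {J : Ideal (MvPolynomial σ k)}

/-- A minimal graded free resolution as a graded resolution. -/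
def MinimalGradedFreeResolution.toGradedRes (G : MinimalGradedFreeResolution J) : GradedRes J where
  ι i := Fin (G.rank i)
  deg := G.deg
  diff := G.diff
  aug := G.aug
  graded i q p := G.diff_homogeneous i p q
  aug_graded := G.aug_homogeneous
  aug_surjective := G.aug_surjective
  exact_zero := G.exact_zero
  exact_succ := G.exact_succ

theorem MinimalGradedFreeResolution.betti_eq (G : MinimalGradedFreeResolution J)
    (hJ : IsHomogeneousIdeal J) {X : GradedRes J} (hX : X.Minimal) (i j : ℕ) :
    G.betti i j = X.betti i j :=
  GradedRes.Minimal.betti_eq (Y := G.toGradedRes) hJ hX G.minimal i j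

theorem GradedRes.Minimal.nonempty {X : GradedRes J} (hX : X.Minimal) :
    Nonempty (MinimalGradedFreeResolution J) := by
  let e : ∀ i, X.ι i ≃ Fin (Fintype.card (X.ι i)) := fun i => Fintype.equivFin _
  let E : ∀ i, (X.ι i → MvPolynomial σ k) ≃ₗ[MvPolynomial σ k]
      (Fin (Fintype.card (X.ι i)) → MvPolynomial σ k) :=
    fun i => LinearEquiv.funCongrLeft _ _ (e i).symm
  have hE : ∀ i v p, E i v p = v ((e i).symm p) := fun i v p => rfl
  have hEs : ∀ i q, (E i).symm (Pi.single q 1) = Pi.single ((e i).symm q) 1 := fun i q => by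
    rw [LinearEquiv.symm_apply_eq]
    funext p
    rw [hE, Pi.single_apply, Pi.single_apply]
    simp
  refine ⟨{
    rank := fun i => Fintype.card (X.ι i)
    deg := fun i q => X.deg i ((e i).symm q)
    diff := fun i => (E i).toLinearMap ∘ₗ X.diff i ∘ₗ (E (i + 1)).symm.toLinearMap
    aug := X.aug ∘ₗ (E 0).symm.toLinearMap
    diff_homogeneous := fun i p q => ?_
    aug_homogeneous := fun q => ?_
    aug_surjective := X.aug_surjective.comp (E 0).symm.surjective
    exact_zero := fun v => ?_
    exact_succ := fun i v => ?_
    minimal := fun i p q => ?_ }⟩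
  · have := X.graded i ((e (i + 1)).symm q) ((e i).symm p)
    simpa only [LinearMap.comp_apply, LinearEquiv.coe_coe, hE, hEs] using this
  · simpa only [LinearMap.comp_apply, LinearEquiv.coe_coe, hEs] using X.aug_graded ((e 0).symm q)
  · have := X.exact_zero ((E 0).symm v)
    refine this.trans ⟨?_, ?_⟩
    · rintro ⟨w, hw⟩
      exact ⟨E 1 w, by simp [hw]⟩
    · rintro ⟨w, rfl⟩
      exact ⟨(E 1).symm w, by simp⟩
  · have := X.exact_succ i ((E (i + 1)).symm v)
    rw [LinearMap.comp_apply, LinearEquiv.coe_coe, LinearEquiv.map_eq_zero_iff,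
      LinearMap.comp_apply, LinearEquiv.coe_coe]
    refine this.trans ⟨?_, ?_⟩
    · rintro ⟨w, hw⟩
      exact ⟨E (i + 2) w, by simp [hw]⟩
    · rintro ⟨w, rfl⟩
      exact ⟨(E (i + 2)).symm w, by simp⟩
  · simpa only [LinearMap.comp_apply, LinearEquiv.coe_coe, hE, hEs] using
      hX i ((e i).symm p) ((e (i + 1)).symm q)

end Comparison

/-! ### Binomial sums over the sizes of initial parts -/

section Counting

variable {s : ℕ}

/-- The elements of `D` preceding all elements outside `D`. -/
def initialPart (D : Finset (Fin s)) : Finset (Fin s) := D.filter fun i => ∀ j ∉ D, i < j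

theorem initialPart_eq_Iio {D : Finset (Fin s)} {τ : Fin s} (hτ : τ ∉ D)
    (hmin : ∀ j ∉ D, τ ≤ j) : initialPart D = Finset.Iio τ := by
  ext i
  simp only [initialPart, Finset.mem_filter, Finset.mem_Iio]
  refine ⟨fun h => h.2 τ hτ, fun h => ⟨?_, fun j hj => h.trans_le (hmin j hj)⟩⟩
  by_contra hi
  exact absurd (hmin i hi) (not_le.2 h)

theorem exists_min_notMem {D : Finset (Fin s)} (hD : D.card < s) :
    ∃ τ ∉ D, ∀ j ∉ D, τ ≤ j := by
  have hne : Dᶜ.Nonempty := by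
    rw [← Finset.card_pos, Finset.card_compl, Fintype.card_fin]
    omega
  refine ⟨Dᶜ.min' hne, Finset.mem_compl.1 (Finset.min'_mem _ hne), fun j hj => ?_⟩
  exact Finset.min'_le _ _ (Finset.mem_compl.2 hj)

theorem card_initialPart {D : Finset (Fin s)} {τ : Fin s} (hτ : τ ∉ D)
    (hmin : ∀ j ∉ D, τ ≤ j) : (initialPart D).card = τ := by
  rw [initialPart_eq_Iio hτ hmin, Fin.card_Iio]

theorem sum_range_card_initialPart {M : Type*} [AddCommMonoid M] {D : Finset (Fin s)}
    (hD : D.card < s) (g : ℕ → M) :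
    ∑ f ∈ Finset.range (initialPart D).card, g f = ∑ f ∈ initialPart D, g f := by
  obtain ⟨τ, hτ, hmin⟩ := exists_min_notMem hD
  rw [card_initialPart hτ hmin, initialPart_eq_Iio hτ hmin, ← Nat.Iio_eq_range,
    ← Fin.map_valEmbedding_Iio, Finset.sum_map]
  rfl

/-- Removing one element of the initial part. -/
theorem sum_powersetCard_initialPart {M : Type*} [AddCommMonoid M] {d : ℕ} (hd : d + 1 < s)
    (g : ℕ → M) :
    ∑ D ∈ Finset.powersetCard (d + 1) (Finset.univ : Finset (Fin s)),
      ∑ f ∈ Finset.range (initialPart D).card, g f =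
    ∑ H ∈ Finset.powersetCard d (Finset.univ : Finset (Fin s)), g (initialPart H).card := by
  have h1 : ∀ D ∈ Finset.powersetCard (d + 1) (Finset.univ : Finset (Fin s)),
      ∑ f ∈ Finset.range (initialPart D).card, g f = ∑ f ∈ initialPart D, g f := fun D hD =>
    sum_range_card_initialPart (by
      rw [(Finset.mem_powersetCard.1 hD).2]
      exact hd) g
  rw [Finset.sum_congr rfl h1, Finset.sum_sigma']
  have hmin : ∀ (D : Finset (Fin s)) (f : Fin s), f ∈ initialPart D →
      ∀ j ∉ D.erase f, f ≤ j := fun D f hf j hj => by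
    rw [Finset.mem_erase, not_and_or, not_not] at hj
    rcases hj with rfl | hj
    · exact le_rfl
    · exact ((Finset.mem_filter.1 hf).2 j hj).le
  -- The removed f is the least element missing from the remaining set H. So f and D are recovered
  -- from H, and f is the size of its initial part.
  refine Finset.sum_bij (fun x _ => x.1.erase x.2) ?_ ?_ ?_ ?_
  · rintro ⟨D, f⟩ h
    simp only [Finset.mem_sigma, Finset.mem_powersetCard, Finset.subset_univ, true_and] at h ⊢
    rw [Finset.card_erase_of_mem (Finset.mem_filter.1 h.2).1, h.1]
    rfl
  · rintro ⟨D, f⟩ h ⟨D', f'⟩ h' heq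
    simp only [Finset.mem_sigma] at h h' heq
    have hf : f = f' := by
      refine le_antisymm ?_ ?_
      · exact hmin D f h.2 f' (heq ▸ Finset.notMem_erase _ _)
      · exact hmin D' f' h'.2 f (heq ▸ Finset.notMem_erase _ _)
    subst hf
    have hD : D = D' := by
      rw [← Finset.insert_erase (Finset.mem_filter.1 h.2).1, heq,
        Finset.insert_erase (Finset.mem_filter.1 h'.2).1]
    rw [hD]
  · intro H hH
    have hH : H.card = d := (Finset.mem_powersetCard.1 hH).2
    obtain ⟨τ, hτ, hτmin⟩ := exists_min_notMem (D := H) (by omega)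
    refine ⟨⟨insert τ H, τ⟩, ?_, Finset.erase_insert hτ⟩
    simp only [Finset.mem_sigma, Finset.mem_powersetCard, Finset.subset_univ, true_and,
      Finset.card_insert_of_notMem hτ, hH, initialPart, Finset.mem_filter, Finset.mem_insert,
      true_or]
    intro j hj
    rw [not_or] at hj
    exact lt_of_le_of_ne (hτmin j hj.2) (Ne.symm hj.1)
  · rintro ⟨D, f⟩ h
    simp only [Finset.mem_sigma] at h
    simp only [card_initialPart (Finset.notMem_erase f D) (hmin D f h.2)]

/-- By the hockey-stick identity C(ℓ, a+1) is the sum of C(f, a) over f < ℓ, and the removal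
bijection lowers a and d together. -/
theorem sum_choose_initialPart (a : ℕ) {d : ℕ} (hd : d < s) :
    ∑ D ∈ Finset.powersetCard d (Finset.univ : Finset (Fin s)), (initialPart D).card.choose a =
      s.choose (s - d + a) := by
  induction a generalizing d with
  | zero => simp [Nat.choose_symm hd.le]
  | succ a ih =>
    rcases d with _ | d
    · simp [initialPart, Nat.choose_eq_zero_of_lt]
    · have h1 : ∀ ℓ : ℕ, ℓ.choose (a + 1) = ∑ f ∈ Finset.range ℓ, f.choose a := fun ℓ => by
        induction ℓ with
        | zero => simp
        | succ ℓ ihℓ => rw [Nat.choose_succ_succ', ihℓ, Finset.sum_range_succ, add_comm]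
      rw [Finset.sum_congr rfl fun D _ => h1 _,
        sum_powersetCard_initialPart hd (fun f => f.choose a), ih (by omega)]
      congr 1
      omega

/-- The same induction with the telescoping identity C(d+1, r+1) - C(d+1-ℓ, r+1) = ∑ C(d-f, r) over
f < ℓ. -/
theorem sum_choose_sub_initialPart {d : ℕ} (hd : d < s) {r : ℕ} (hr : r ≤ d) :
    ∑ D ∈ Finset.powersetCard d (Finset.univ : Finset (Fin s)),
      (d - (initialPart D).card).choose r = s.choose (d - r) * (s - d - 1 + r).choose r := by
  induction r generalizing d with
  | zero => simp
  | succ r ih =>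
    rcases d with _ | d
    · omega
    · have h1 : ∀ ℓ ≤ d + 1, (d + 1 - ℓ).choose (r + 1) +
          ∑ f ∈ Finset.range ℓ, (d - f).choose r = (d + 1).choose (r + 1) := by
        intro ℓ hℓ
        induction ℓ with
        | zero => simp
        | succ ℓ ihℓ =>
          rw [← ihℓ (by omega), Finset.sum_range_succ]
          have : d + 1 - ℓ = (d - ℓ) + 1 := by omega
          rw [this, Nat.choose_succ_succ', show d + 1 - (ℓ + 1) = d - ℓ by omega]
          omega
      have h2 := sum_powersetCard_initialPart hd (fun f => (d - f).choose r)
      rw [ih (by omega) (by omega)] at h2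
      have h3 : ∑ D ∈ Finset.powersetCard (d + 1) (Finset.univ : Finset (Fin s)),
          ((d + 1 - (initialPart D).card).choose (r + 1) +
            ∑ f ∈ Finset.range (initialPart D).card, (d - f).choose r) =
          s.choose (d + 1) * (d + 1).choose (r + 1) := by
        rw [Finset.sum_congr rfl (g := fun _ => (d + 1).choose (r + 1))]
        · simp
        · intro D hD
          refine h1 _ ?_
          rw [← (Finset.mem_powersetCard.1 hD).2]
          exact Finset.card_filter_le _ _
      rw [Finset.sum_add_distrib, h2] at h3
      have h4 : s.choose (d + 1) * (d + 1).choose (r + 1) =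
          s.choose (d - r) * (s - (d - r)).choose (r + 1) := by
        have := Nat.choose_mul (n := s) (k := d + 1) (s := d - r) (by omega)
        rw [← Nat.choose_symm (n := d + 1) (k := r + 1) (by omega),
          show d + 1 - (r + 1) = d - r by omega, this]
        congr 2
        omega
      have h5 : s - (d - r) = (s - d - 1 + r) + 1 := by omega
      rw [h4, h5, Nat.choose_succ_succ', mul_add] at h3
      rw [show d + 1 - (r + 1) = d - r by omega,
        show s - (d + 1) - 1 + (r + 1) = s - d - 1 + r by omega]
      omega

end Counting

/-! ### Generators as low positions with values -/

section Gluing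

variable {s : ℕ}

/-- The exponent equal to `v` on `D` and to `t` elsewhere. -/
noncomputable def glueExp (t : ℕ) (D : Finset (Fin s)) (v : Fin s →₀ ℕ) : Fin s →₀ ℕ :=
  Finsupp.equivFunOnFinite.symm fun i => if i ∈ D then v i else t

theorem glueExp_apply (t : ℕ) (D : Finset (Fin s)) (v : Fin s →₀ ℕ) (i : Fin s) :
    glueExp t D v i = if i ∈ D then v i else t := rfl

/-- The exponents supported on `D`, with sum `n` and all entries smaller than `t`. -/
def boundedAntidiag (t : ℕ) (D : Finset (Fin s)) (n : ℕ) : Finset (Fin s →₀ ℕ) :=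
  (Finset.finsuppAntidiag D n).filter fun v => ∀ i ∈ D, v i < t

theorem topExp_glueExp {t : ℕ} {D : Finset (Fin s)} {v : Fin s →₀ ℕ} (hD : D.card < s)
    (hv : ∀ i ∈ D, v i < t) : topExp (glueExp t D v) = t := by
  obtain ⟨τ, hτ, -⟩ := exists_min_notMem hD
  refine topExp_eq (fun i => ?_) τ (by rw [glueExp_apply, if_neg hτ])
  rw [glueExp_apply]
  split_ifs with h
  · exact (hv i h).le
  · exact le_rfl

theorem lowPos_glueExp {t : ℕ} {D : Finset (Fin s)} {v : Fin s →₀ ℕ} (hD : D.card < s)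
    (hv : ∀ i ∈ D, v i < t) : lowPos (glueExp t D v) = D := by
  ext i
  simp only [lowPos, Finset.mem_filter, Finset.mem_univ, true_and, topExp_glueExp hD hv,
    glueExp_apply]
  split_ifs with h
  · simp [h, hv i h]
  · simp [h]

/-- The largest entries sit exactly outside D, so a position with value t-1 is lost precisely when
it precedes all of the complement. -/
theorem card_genDirs_glueExp {t : ℕ} {D : Finset (Fin s)} {v : Fin s →₀ ℕ} (hD : D.card < s)
    (hv : ∀ i ∈ D, v i < t) : (genDirs (glueExp t D v)).card =
      D.card - ((initialPart D).filter fun i => v i + 1 = t).card := by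
  have hsub : ((initialPart D).filter fun i => v i + 1 = t) ⊆ D :=
    (Finset.filter_subset _ _).trans (Finset.filter_subset _ _)
  rw [← Finset.card_sdiff_of_subset hsub]
  congr 1
  ext i
  simp only [genDirs, Finset.mem_filter, Finset.mem_univ, true_and, topExp_glueExp hD hv,
    glueExp_apply, Finset.mem_sdiff, initialPart]
  by_cases hi : i ∈ D
  · simp only [hi, if_true, hv i hi, true_and, not_and]
    constructor
    · intro h h1 h2
      obtain ⟨j, hji, hj⟩ := h h2
      by_cases hjD : j ∈ D
      · rw [if_pos hjD] at hj
        exact absurd hj (hv j hjD).ne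
      · exact absurd hji (not_lt.2 (h1 j hjD).le)
    · intro h h2
      by_contra! hcon
      refine h (fun j hj => ?_) h2
      by_contra! hji
      have hne : j ≠ i := fun e => hj (e ▸ hi)
      exact hcon j (lt_of_le_of_ne hji hne) (if_neg hj)
  · simp [hi]

theorem IsStarGen.mul_topExp_le {c m : ℕ} (hcs : c < s) {γ : Fin s →₀ ℕ}
    (h : IsStarGen c m γ) : (c - (lowPos γ).card) * topExp γ ≤ m := by
  obtain ⟨C, hC, hlow, hsum⟩ := h.exists_sum_eq hcs
  rw [← hsum, ← hC, ← Finset.card_sdiff_of_subset hlow]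
  refine (Finset.card_nsmul_le_sum _ (fun i => γ i) _ fun i hi => ?_).trans
    (Finset.sum_le_sum_of_subset Finset.sdiff_subset)
  have hi := (Finset.mem_sdiff.1 hi).2
  simpa [lowPos] using hi

/-- The `c` smallest entries are the d low ones and c-d copies of t, so the low ones sum to m -
(c-d)t. -/
theorem sum_filter_starGens {M : Type*} [AddCommMonoid M] {c m t d : ℕ} (hcs : c < s)
    (hd : d < c) (hm : (c - d) * t ≤ m) (f : (Fin s →₀ ℕ) → M) :
    ∑ γ ∈ (finite_starGens (s := s) (m := m) hcs).toFinset.filter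
      (fun γ => topExp γ = t ∧ (lowPos γ).card = d), f γ =
    ∑ D ∈ Finset.powersetCard d (Finset.univ : Finset (Fin s)),
      ∑ v ∈ boundedAntidiag t D (m - (c - d) * t), f (glueExp t D v) := by
  rw [Finset.sum_sigma']
  symm
  refine Finset.sum_bij' (fun x _ => glueExp t x.1 x.2)
    (fun γ _ => ⟨lowPos γ, γ.filter (· ∈ lowPos γ)⟩) ?_ ?_ ?_ ?_ (fun _ _ => rfl)
  · rintro ⟨D, v⟩ h
    simp only [Finset.mem_sigma, Finset.mem_powersetCard, Finset.subset_univ, true_and,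
      boundedAntidiag, Finset.mem_filter, Finset.mem_finsuppAntidiag] at h
    obtain ⟨hD, ⟨hsum, hsupp⟩, hv⟩ := h
    have hDs : D.card < s := by omega
    simp only [Finset.mem_filter, Set.Finite.mem_toFinset, topExp_glueExp hDs hv,
      lowPos_glueExp hDs hv, hD, and_self, and_true]
    refine ⟨by rw [lowPos_glueExp hDs hv, hD]; exact hd, ?_⟩
    rw [topExp_glueExp hDs hv, ← Finset.sum_add_sum_compl D]
    have h1 : ∑ i ∈ D, glueExp t D v i = m - (c - d) * t := by
      rw [← hsum]
      exact Finset.sum_congr rfl fun i hi => by rw [glueExp_apply, if_pos hi]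
    have h2 : ∑ i ∈ Dᶜ, glueExp t D v i = (s - d) * t := by
      rw [Finset.sum_congr rfl (g := fun _ => t)
        fun i hi => by rw [glueExp_apply, if_neg (Finset.mem_compl.1 hi)]]
      simp [Finset.card_compl, hD]
    have h3 : (s - d) * t = (s - c) * t + (c - d) * t := by
      rw [← add_mul]
      congr 1
      omega
    omega
  · intro γ h
    simp only [Finset.mem_filter, Set.Finite.mem_toFinset] at h
    obtain ⟨hγ, ht, hlow⟩ := h
    have hγ : IsStarGen c m γ := hγ
    simp only [Finset.mem_sigma, Finset.mem_powersetCard, Finset.subset_univ, true_and,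
      boundedAntidiag, Finset.mem_filter, hlow]
    constructor
    · have h1 := filter_mem_finsuppAntidiag (lowPos γ) γ
      have h2 : ∑ i ∈ lowPos γ, γ i = m - (c - d) * t := by
        have h3 := hγ.sum_eq
        rw [← Finset.sum_add_sum_compl (lowPos γ), ht] at h3
        have h4 : ∑ i ∈ (lowPos γ)ᶜ, γ i = (s - d) * t := by
          rw [Finset.sum_congr rfl (g := fun _ => t)]
          · simp [Finset.card_compl, hlow]
          · intro i hi
            simp only [lowPos, Finset.mem_compl, Finset.mem_filter, Finset.mem_univ, true_and,
              not_lt] at hi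
            rw [← ht]
            exact le_antisymm (le_topExp γ i) hi
        have h5 : (s - d) * t = (s - c) * t + (c - d) * t := by
          rw [← add_mul]
          congr 1
          omega
        omega
      rwa [h2] at h1
    · intro i hi
      rw [Finsupp.filter_apply, if_pos hi, ← ht]
      simpa [lowPos] using hi
  · rintro ⟨D, v⟩ h
    simp only [Finset.mem_sigma, Finset.mem_powersetCard, Finset.subset_univ, true_and,
      boundedAntidiag, Finset.mem_filter, Finset.mem_finsuppAntidiag] at h
    obtain ⟨hD, ⟨hsum, hsupp⟩, hv⟩ := h
    have hDs : D.card < s := by omega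
    simp only [lowPos_glueExp hDs hv, Sigma.mk.injEq, heq_eq_eq, true_and]
    ext i
    rw [Finsupp.filter_apply, glueExp_apply]
    split_ifs with hi
    · rfl
    · exact (Finsupp.notMem_support_iff.1 fun h => hi (hsupp h)).symm
  · intro γ h
    simp only [Finset.mem_filter, Set.Finite.mem_toFinset] at h
    ext i
    simp only [glueExp_apply, Finsupp.filter_apply]
    split_ifs with hi
    · rfl
    · simp only [lowPos, Finset.mem_filter, Finset.mem_univ, true_and, not_lt] at hi
      rw [← h.2.1]
      exact le_antisymm hi (le_topExp γ i)

theorem boundedAntidiag_of_lt {t n : ℕ} (h : n < t) (D : Finset (Fin s)) :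
    boundedAntidiag t D n = Finset.finsuppAntidiag D n := by
  refine Finset.filter_true_of_mem fun v hv i hi => lt_of_le_of_lt ?_ h
  rw [← (Finset.mem_finsuppAntidiag.1 hv).1]
  exact Finset.single_le_sum (f := v) (fun _ _ => Nat.zero_le _) hi

theorem card_filter_apply_eq {D : Finset (Fin s)} {e : Fin s} (he : e ∈ D) {n k : ℕ}
    (hk : k ≤ n) : ((Finset.finsuppAntidiag D n).filter fun v => v e = k).card =
      (Finset.finsuppAntidiag (D.erase e) (n - k)).card := by
  refine Finset.card_bij' (fun v _ => v.erase e) (fun u _ => u + Finsupp.single e k) ?_ ?_ ?_ ?_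
  · intro v hv
    simp only [Finset.mem_filter, Finset.mem_finsuppAntidiag] at hv ⊢
    obtain ⟨⟨h1, h2⟩, h3⟩ := hv
    constructor
    · rw [← Finset.add_sum_erase _ _ he] at h1
      rw [Finset.sum_congr rfl fun i hi => Finsupp.erase_ne (Finset.ne_of_mem_erase hi)]
      omega
    · rw [Finsupp.support_erase]
      exact Finset.erase_subset_erase _ h2
  · intro u hu
    simp only [Finset.mem_filter, Finset.mem_finsuppAntidiag] at hu ⊢
    obtain ⟨h1, h2⟩ := hu
    have h0 : u e = 0 := Finsupp.notMem_support_iff.1 fun h => by simpa using h2 h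
    refine ⟨⟨?_, ?_⟩, by simp [h0]⟩
    · rw [← Finset.add_sum_erase _ _ he, Finset.sum_congr rfl (g := fun i => u i) fun i hi => by
        simp [Finset.ne_of_mem_erase hi]]
      rw [h1]
      simp only [Finsupp.add_apply, h0, Finsupp.single_eq_same]
      omega
    · refine Finsupp.support_add.trans (Finset.union_subset (h2.trans (Finset.erase_subset _ _)) ?_)
      exact Finsupp.support_single_subset.trans (by simpa using he)
  · intro v hv
    simp only [Finset.mem_filter] at hv
    rw [← hv.2, Finsupp.erase_add_single]
  · intro u hu
    have h0 : u e = 0 := Finsupp.notMem_support_iff.1 fun h => by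
      simpa using (Finset.mem_finsuppAntidiag.1 hu).2 h
    ext i
    by_cases hi : i = e
    · subst hi; simp [h0]
    · simp [hi]

/-- The bound excludes only the exponents with t at one position and 0 elsewhere. -/
theorem card_boundedAntidiag_self {t : ℕ} (ht : 0 < t) (D : Finset (Fin s)) :
    (boundedAntidiag t D t).card + D.card = (Finset.finsuppAntidiag D t).card := by
  classical
  have h1 : ((Finset.finsuppAntidiag D t).filter fun v => ¬ ∀ i ∈ D, v i < t) =
      D.image fun e => Finsupp.single e t := by
    ext v
    simp only [Finset.mem_filter, Finset.mem_finsuppAntidiag, not_forall, not_lt, Finset.mem_image]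
    constructor
    · rintro ⟨⟨hsum, hsupp⟩, e, he, hle⟩
      refine ⟨e, he, ?_⟩
      rw [← Finset.add_sum_erase _ _ he] at hsum
      have h2 : ∑ i ∈ D.erase e, v i = 0 := by omega
      rw [Finset.sum_eq_zero_iff] at h2
      ext i
      by_cases hi : i = e
      · subst hi
        simp only [Finsupp.single_eq_same]
        omega
      · rw [Finsupp.single_eq_of_ne hi]
        by_cases hiD : i ∈ D
        · exact (h2 i (Finset.mem_erase.2 ⟨hi, hiD⟩)).symm
        · exact (Finsupp.notMem_support_iff.1 fun h => hiD (hsupp h)).symm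
    · rintro ⟨e, he, rfl⟩
      refine ⟨⟨?_, Finsupp.support_single_subset.trans (by simpa using he)⟩, e, he, by simp⟩
      rw [Finset.sum_eq_single e] <;> simp_all
  rw [← Finset.card_filter_add_card_filter_not (s := Finset.finsuppAntidiag D t)
    (fun v => ∀ i ∈ D, v i < t), h1,
    Finset.card_image_of_injective _ (Finsupp.single_left_injective ht.ne')]
  rfl

theorem sum_card_filter_initialPart (S : Finset (Fin s →₀ ℕ)) (D : Finset (Fin s)) (t k : ℕ)
    (h : ∀ e ∈ initialPart D, (S.filter fun v => v e + 1 = t).card = k) :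
    ∑ v ∈ S, ((initialPart D).filter fun i => v i + 1 = t).card = (initialPart D).card * k := by
  simp only [Finset.card_filter]
  rw [Finset.sum_comm, Finset.sum_congr rfl (g := fun _ => k)]
  · simp
  · intro e he
    rw [← h e he, Finset.card_filter]

/-- Two entries t-1 would already sum to 2t-2 > n. -/
theorem card_filter_initialPart_le_one {t n : ℕ} (h : n + 2 < 2 * t) {D : Finset (Fin s)}
    {v : Fin s →₀ ℕ} (hv : v ∈ Finset.finsuppAntidiag D n) :
    ((initialPart D).filter fun i => v i + 1 = t).card ≤ 1 := by
  refine Finset.card_le_one.2 fun e he f hf => ?_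
  by_contra hne
  simp only [initialPart, Finset.mem_filter] at he hf
  have h1 := (Finset.mem_finsuppAntidiag.1 hv).1
  rw [← Finset.add_sum_erase _ _ he.1.1,
    ← Finset.add_sum_erase _ _ (Finset.mem_erase.2 ⟨Ne.symm hne, hf.1.1⟩)] at h1
  omega

theorem sum_choose_of_le_one {α : Type*} (S : Finset α) (W : α → ℕ) (hW : ∀ v ∈ S, W v ≤ 1)
    (d r : ℕ) : ∑ v ∈ S, ((d - W v).choose r : ℤ) =
      S.card * d.choose r - (∑ v ∈ S, W v : ℕ) * ((d.choose r : ℤ) - (d - 1).choose r) := by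
  rw [Nat.cast_sum, Finset.sum_mul, ← nsmul_eq_mul, ← Finset.sum_const, ← Finset.sum_sub_distrib]
  refine Finset.sum_congr rfl fun v hv => ?_
  have := hW v hv
  interval_cases W v <;> simp

/-- Linear interpolation in W from the values at 0 and 1, corrected at W = 2 by the second
difference. -/
theorem sum_choose_of_le_two {α : Type*} (S : Finset α) (W : α → ℕ) (hW : ∀ v ∈ S, W v ≤ 2)
    (d r : ℕ) : ∑ v ∈ S, ((d - W v).choose r : ℤ) =
      S.card * d.choose r - (∑ v ∈ S, W v : ℕ) * ((d.choose r : ℤ) - (d - 1).choose r) +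
        (S.filter fun v => W v = 2).card *
          ((d.choose r : ℤ) - 2 * (d - 1).choose r + (d - 2).choose r) := by
  rw [Nat.cast_sum, Finset.sum_mul, ← nsmul_eq_mul, ← Finset.sum_const, ← Finset.sum_sub_distrib,
    Finset.card_filter, Nat.cast_sum, Finset.sum_mul, ← Finset.sum_add_distrib]
  refine Finset.sum_congr rfl fun v hv => ?_
  have := hW v hv
  interval_cases W v <;> simp
  ring

/-- An entry t-1 leaves a single unit for the other positions. -/
theorem card_filter_boundedAntidiag_self {t : ℕ} (ht : 2 ≤ t) {D : Finset (Fin s)} {e : Fin s}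
    (he : e ∈ D) : ((boundedAntidiag t D t).filter fun v => v e + 1 = t).card = D.card - 1 := by
  have h1 : ((boundedAntidiag t D t).filter fun v => v e + 1 = t) =
      (Finset.finsuppAntidiag D t).filter fun v => v e = t - 1 := by
    ext v
    simp only [boundedAntidiag, Finset.mem_filter, Finset.mem_finsuppAntidiag]
    refine ⟨fun h => ⟨h.1.1, by omega⟩, fun h => ⟨⟨h.1, fun i hi => ?_⟩, by omega⟩⟩
    by_cases hie : i = e
    · subst hie; omega
    · have h2 := h.1.1
      rw [← Finset.add_sum_erase _ _ he,
        ← Finset.add_sum_erase _ _ (Finset.mem_erase.2 ⟨hie, hi⟩)] at h2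
      omega
  rw [h1, card_filter_apply_eq he (by omega), show t - (t - 1) = 1 by omega,
    Finset.card_finsuppAntidiag_nat_eq_choose, Finset.card_erase_of_mem he]
  simp

theorem filter_boundedAntidiag_two (D : Finset (Fin s)) :
    ((boundedAntidiag 2 D 2).filter fun v =>
      ((initialPart D).filter fun i => v i + 1 = 2).card = 2) =
      boundedAntidiag 2 (initialPart D) 2 := by
  have hsub : initialPart D ⊆ D := Finset.filter_subset _ _
  have hcard : ∀ v : Fin s →₀ ℕ, (∀ i ∈ initialPart D, v i < 2) →
      ((initialPart D).filter fun i => v i + 1 = 2).card = ∑ i ∈ initialPart D, v i := by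
    intro v hv
    rw [Finset.card_filter]
    refine Finset.sum_congr rfl fun i hi => ?_
    have := hv i hi
    split_ifs <;> omega
  ext v
  simp only [boundedAntidiag, Finset.mem_filter, Finset.mem_finsuppAntidiag]
  constructor
  · rintro ⟨⟨⟨h1, h2⟩, h3⟩, h4⟩
    have h5 := fun i hi => h3 i (hsub hi)
    rw [hcard v h5] at h4
    refine ⟨⟨h4, fun i hi => ?_⟩, h5⟩
    by_contra hcon
    have h6 := Finset.sum_le_sum_of_subset (f := v)
      (Finset.insert_subset (h2 hi) hsub)
    rw [Finset.sum_insert hcon, h1, h4] at h6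
    exact (Finsupp.mem_support_iff.1 hi) (by omega)
  · rintro ⟨⟨h1, h2⟩, h3⟩
    have h0 : ∀ i ∉ initialPart D, v i = 0 := fun i hi =>
      Finsupp.notMem_support_iff.1 fun h => hi (h2 h)
    refine ⟨⟨⟨?_, h2.trans hsub⟩, fun i _ => ?_⟩, by rw [hcard v h3, h1]⟩
    · rw [← h1]
      exact (Finset.sum_subset hsub fun i _ hi => h0 i hi).symm
    · by_cases hi : i ∈ initialPart D
      · exact h3 i hi
      · rw [h0 i hi]
        omega

end Gluing

/-! ### Contribution of the generators with given maximum and number of low positions -/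

section Counting

variable {s : ℕ}

/-- The number of generators with top exponent `t` and `d` low positions of total exponent `n`,
each weighted by a binomial coefficient of its number of directions. -/
noncomputable def stratumSum (s t d n r : ℕ) : ℤ :=
  ∑ D ∈ Finset.powersetCard d (Finset.univ : Finset (Fin s)), ∑ v ∈ boundedAntidiag t D n,
    ((d - ((initialPart D).filter fun i => v i + 1 = t).card).choose r : ℤ)

theorem sum_filter_starGens_eq_stratumSum {c m t d : ℕ} (hcs : c < s) (hd : d < c)
    (hm : (c - d) * t ≤ m) (r : ℕ) :
    ∑ γ ∈ (finite_starGens (s := s) (m := m) hcs).toFinset.filter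
      (fun γ => topExp γ = t ∧ (lowPos γ).card = d), ((genDirs γ).card.choose r : ℤ) =
    stratumSum s t d (m - (c - d) * t) r := by
  rw [sum_filter_starGens hcs hd hm, stratumSum]
  refine Finset.sum_congr rfl fun D hD => Finset.sum_congr rfl fun v hv => ?_
  have hD := (Finset.mem_powersetCard.1 hD).2
  rw [card_genDirs_glueExp (by omega) (Finset.mem_filter.1 hv).2, hD]

/-- With d low positions (c-d)t ≤ m ≤ 2t, so c-d is 1 or 2, and 2 forces m = 2t. -/
theorem sum_topExp_eq_stratumSum {c m t : ℕ} (hc : 2 ≤ c) (hcs : c < s) (ht : 0 < t)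
    (hmt : m ≤ 2 * t) (htm : t ≤ m) (r : ℕ) :
    ∑ γ ∈ (finite_starGens (s := s) (m := m) hcs).toFinset.filter (fun γ => topExp γ = t),
      ((genDirs γ).card.choose r : ℤ) =
    stratumSum s t (c - 1) (m - t) r + if m = 2 * t then stratumSum s t (c - 2) 0 r else 0 := by
  have hdiff : ∀ γ : Fin s →₀ ℕ, IsStarGen c m γ → topExp γ = t →
      (lowPos γ).card = c - 1 ∨ ((lowPos γ).card = c - 2 ∧ m = 2 * t) := by
    intro γ hγ hγt
    have h1 := hγ.card_lowPos
    have h2 := hγ.mul_topExp_le hcs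
    rw [hγt] at h2
    have h3 : c - (lowPos γ).card ≤ 2 := Nat.le_of_mul_le_mul_right (h2.trans hmt) ht
    by_cases h4 : (lowPos γ).card = c - 1
    · exact Or.inl h4
    · rw [show c - (lowPos γ).card = 2 by omega] at h2
      exact Or.inr ⟨by omega, by omega⟩
  have h1 := sum_filter_starGens_eq_stratumSum (s := s) (c := c) (m := m) (t := t) (d := c - 1) hcs
    (by omega) (by rw [show c - (c - 1) = 1 by omega]; omega) r
  rw [show c - (c - 1) = 1 by omega, one_mul] at h1
  rw [← h1, ← Finset.sum_filter_add_sum_filter_not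
    ((finite_starGens (s := s) (m := m) hcs).toFinset.filter (fun γ => topExp γ = t))
    (fun γ => (lowPos γ).card = c - 1), Finset.filter_filter, Finset.filter_filter]
  congr 1
  split_ifs with h
  · have h2 := sum_filter_starGens_eq_stratumSum (s := s) (c := c) (m := m) (t := t) (d := c - 2)
      hcs (by omega) (by rw [show c - (c - 2) = 2 by omega]; omega) r
    rw [show c - (c - 2) = 2 by omega, h, Nat.sub_self] at h2
    subst h
    rw [← h2]
    refine Finset.sum_congr (Finset.filter_congr fun γ hγ => ?_) fun _ _ => rfl
    have hγ : IsStarGen c (2 * t) γ := by simpa using hγ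
    refine ⟨fun h3 => ⟨h3.1, ?_⟩, fun h3 => ⟨h3.1, by omega⟩⟩
    exact ((hdiff γ hγ h3.1).resolve_left h3.2).1
  · refine Finset.sum_eq_zero fun γ hγ => absurd hγ ?_
    simp only [Finset.mem_filter, Set.Finite.mem_toFinset, not_and, not_not]
    exact fun h3 h4 => (hdiff γ h3 h4).resolve_right fun h5 => h h5.2

/-- The total n is less than t-1, so no direction is lost. -/
theorem stratumSum_of_lt {t d n : ℕ} (h : n + 1 < t) (r : ℕ) :
    stratumSum s t d n r = s.choose d * ((d + n - 1).choose n * d.choose r) := by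
  rw [stratumSum, Finset.sum_congr rfl (g := fun _ => ((d + n - 1).choose n * d.choose r : ℤ))]
  · simp
  intro D hD
  have hD := (Finset.mem_powersetCard.1 hD).2
  rw [boundedAntidiag_of_lt (by omega), Finset.sum_congr rfl (g := fun _ => (d.choose r : ℤ))]
  · rw [Finset.sum_const, Finset.card_finsuppAntidiag_nat_eq_choose, hD, nsmul_eq_mul]
  intro v hv
  rw [Finset.filter_false_of_mem, Finset.card_empty, Nat.sub_zero]
  intro i hi
  have h1 := Finset.single_le_sum (f := v) (fun _ _ => Nat.zero_le _)
    (Finset.filter_subset _ _ hi : i ∈ D)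
  rw [(Finset.mem_finsuppAntidiag.1 hv).1] at h1
  omega

theorem sum_card_initialPart {d : ℕ} (hd : d < s) :
    ∑ D ∈ Finset.powersetCard d (Finset.univ : Finset (Fin s)), ((initialPart D).card : ℤ) =
      s.choose (s - d + 1) := by
  rw [← sum_choose_initialPart 1 hd]
  simp

/-- An entry t-1 = n uses up the whole sum, so each element of the initial part is lost for exactly
one v. -/
theorem stratumSum_of_succ_eq {d n : ℕ} (hn : 0 < n) (hd : d < s) (r : ℕ) :
    stratumSum s (n + 1) d n r = s.choose d * ((d + n - 1).choose n * d.choose r) -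
      s.choose (s - d + 1) * ((d.choose r : ℤ) - (d - 1).choose r) := by
  rw [stratumSum, Finset.sum_congr rfl (g := fun D => ((d + n - 1).choose n * d.choose r : ℤ) -
    (initialPart D).card * ((d.choose r : ℤ) - (d - 1).choose r))]
  · rw [Finset.sum_sub_distrib, Finset.sum_const, ← Finset.sum_mul, sum_card_initialPart hd]
    simp
  intro D hD
  have hD := (Finset.mem_powersetCard.1 hD).2
  rw [boundedAntidiag_of_lt (by omega), sum_choose_of_le_one _ _
    (fun v hv => card_filter_initialPart_le_one (by omega) hv),
    sum_card_filter_initialPart _ D _ 1, Finset.card_finsuppAntidiag_nat_eq_choose, hD, mul_one]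
  intro e he
  simp only [Nat.add_right_cancel_iff]
  rw [card_filter_apply_eq (Finset.filter_subset _ _ he) le_rfl]
  simp

theorem cast_card_boundedAntidiag_self {t : ℕ} (ht : 0 < t) (D : Finset (Fin s)) :
    ((boundedAntidiag t D t).card : ℤ) = (D.card + t - 1).choose t - D.card := by
  rw [← Finset.card_finsuppAntidiag_nat_eq_choose, ← card_boundedAntidiag_self ht D]
  push_cast
  ring

theorem stratumSum_self_of_three_le {t d : ℕ} (ht : 3 ≤ t) (hd : d < s) (r : ℕ) :
    stratumSum s t d t r = s.choose d * (((d + t - 1).choose t - d) * d.choose r) -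
      s.choose (s - d + 1) * ((d - 1 : ℕ) * ((d.choose r : ℤ) - (d - 1).choose r)) := by
  rw [stratumSum, Finset.sum_congr rfl (g := fun D => (((d + t - 1).choose t - d) * d.choose r : ℤ) -
    (initialPart D).card * ((d - 1 : ℕ) * ((d.choose r : ℤ) - (d - 1).choose r)))]
  · rw [Finset.sum_sub_distrib, Finset.sum_const, ← Finset.sum_mul, sum_card_initialPart hd]
    simp
  intro D hD
  have hD := (Finset.mem_powersetCard.1 hD).2
  rw [sum_choose_of_le_one (boundedAntidiag t D t) _
    (fun v hv => card_filter_initialPart_le_one (by omega) (Finset.filter_subset _ _ hv)),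
    sum_card_filter_initialPart _ D _ (d - 1), cast_card_boundedAntidiag_self (by omega), hD]
  · push_cast
    ring
  intro e he
  rw [card_filter_boundedAntidiag_self (by omega) (Finset.filter_subset _ _ he), hD]

/-- Here v is the indicator of a pair; both of its elements may lie in the initial part, whence the
second difference. -/
theorem stratumSum_two {d : ℕ} (hd : d < s) (r : ℕ) :
    stratumSum s 2 d 2 r = s.choose d * (d.choose 2 * d.choose r) -
      s.choose (s - d + 1) * ((d - 1 : ℕ) * ((d.choose r : ℤ) - (d - 1).choose r)) +
      s.choose (s - d + 2) * ((d.choose r : ℤ) - 2 * (d - 1).choose r + (d - 2).choose r) := by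
  have hcard : ∀ D : Finset (Fin s), ((boundedAntidiag 2 D 2).card : ℤ) = D.card.choose 2 := by
    intro D
    rw [cast_card_boundedAntidiag_self (by omega), show D.card + 2 - 1 = D.card + 1 by omega,
      Nat.choose_succ_succ' D.card 1]
    simp
  rw [stratumSum, Finset.sum_congr rfl (g := fun D => ((d.choose 2 * d.choose r : ℤ) -
    (initialPart D).card * ((d - 1 : ℕ) * ((d.choose r : ℤ) - (d - 1).choose r))) +
    ((initialPart D).card.choose 2 : ℕ) *
      ((d.choose r : ℤ) - 2 * (d - 1).choose r + (d - 2).choose r))]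
  · rw [Finset.sum_add_distrib, Finset.sum_sub_distrib, Finset.sum_const, ← Finset.sum_mul,
      ← Finset.sum_mul, sum_card_initialPart hd, ← Nat.cast_sum, sum_choose_initialPart 2 hd]
    simp
  intro D hD
  have hD := (Finset.mem_powersetCard.1 hD).2
  rw [sum_choose_of_le_two, sum_card_filter_initialPart _ D _ (d - 1), hcard, hD,
    filter_boundedAntidiag_two, hcard]
  · push_cast
    ring
  · intro e he
    rw [card_filter_boundedAntidiag_self le_rfl (Finset.filter_subset _ _ he), hD]
  · intro v hv
    have h1 := (Finset.mem_finsuppAntidiag.1 (Finset.filter_subset _ _ hv)).1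
    rw [← h1, Finset.card_filter]
    refine le_trans ?_ (Finset.sum_le_sum_of_subset (Finset.filter_subset _ _ : initialPart D ⊆ D))
    refine Finset.sum_le_sum fun i _ => ?_
    split_ifs <;> omega

theorem stratumSum_one_one (d r : ℕ) : stratumSum s 1 d 1 r = 0 := by
  refine Finset.sum_eq_zero fun D _ => Finset.sum_eq_zero fun v hv => absurd hv ?_
  simp only [boundedAntidiag, Finset.mem_filter, Finset.mem_finsuppAntidiag, not_and]
  intro h1 h2
  rw [Finset.sum_eq_zero fun i hi => Nat.lt_one_iff.1 (h2 i hi)] at h1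
  exact absurd h1.1 (by omega)

/-- Only v = 0 remains, and since t-1 = 0 the whole initial part is lost. -/
theorem stratumSum_one_zero (d r : ℕ) :
    stratumSum s 1 d 0 r = ∑ D ∈ Finset.powersetCard d (Finset.univ : Finset (Fin s)),
      ((d - (initialPart D).card).choose r : ℤ) := by
  refine Finset.sum_congr rfl fun D _ => ?_
  rw [boundedAntidiag_of_lt (by omega)]
  simp

end Counting

/-! ### Integer binomial coefficients -/

section Binom

theorem binom_of_neg {a b : ℤ} (hb : b < 0) : binom a b = 0 := if_pos hb

theorem binom_eq_choose {a b : ℤ} (x y : ℕ) (ha : a = x) (hb : b = y) :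
    binom a b = x.choose y := by
  subst ha hb
  rw [binom, if_neg (by omega), Int.toNat_natCast, Ring.choose_natCast]

/-- Symmetry that remains valid for negative b, where y > x and both sides vanish. -/
theorem binom_eq_choose_of_add_eq {b : ℤ} (x y : ℕ) (h : b + y = x) :
    binom x b = x.choose y := by
  rcases lt_or_ge b 0 with hb | hb
  · rw [binom_of_neg hb, Nat.choose_eq_zero_of_lt (by omega), Nat.cast_zero]
  · lift b to ℕ using hb
    rw [binom_eq_choose x b rfl rfl, Nat.choose_symm_of_eq_add (by omega : x = b + y)]

theorem binom_pred {d r : ℕ} (hd : 0 < d) :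
    binom (d - 1) (r - 1) = (d.choose r : ℤ) - (d - 1).choose r := by
  obtain ⟨d, rfl⟩ := Nat.exists_eq_succ_of_ne_zero hd.ne'
  cases r with
  | zero => simp [binom_of_neg]
  | succ r =>
    rw [binom_eq_choose d r (by push_cast; ring) (by push_cast; ring), Nat.succ_sub_one,
      Nat.succ_eq_add_one, Nat.choose_succ_succ']
    push_cast
    ring

theorem ceil_half (m : ℕ) : ⌈(m : ℚ) / 2⌉₊ = (m + 1) / 2 := by
  refine eq_of_forall_ge_iff fun a => ?_
  rw [Nat.ceil_le, div_le_iff₀ two_pos]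
  norm_cast
  omega

end Binom

/-! ### The contributions in the form of the theorem -/

section StratumValues

variable {s : ℕ}

theorem stratumSum_odd {d n : ℕ} (hd : 0 < d) (hds : d < s) (hn : 0 < n) (r : ℕ) :
    stratumSum s (n + 1) d n r =
      binom d r * binom (d - 1 + n) (d - 1) * binom s d - binom (d - 1) (r - 1) * binom s (d - 1) := by
  rw [stratumSum_of_succ_eq hn hds, binom_pred hd, binom_eq_choose d r rfl rfl,
    binom_eq_choose (d + n - 1) (d - 1) (by omega) (by omega), binom_eq_choose s d rfl rfl,
    binom_eq_choose_of_add_eq s (s - d + 1) (by omega),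
    Nat.choose_symm_of_eq_add (by omega : d + n - 1 = d - 1 + n)]
  ring

theorem stratumSum_large {t d n : ℕ} (hd : 0 < d) (h : n + 1 < t) (r : ℕ) :
    stratumSum s t d n r = binom d r * binom (d - 1 + n) (d - 1) * binom s d := by
  rw [stratumSum_of_lt h, binom_eq_choose d r rfl rfl,
    binom_eq_choose (d + n - 1) (d - 1) (by omega) (by omega), binom_eq_choose s d rfl rfl,
    Nat.choose_symm_of_eq_add (by omega : d + n - 1 = d - 1 + n)]
  ring

theorem stratumSum_zero {t d : ℕ} (ht : 1 < t) (r : ℕ) :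
    stratumSum s t d 0 r = binom d r * binom s d := by
  rw [stratumSum_of_lt (by omega), binom_eq_choose d r rfl rfl, binom_eq_choose s d rfl rfl]
  simp [mul_comm]

theorem stratumSum_one {d r : ℕ} (hds : d < s) (hr : r ≤ d + 1) :
    stratumSum s 1 d 0 r = binom s (d - r) * binom (s - d - 1 + r) r := by
  rw [stratumSum_one_zero]
  rcases Nat.lt_or_ge d r with h | h
  · rw [binom_of_neg (by omega), zero_mul]
    refine Finset.sum_eq_zero fun D _ => ?_
    rw [Nat.choose_eq_zero_of_lt (by omega), Nat.cast_zero]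
  · rw [← Nat.cast_sum, sum_choose_sub_initialPart hds h,
      binom_eq_choose s (d - r) rfl (by omega),
      binom_eq_choose (s - d - 1 + r) r (by omega) rfl, Nat.cast_mul]

theorem choose_mul_pred {d : ℕ} (hd : 0 < d) (hds : d < s) :
    (s.choose (s - d + 1) : ℤ) * (d - 1 : ℕ) = s.choose (s - d + 2) * (s - d + 2) := by
  have h := Nat.choose_succ_right_eq s (s - d + 1)
  rw [show s - (s - d + 1) = d - 1 by omega] at h
  rw [← Nat.cast_mul, ← h]
  push_cast [hds.le]
  ring

theorem stratumSum_self {t d : ℕ} (hd : 0 < d) (hds : d < s) (ht : 3 ≤ t) (r : ℕ) :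
    stratumSum s t d t r = binom d r * binom s d * (binom (d - 1 + t) t - d) -
      binom (d - 1) (r - 1) * binom s (d - 2) * (s - d + 2) := by
  rw [stratumSum_self_of_three_le ht hds, ← mul_assoc (s.choose (s - d + 1) : ℤ),
    choose_mul_pred hd hds, binom_pred hd, binom_eq_choose d r rfl rfl,
    binom_eq_choose (d + t - 1) t (by omega) rfl, binom_eq_choose s d rfl rfl,
    binom_eq_choose_of_add_eq s (s - d + 2) (by omega)]
  ring

theorem cast_choose_two_mul_two (x : ℕ) : (x.choose 2 : ℤ) * 2 = x * (x - 1) := by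
  have h := Nat.choose_succ_right_eq x 1
  cases x with
  | zero => simp
  | succ x =>
    rw [Nat.choose_one_right, Nat.add_sub_cancel] at h
    rw [Nat.cast_succ, add_sub_cancel_right]
    exact_mod_cast h

theorem stratumSum_self_two {d : ℕ} (hd : 0 < d) (hds : d < s) (r : ℕ) :
    stratumSum s 2 d 2 r = binom s (d - 2) * (binom (d - 2) r + binom (d - 1) r * (s - d) +
      binom d r * binom (s - d + 1) 2) := by
  have hB := choose_mul_pred hd hds
  have hA : (s.choose d : ℤ) * d = s.choose (s - d + 1) * (s - d + 1) := by
    have h := Nat.choose_succ_right_eq s (s - d)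
    rw [show s - (s - d) = d by omega, Nat.choose_symm hds.le] at h
    rw [← Nat.cast_mul, ← h]
    push_cast [hds.le]
    ring
  -- All terms are reduced to multiples of C(s, s-d+2) = C(s, d-2).
  have hC : (s.choose d : ℤ) * d.choose 2 =
      s.choose (s - d + 2) * ((s - d + 1).choose 2 + (s - d + 1)) := by
    have h1 := cast_choose_two_mul_two d
    have h2 := cast_choose_two_mul_two (s - d + 1)
    push_cast [hds.le, hd] at h1 h2 hB
    refine mul_right_cancel₀ (two_ne_zero (α := ℤ)) ?_
    linear_combination (s.choose d : ℤ) * h1 - (s.choose (s - d + 2) : ℤ) * h2 +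
      ((d : ℤ) - 1) * hA + ((s : ℤ) - d + 1) * hB
  have hD : binom s (d - 2) * binom (d - 2) r =
      (s.choose (s - d + 2) : ℤ) * (d - 2).choose r := by
    rw [binom_eq_choose_of_add_eq s (s - d + 2) (by omega)]
    rcases Nat.lt_or_ge d 2 with h | h
    · rw [Nat.choose_eq_zero_of_lt (by omega : s < s - d + 2)]
      simp
    · rw [binom_eq_choose (d - 2) r (by omega) rfl]
  rw [stratumSum_two hds, mul_add (binom s (d - 2)), mul_add (binom s (d - 2)), hD,
    binom_eq_choose_of_add_eq s (s - d + 2) (by omega),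
    binom_eq_choose (d - 1) r (by omega) rfl, binom_eq_choose d r rfl rfl,
    binom_eq_choose (b := 2) (s - d + 1) 2 (by omega) rfl]
  linear_combination (d.choose r : ℤ) * hC - ((d.choose r : ℤ) - (d - 1).choose r) * hB

end StratumValues

/-! ### The Betti numbers -/

section MainTheorem

/-- Forms of degree 0 are constants: 0 is a zero divisor, and a nonzero constant generates the unit
ideal. -/
theorem AnyFormRegularSequence.degree_pos {σ k : Type*} [Field k] {s r δ : ℕ}
    {F : Fin s → MvPolynomial σ k} (h : AnyFormRegularSequence F (r + 1)) (hr : r < s)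
    (hdeg : ∀ a, (F a).IsHomogeneous δ) : 0 < δ := by
  by_contra hδ
  obtain rfl : δ = 0 := by omega
  have hreg := h (Fin.castLE hr) (Fin.castLE_injective hr)
  set f := F (Fin.castLE hr 0) with hf
  obtain ⟨a, ha⟩ : ∃ a, f = MvPolynomial.C a :=
    ⟨_, MvPolynomial.totalDegree_eq_zero_iff_eq_C.1 (Nat.le_zero.1 (hdeg _).totalDegree_le)⟩
  have hmem : f ∈ List.ofFn fun a => F (Fin.castLE hr a) := List.mem_ofFn.2 ⟨0, rfl⟩
  have hne : a ≠ 0 := by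
    rintro rfl
    have h1 := hreg.toIsWeaklyRegular
    rw [List.ofFn_succ, RingTheory.Sequence.isWeaklyRegular_cons_iff] at h1
    have h2 := h1.1 (a₁ := 0) (a₂ := 1)
    rw [← hf, ha] at h2
    simp at h2
  refine hreg.top_ne_smul ?_
  have htop : Ideal.ofList (List.ofFn fun a => F (Fin.castLE hr a)) = ⊤ :=
    Ideal.eq_top_of_isUnit_mem _ (Ideal.subset_span hmem)
      (ha ▸ (isUnit_iff_ne_zero.2 hne).map MvPolynomial.C)
  rw [htop]
  simp

/-- Since s-c and δ are positive, the degree of F^γ determines the largest entry of γ. -/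
theorem betti_eq_sum_topExp {σ k : Type*} [Field k] {s c m δ : ℕ} (hc : 0 < c) (hcs : c < s)
    (hm : 0 < m) (hδ : 0 < δ) {F : Fin s → MvPolynomial σ k} (hdeg : ∀ a, (F a).IsHomogeneous δ)
    (hF : RegularUpTo F c)
    (G : MinimalGradedFreeResolution (monomialIdeal F {γ | IsStarGen c m γ})) (t r : ℕ) :
    (G.betti (r + 1) (δ * (t * (s - c) + m + (r + 1) - 1)) : ℤ) =
      ∑ γ ∈ (finite_starGens (s := s) (m := m) hcs).toFinset.filter (fun γ => topExp γ = t),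
        ((genDirs γ).card.choose r : ℤ) := by
  obtain ⟨Z, hZ, hbetti⟩ := exists_star_resolution hc hcs hm hδ hdeg hF
  rw [G.betti_eq (isHomogeneousIdeal_monomialIdeal hdeg _) hZ, hbetti, Finset.sum_filter,
    Nat.cast_sum]
  refine Finset.sum_congr rfl fun γ hγ => ?_
  have hγ : IsStarGen c m γ := by simpa using hγ
  have hiff : δ * (t * (s - c) + m + (r + 1) - 1) = δ * (∑ a, γ a + r) ↔ topExp γ = t := by
    rw [hγ.sum_eq, Nat.mul_right_inj hδ.ne']
    have h0 : 0 < s - c := by omega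
    rw [show t * (s - c) + m + (r + 1) - 1 = m + (s - c) * t + r by rw [mul_comm t]; omega,
      Nat.add_right_cancel_iff, Nat.add_left_cancel_iff, Nat.mul_right_inj h0.ne', eq_comm]
  rw [if_congr hiff rfl rfl]
  split_ifs <;> simp

theorem theorem7 {k : Type*} [Field k] (n c s δ m : ℕ) (hc : 2 ≤ c) (hcs : c < s) (hm : 1 < m)
    (F : Fin s → MvPolynomial (Fin (n + 1)) k)
    (hdeg : ∀ a, (F a).IsHomogeneous δ)
    (hreg : AnyFormRegularSequence F (c + 1)) :
    Nonempty (MinimalGradedFreeResolution (symbolicPower (starIdeal F c) m)) ∧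
    ∀ G : MinimalGradedFreeResolution (symbolicPower (starIdeal F c) m),
      (∀ t : ℕ, ⌈(m : ℚ) / 2⌉₊ < t → t ≤ m → ∀ i : ℕ, 1 ≤ i → i ≤ c →
        (G.betti i (δ * (t * (s - c) + m + i - 1)) : ℤ) =
          binom (c - 1) (i - 1) * binom (c - 2 + m - t) (c - 2) * binom s (c - 1)) ∧
      (∀ t : ℕ, t = ⌈(m : ℚ) / 2⌉₊ → ∀ i : ℕ, 1 ≤ i → i ≤ c →
        (Odd m →
          (G.betti i (δ * (t * (s - c) + m + i - 1)) : ℤ) =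
            binom (c - 1) (i - 1) * binom (c - 2 + m - t) (c - 2) * binom s (c - 1)
              - binom (c - 2) (i - 2) * binom s (c - 2)) ∧
        (m = 2 →
          (G.betti i (δ * (t * (s - c) + m + i - 1)) : ℤ) =
            binom s (c - 1 - i) * binom (s - c + i) (i - 1)) ∧
        (m = 4 →
          (G.betti i (δ * (t * (s - c) + m + i - 1)) : ℤ) =
            binom (c - 2) (i - 1) * binom s (c - 2)
              + binom s (c - 3) * (binom (c - 3) (i - 1) + binom (c - 2) (i - 1) * (s - c + 1)
                + binom (c - 1) (i - 1) * binom (s - c + 2) 2)) ∧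
        (Even m → 4 < m →
          (G.betti i (δ * (t * (s - c) + m + i - 1)) : ℤ) =
            binom (c - 2) (i - 1) * binom s (c - 2)
              + binom (c - 1) (i - 1) * binom s (c - 1) * (binom (c - 2 + t) t - (c - 1))
              - binom (c - 2) (i - 2) * binom s (c - 3) * (s - c + 3))) := by
  have hF := hreg.regularUpTo hcs
  have hδ := hreg.degree_pos hcs hdeg
  rw [symbolicPower_starIdeal (by omega) hcs (by omega) hF]
  constructor
  · obtain ⟨Z, hZ, -⟩ := exists_star_resolution (m := m) (by omega) hcs (by omega) hδ hdeg hF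
    exact hZ.nonempty
  intro G
  have hbetti : ∀ t r : ℕ, m ≤ 2 * t → t ≤ m →
      (G.betti (r + 1) (δ * (t * (s - c) + m + (r + 1) - 1)) : ℤ) =
        stratumSum s t (c - 1) (m - t) r +
          if m = 2 * t then stratumSum s t (c - 2) 0 r else 0 := by
    intro t r h1 h2
    rw [betti_eq_sum_topExp (by omega) hcs (by omega) hδ hdeg hF,
      sum_topExp_eq_stratumSum hc hcs (by omega) h1 h2]
  have e1 : ((c - 1 : ℕ) : ℤ) = c - 1 := by omega
  have e2 : ((c - 2 : ℕ) : ℤ) = c - 2 := by omega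
  rw [ceil_half]
  -- With n = m - t the cases are n + 1 < t, then n + 1 = t, then n = t for t = 1, for t = 2 and for
  -- t ≥ 3.
  refine ⟨fun t ht htm i hi hic => ?_, fun t ht i hi hic => ⟨fun hodd => ?_, ?_, ?_, ?_⟩⟩ <;>
    obtain ⟨r, rfl⟩ : ∃ r, i = r + 1 := ⟨i - 1, by omega⟩
  · rw [hbetti t r (by omega) htm, if_neg (by omega), stratumSum_large (by omega) (by omega), e1,
      Nat.cast_sub htm]
    push_cast
    ring_nf
  · obtain ⟨q, rfl⟩ := hodd
    obtain rfl : t = q + 1 := by omega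
    rw [hbetti _ r (by omega) (by omega), if_neg (by omega), show 2 * q + 1 - (q + 1) = q by omega,
      stratumSum_odd (by omega) (by omega) (by omega), e1]
    push_cast
    ring_nf
  · rintro rfl
    obtain rfl : t = 1 := by omega
    rw [hbetti _ r (by omega) (by omega), if_pos rfl, show 2 - 1 = 1 from rfl, stratumSum_one_one,
      stratumSum_one (by omega) (by omega), e2]
    push_cast
    ring_nf
  · rintro rfl
    obtain rfl : t = 2 := by omega
    rw [hbetti _ r (by omega) (by omega), if_pos rfl, show 4 - 2 = 2 from rfl,
      stratumSum_self_two (by omega) (by omega), stratumSum_zero (by omega), e1, e2]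
    push_cast
    ring_nf
  · intro heven h4
    obtain ⟨q, rfl⟩ := heven
    obtain rfl : t = q := by omega
    rw [hbetti _ r (by omega) (by omega), if_pos (by omega), show t + t - t = t by omega,
      stratumSum_self (by omega) (by omega) (by omega), stratumSum_zero (by omega), e1, e2]
    push_cast
    ring_nf

end MainTheorem
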